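/- All graphs are undirected, simple (no loops, no multiple edges) and connected, and may be infinite and not locally finite; $d$ is the graph distance. A graph is *weakly modular* if for every vertex $u$: (TC) whenever $1=d(v,w)<d(u,v)=d(u,w)$, there is a common neighbor $x$ of $v,w$ with $d(u,x)=d(u,v)-1$; and (QC) whenever $d(v,z)=d(w,z)=1$ and $2=d(v,w)\le d(u,v)=d(u,w)=d(u,z)-1$, there is a common neighbor $x$ of $v,w$ with $d(u,x)=d(u,v)-1$. It is *locally weakly modular* if for every vertex $u$: whenever $v\sim w$ and $d(u,v)=d(u,w)=2$, the vertices $u,v,w$ have a common neighbor; and whenever $z\sim v,w$ and $d(v,w)=d(u,v)=d(u,w)=d(u,z)-1=2$, the vertices $u,v,w$ have a common neighbor. $W_4$ is a $4$-cycle together with a vertex adjacent to all its vertices; $W_4^-$ is $W_4$ with one of the four edges at that vertex removed. $M_4$ is the graph formed by an induced $4$-cycle $(x_1,x_2,x_3,x_4)$ and four pairwise adjacent vertices $a_1,a_2,a_3,a_4$, where $a_i$ is adjacent to exactly the vertices $x_i,x_{i+1}$ of the cycle (indices modulo $4$). A *square* is an induced $4$-cycle. A graph is *pre-median* if it is weakly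 modular and contains no induced $K_{2,3}$ and no induced $W_4^-$. A set $A$ of vertices is *gated* if for every vertex $x\notin A$ there is $x'\in A$ with $d(x,y)=d(x,x')+d(x',y)$ for all $y\in A$. A graph with at least two vertices is *prime* if it is neither isomorphic to the Cartesian product of two graphs with at least two vertices each, nor a gated amalgam of smaller graphs, i.e. the union of two intersecting subgraphs induced by gated proper subsets of the vertex set. A graph is *2-connected* if it is connected, has at least two vertices, and remains connected after the deletion of any one vertex (so $K_2$ is 2-connected). The *clique complex* $X(G)$ is the simplicial complex whose simplices are the nonempty finite cliques of $G$, and the *triangle complex* $X_{\triangle}(G)$ is its $2$-skeleton; simple connectivity is that of the geometric realization. **Theorem.** For a connected graph $G$, the following conditions are equivalent: 1. $G$ is a prime pre-median graph; 2. $G$ is a 2-connected pre-median graph and every square of $G$ is included in an induced $W_4$ or an induced $M_4$; 3. $G$ is a 2-connected pre-median graph and its triangle complex $X_{\triangle}(G)$ is simply connected; 4. $G$ is a 2-connected pre-median graph and its clique complex $X(G)$ is simply connected; 5. $G$ is a 2-connected locally weakly modular graph that contains no induced $K_{2,3}$ and no induced $W_4^-$, and its triangle complex $X_{\triangle}(G)$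 is simply connected. -/

import Mathlib

open scoped SimpleGraph

section GeometricRealization

variable {V : Type*}

/-- A point of the geometric realization of an abstract simplicial complex `K`: a family of
barycentric coordinates, that is, nonnegative reals indexed by the vertices which vanish outside
some face of `K` and add up to `1`. -/
@[ext]
structure AbstractSimplicialComplex.Realization (K : AbstractSimplicialComplex V) where
  coord : V → ℝ
  coord_nonneg : ∀ v, 0 ≤ coord v
  exists_face : ∃ s ∈ K, (∀ v ∉ s, coord v = 0) ∧ ∑ v ∈ s, coord v = 1

open Classical in
/-- The characteristic map of a face `s`: it sends the standard simplex on the vertex set `s`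
onto the closed simplex of the realization spanned by `s`, extending barycentric coordinates
by zero. -/
noncomputable def AbstractSimplicialComplex.Realization.ofFace (K : AbstractSimplicialComplex V)
    (s : Finset V) (hs : s ∈ K) (x : stdSimplex ℝ s) : K.Realization where
  coord v := if h : v ∈ s then x.1 ⟨v, h⟩ else 0
  coord_nonneg v := by
    by_cases h : v ∈ s
    · simpa [h] using x.2.1 ⟨v, h⟩
    · simp [h]
  exists_face := by
    refine ⟨s, hs, fun v hv => dif_neg hv, ?_⟩
    rw [← Finset.sum_coe_sort s]
    simpa using x.2.2

/-- The CW (weak, coherent) topology of the realization: a set is open iff its preimage under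
the characteristic map of every face is open in the Euclidean standard simplex. -/
noncomputable instance AbstractSimplicialComplex.Realization.instTopologicalSpace
    (K : AbstractSimplicialComplex V) : TopologicalSpace K.Realization :=
  ⨆ s : {s : Finset V // s ∈ K},
    TopologicalSpace.coinduced (AbstractSimplicialComplex.Realization.ofFace K s.1 s.2)
      inferInstance

end GeometricRealization

namespace SimpleGraph

variable {V : Type*}

/-! ### The clique complex and the triangle complex -/

/-- The clique complex `X(G)`: its simplices are the nonempty finite cliques. -/
def cliqueComplex (G : SimpleGraph V) : AbstractSimplicialComplex V where
  faces := {s | s.Nonempty ∧ G.IsClique (s : Set V)}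
  isRelLowerSet_faces := by
    rintro s ⟨hs, hc⟩
    refine ⟨hs, fun t hts ht => ⟨ht, hc.subset ?_⟩⟩
    exact_mod_cast hts
  singleton_mem v := ⟨Finset.singleton_nonempty v, by simp⟩

/-- The triangle complex of `G`: the two-dimensional complex whose 1-skeleton is `G` and whose
2-cells are the triangles of `G`. -/
def triangleComplex (G : SimpleGraph V) : AbstractSimplicialComplex V where
  faces := {s | s.Nonempty ∧ G.IsClique (s : Set V) ∧ s.card ≤ 3}
  isRelLowerSet_faces := by
    rintro s ⟨hs, hc, h3⟩
    refine ⟨hs, fun t hts ht => ⟨ht, hc.subset ?_, (Finset.card_le_card hts).trans h3⟩⟩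
    exact_mod_cast hts
  singleton_mem v := ⟨Finset.singleton_nonempty v, by simp, by simp⟩

/-! ### Small graphs -/

/-- The wheel `W₄`: the 4-cycle on the vertices `some i` together with a central vertex `none`
adjacent to all of them. -/
def wheelFour : SimpleGraph (Option (Fin 4)) where
  Adj
    | none, none => False
    | none, some _ => True
    | some _, none => True
    | some i, some j => (cycleGraph 4).Adj i j
  symm := ⟨by
    rintro (_ | i) (_ | j) h
    · exact h
    · trivial
    · trivial
    · exact h.symm⟩
  loopless := ⟨by
    rintro (_ | i) h
    · exact h
    · exact (cycleGraph 4).loopless.irrefl i h⟩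

/-- The almost wheel `W₄⁻`: the wheel `W₄` with one spoke removed. -/
def almostWheelFour : SimpleGraph (Option (Fin 4)) :=
  wheelFour.deleteEdges {s(none, some 0)}

/-- The graph `M₄`: a 4-cycle `x₀ x₁ x₂ x₃` (`xᵢ = inl i`) and four pairwise adjacent vertices
`a₀, a₁, a₂, a₃` (`aᵢ = inr i`), where `aⱼ` is adjacent on the cycle exactly to `xⱼ` and `xⱼ₊₁`
(indices modulo 4). -/
def graphMFour : SimpleGraph (Fin 4 ⊕ Fin 4) where
  Adj
    | .inl i, .inl j => (cycleGraph 4).Adj i j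
    | .inr i, .inr j => i ≠ j
    | .inl i, .inr j => i = j ∨ i = j + 1
    | .inr j, .inl i => i = j ∨ i = j + 1
  symm := ⟨by
    rintro (i | i) (j | j) h
    · exact h.symm
    · exact h
    · exact h
    · exact Ne.symm h⟩
  loopless := ⟨by
    rintro (i | i) h
    · exact (cycleGraph 4).loopless.irrefl i h
    · exact h rfl⟩

/-! ### Weakly modular, locally weakly modular and pre-median graphs -/

/-- Weak modularity: the triangle condition and the quadrangle condition hold with respect to
every vertex `u`. -/
def IsWeaklyModular (G : SimpleGraph V) : Prop :=
  ∀ u : V,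
    (∀ v w : V, G.dist v w = 1 → 1 < G.dist u v → G.dist u v = G.dist u w →
      ∃ x, G.Adj x v ∧ G.Adj x w ∧ G.dist u x + 1 = G.dist u v) ∧
    (∀ v w z : V, G.dist v z = 1 → G.dist w z = 1 → G.dist v w = 2 →
      2 ≤ G.dist u v → G.dist u v = G.dist u w → G.dist u w + 1 = G.dist u z →
      ∃ x, G.Adj x v ∧ G.Adj x w ∧ G.dist u x + 1 = G.dist u v)

/-- Local weak modularity: the local triangle condition and the local quadrangle condition hold
with respect to every vertex `u`. -/
def IsLocallyWeaklyModular (G : SimpleGraph V) : Prop :=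
  ∀ u : V,
    (∀ v w : V, G.Adj v w → G.dist u v = 2 → G.dist u w = 2 →
      ∃ x, G.Adj x u ∧ G.Adj x v ∧ G.Adj x w) ∧
    (∀ v w z : V, G.Adj z v → G.Adj z w → G.dist v w = 2 → G.dist u v = 2 →
      G.dist u w = 2 → G.dist u z = 3 →
      ∃ x, G.Adj x u ∧ G.Adj x v ∧ G.Adj x w)

/-- A pre-median graph is a weakly modular graph without induced `K_{2,3}` and `W₄⁻`. -/
def IsPreMedian (G : SimpleGraph V) : Prop :=
  G.IsWeaklyModular ∧ ¬ completeBipartiteGraph (Fin 2) (Fin 3) ⊴ G ∧ ¬ almostWheelFour ⊴ G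

/-! ### Prime graphs -/

/-- A set `A` of vertices is gated if every vertex `x` outside `A` has a gate in `A`: a vertex
`x' ∈ A` that lies on a shortest path from `x` to `y`, for every `y ∈ A`. -/
def IsGated (G : SimpleGraph V) (A : Set V) : Prop :=
  ∀ x ∉ A, ∃ x' ∈ A, ∀ y ∈ A, G.dist x x' + G.dist x' y = G.dist x y

/-- `G` is a Cartesian product of smaller graphs: of two graphs with at least two vertices
each. (A product, or weak product, of a larger family is the product of one nontrivial factor
and the product of the others.) -/
def IsProperCartesianProduct.{u} {V : Type u} (G : SimpleGraph V) : Prop :=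
  ∃ (α β : Type u) (A : SimpleGraph α) (B : SimpleGraph β),
    Nontrivial α ∧ Nontrivial β ∧ Nonempty (G ≃g A □ B)

/-- `G` is a gated amalgam of smaller graphs: the union of two intersecting proper gated
subgraphs, those induced by `A` and `B`. -/
def IsProperGatedAmalgam (G : SimpleGraph V) : Prop :=
  ∃ A B : Set V, G.IsGated A ∧ G.IsGated B ∧ (A ∩ B).Nonempty ∧
    A ≠ Set.univ ∧ B ≠ Set.univ ∧ A ∪ B = Set.univ ∧
    ∀ u v, G.Adj u v → (u ∈ A ∧ v ∈ A) ∨ (u ∈ B ∧ v ∈ B)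

/-- A graph with at least two vertices is prime if it is neither a Cartesian product nor a
gated amalgam of smaller graphs. -/
def IsPrime (G : SimpleGraph V) : Prop :=
  Nontrivial V ∧ ¬ G.IsProperCartesianProduct ∧ ¬ G.IsProperGatedAmalgam

/-! ### 2-connected graphs and squares -/

/-- A graph is 2-connected if it has at least two vertices, is connected, and has no cut vertex:
deleting any vertex `c` leaves a connected graph. (So `K₂`, which is a prime graph, is
2-connected.) -/
def IsTwoConnected (G : SimpleGraph V) : Prop :=
  Nontrivial V ∧ G.Connected ∧ ∀ c : V, (G.induce {c}ᶜ).Connected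

/-- Every square (induced 4-cycle) of `G` is included in an induced `W₄` or in an
induced `M₄`. -/
def SquaresInWheelFourOrMFour (G : SimpleGraph V) : Prop :=
  ∀ q : cycleGraph 4 ↪g G,
    (∃ f : wheelFour ↪g G, Set.range q ⊆ Set.range f) ∨
      (∃ f : graphMFour ↪g G, Set.range q ⊆ Set.range f)

end SimpleGraph

/-! Topology is traded for combinatorics by means of local systems: sets attached to the vertices
and transported along the edges, consistently on triangles. If the triangle complex or the clique
complex is simply connected, every local system has a parallel section through every point: it
defines a covering space glued from trivial pieces over the open stars, and monodromy gives the
section (`hasParallelSections_of_simplyConnectedSpace`). Conversely, a parallel section of the local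
system of path classes from a base vertex determines the class of every path by its ends
(`simplyConnectedSpace_of_hasParallelSections`). What remains concerns graphs only.

From local to global weak modularity: paths from `v₀` are considered up to exchanging an interior
vertex for another common neighbour of its two neighbours. The local conditions make the classes of
reduced paths into a covering of the graph (`reducedPathSystem`). A parallel section shows that it
has one sheet, so every vertex is the end of exactly one class, whose length is the distance from
`v₀`. The triangle and quadrangle conditions are then read off from the way predecessors of a class
meet (`IsLocallyWeaklyModular.isWeaklyModular`).

From primality to squares: in a pre-median graph a square `a b c d` lies in a `W₄` or an `M₄`
exactly when `b` and `d` lie in one component of the link of `a` (`isGoodSquare_of_linkConn`,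
`IsGoodSquare.linkConn`). Hence link components can be carried from vertex to vertex, and a
confluence argument for geodesic descents shows that each one spans a gated set `H`
(`exists_isGated_link`). If a link is disconnected, some such `H` is proper. The fibres of the gate
map to `H` are gated. Either some vertex has no neighbour outside its fibre, and the graph is a
gated amalgam, or the graph is the product of `H` and a fibre. So links in prime graphs are
connected and all squares are good.

If all squares are good, transport along geodesics is well defined by the triangle and quadrangle
conditions, so parallel sections exist (`hasParallelSections_of_isGoodSquare`). Finally, in a
2-connected pre-median graph a proper gated set with two vertices produces a square with exactly one
side in it, and an explicit local system of permutations of three points has nontrivial holonomy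
around that square. Parallel sections therefore leave only trivial gated sets, and the graph is
prime (`HasParallelSections.hasTrivialGatedSets`, `HasTrivialGatedSets.isPrime`). -/

section Realization

open scoped unitInterval

/-! ### The realization: open stars, closed simplices and segments. -/

namespace AbstractSimplicialComplex.Realization

variable {V : Type*} {K : AbstractSimplicialComplex V}

theorem isOpen_iff_forall_face {U : Set K.Realization} :
    IsOpen U ↔ ∀ (s : Finset V) (hs : s ∈ K), IsOpen (ofFace K s hs ⁻¹' U) := by
  refine isOpen_iSup_iff.trans ?_
  simp only [isOpen_coinduced, Subtype.forall]

theorem continuous_ofFace (s : Finset V) (hs : s ∈ K) : Continuous (ofFace K s hs) :=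
  continuous_def.2 fun _ hU => isOpen_iff_forall_face.1 hU s hs

theorem ofFace_coord_of_mem {s : Finset V} {hs : s ∈ K} (x : stdSimplex ℝ s) {v : V}
    (h : v ∈ s) : (ofFace K s hs x).coord v = x.1 ⟨v, h⟩ := by
  simp [ofFace, h]

theorem ofFace_coord_of_notMem {s : Finset V} {hs : s ∈ K} (x : stdSimplex ℝ s) {v : V}
    (h : v ∉ s) : (ofFace K s hs x).coord v = 0 := by
  simp [ofFace, h]

/-- The open star of a vertex. -/
def openStar (K : AbstractSimplicialComplex V) (v : V) : Set K.Realization := {y | 0 < y.coord v}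

theorem isOpen_openStar (v : V) : IsOpen (openStar K v) := by
  refine isOpen_iff_forall_face.2 fun s hs => ?_
  by_cases h : v ∈ s
  · have : ofFace K s hs ⁻¹' openStar K v = {x | 0 < x.1 ⟨v, h⟩} := by
      ext x
      simp [openStar, ofFace_coord_of_mem x h]
    rw [this]
    exact isOpen_lt continuous_const ((continuous_apply _).comp continuous_subtype_val)
  · have : ofFace K s hs ⁻¹' openStar K v = ∅ := by
      ext x
      simp [openStar, ofFace_coord_of_notMem x h]
    rw [this]
    exact isOpen_empty

/-- A point of the realization lies in the closed simplex spanned by `s`. -/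
def SupportedIn (y : K.Realization) (s : Finset V) : Prop := ∀ v ∉ s, y.coord v = 0

theorem exists_supportedIn (y : K.Realization) : ∃ s ∈ K, y.SupportedIn s :=
  let ⟨s, hs, h, _⟩ := y.exists_face
  ⟨s, hs, h⟩

theorem SupportedIn.mem {y : K.Realization} {s : Finset V} (h : y.SupportedIn s) {v : V}
    (hv : 0 < y.coord v) : v ∈ s := by
  by_contra hn
  exact hv.ne' (h v hn)

theorem SupportedIn.sum_eq_one {y : K.Realization} {s : Finset V} (h : y.SupportedIn s) :
    ∑ v ∈ s, y.coord v = 1 := by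
  classical
  obtain ⟨t, -, ht, hsum⟩ := y.exists_face
  rw [← hsum, ← Finset.sum_subset (Finset.inter_subset_left : s ∩ t ⊆ s),
    ← Finset.sum_subset (Finset.inter_subset_right : s ∩ t ⊆ t)]
  · intro v hv hn
    exact h v fun hs => hn (Finset.mem_inter.2 ⟨hs, hv⟩)
  · intro v hv hn
    exact ht v fun hs => hn (Finset.mem_inter.2 ⟨hv, hs⟩)

theorem exists_coord_pos (y : K.Realization) : ∃ v, 0 < y.coord v := by
  by_contra! h
  obtain ⟨s, -, -, hsum⟩ := y.exists_face
  have := Finset.sum_nonpos fun v (_ : v ∈ s) => h v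
  linarith

/-- The barycentric coordinates of a point of a closed simplex. -/
def toFace (y : K.Realization) {s : Finset V} (h : y.SupportedIn s) : stdSimplex ℝ s :=
  ⟨fun v => y.coord v, fun v => y.coord_nonneg v, by
    rw [Finset.sum_coe_sort s y.coord]
    exact h.sum_eq_one⟩

theorem ofFace_toFace (y : K.Realization) {s : Finset V} (hs : s ∈ K) (h : y.SupportedIn s) :
    ofFace K s hs (y.toFace h) = y := by
  ext v
  by_cases hv : v ∈ s
  · rw [ofFace_coord_of_mem _ hv]
    rfl
  · rw [ofFace_coord_of_notMem _ hv, h v hv]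

theorem supportedIn_ofFace {s : Finset V} (hs : s ∈ K) (x : stdSimplex ℝ s) :
    (ofFace K s hs x).SupportedIn s := fun _ hv => ofFace_coord_of_notMem x hv

open Classical in
/-- A vertex, as a point of the realization. -/
noncomputable def vert (K : AbstractSimplicialComplex V) (v : V) : K.Realization where
  coord w := if w = v then 1 else 0
  coord_nonneg _ := by split_ifs <;> simp
  exists_face := ⟨{v}, K.singleton_mem v, fun _ hw => by
    rw [if_neg]
    simpa using hw, by simp⟩

theorem vert_coord_self (v : V) : (vert K v).coord v = 1 := if_pos rfl

theorem vert_coord_of_ne {v w : V} (h : w ≠ v) : (vert K v).coord w = 0 := if_neg h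

theorem supportedIn_vert {v : V} {s : Finset V} (h : v ∈ s) : (vert K v).SupportedIn s :=
  fun _ hw => vert_coord_of_ne fun e => hw (e ▸ h)

instance contractibleSpace_stdSimplex (s : Finset V) [Nonempty s] :
    ContractibleSpace (stdSimplex ℝ s) := by
  classical
  exact (convex_stdSimplex ℝ s).contractibleSpace ⟨_, single_mem_stdSimplex ℝ (Classical.arbitrary s)⟩

/-- The segment between two points of a standard simplex. -/
noncomputable def simplexLine {ι : Type*} [Fintype ι] (x z : stdSimplex ℝ ι) (t : I) :
    stdSimplex ℝ ι :=
  ⟨fun i => (1 - (t : ℝ)) * x.1 i + t * z.1 i, fun i =>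
      add_nonneg (mul_nonneg (sub_nonneg.2 t.2.2) (x.2.1 i)) (mul_nonneg t.2.1 (z.2.1 i)), by
    rw [Finset.sum_add_distrib, ← Finset.mul_sum, ← Finset.mul_sum, x.2.2, z.2.2]
    ring⟩

theorem continuous_simplexLine {ι : Type*} [Fintype ι] :
    Continuous fun p : (stdSimplex ℝ ι × stdSimplex ℝ ι) × I => simplexLine p.1.1 p.1.2 p.2 := by
  refine Continuous.subtype_mk ?_ _
  refine continuous_pi fun i => ?_
  have h1 : Continuous fun p : (stdSimplex ℝ ι × stdSimplex ℝ ι) × I => p.1.1.1 i :=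
    (continuous_apply i).comp (continuous_subtype_val.comp (continuous_fst.comp continuous_fst))
  have h2 : Continuous fun p : (stdSimplex ℝ ι × stdSimplex ℝ ι) × I => p.1.2.1 i :=
    (continuous_apply i).comp (continuous_subtype_val.comp (continuous_snd.comp continuous_fst))
  have h3 : Continuous fun p : (stdSimplex ℝ ι × stdSimplex ℝ ι) × I => (p.2 : ℝ) :=
    continuous_subtype_val.comp continuous_snd
  fun_prop

/-- The segment between two points of a common closed simplex. -/
noncomputable def line (y z : K.Realization) {s : Finset V} (hs : s ∈ K) (hy : y.SupportedIn s)
    (hz : z.SupportedIn s) : Path y z where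
  toFun t := ofFace K s hs (simplexLine (y.toFace hy) (z.toFace hz) t)
  continuous_toFun := (continuous_ofFace s hs).comp
    (continuous_simplexLine.comp (Continuous.prodMk_right (y.toFace hy, z.toFace hz)))
  source' := by
    have : simplexLine (y.toFace hy) (z.toFace hz) 0 = y.toFace hy := by
      ext i
      simp [simplexLine]
    rw [this, ofFace_toFace]
  target' := by
    have : simplexLine (y.toFace hy) (z.toFace hz) 1 = z.toFace hz := by
      ext i
      simp [simplexLine]
    rw [this, ofFace_toFace]

theorem line_coord (y z : K.Realization) {s : Finset V} (hs : s ∈ K) (hy : y.SupportedIn s)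
    (hz : z.SupportedIn s) (t : I) (v : V) :
    (line y z hs hy hz t).coord v = (1 - (t : ℝ)) * y.coord v + t * z.coord v := by
  by_cases hv : v ∈ s
  · exact ofFace_coord_of_mem (hs := hs) _ hv
  · refine (ofFace_coord_of_notMem (hs := hs) _ hv).trans ?_
    rw [hy v hv, hz v hv]
    ring

theorem line_eq_line (y z : K.Realization) {s s' : Finset V} (hs : s ∈ K) (hy : y.SupportedIn s)
    (hz : z.SupportedIn s) (hs' : s' ∈ K) (hy' : y.SupportedIn s') (hz' : z.SupportedIn s') :
    line y z hs hy hz = line y z hs' hy' hz' := by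
  ext t v
  rw [line_coord, line_coord]

/-- The path `p` is contained in the closed simplex `s`, in a continuous manner. -/
def _root_.Path.FactorsThroughFace {y z : K.Realization} (p : Path y z) {s : Finset V}
    (hs : s ∈ K) : Prop := ∃ f : C(I, stdSimplex ℝ s), ∀ t, p t = ofFace K s hs (f t)

theorem factors_line (y z : K.Realization) {s : Finset V} (hs : s ∈ K) (hy : y.SupportedIn s)
    (hz : z.SupportedIn s) : (line y z hs hy hz).FactorsThroughFace hs :=
  ⟨⟨fun t => simplexLine (y.toFace hy) (z.toFace hz) t,
    continuous_simplexLine.comp (Continuous.prodMk_right (y.toFace hy, z.toFace hz))⟩,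
    fun _ => rfl⟩

theorem ofFace_injective {s : Finset V} (hs : s ∈ K) : Function.Injective (ofFace K s hs) := by
  intro a b h
  refine Subtype.ext (funext fun i => ?_)
  have := congrArg (fun y => y.coord i.1) h
  simpa only [ofFace_coord_of_mem _ i.2] using this

/-- Two paths of a closed simplex with the same ends are homotopic. -/
theorem homotopic_of_factors {y z : K.Realization} {p q : Path y z} {s : Finset V} {hs : s ∈ K}
    (hp : p.FactorsThroughFace hs) (hq : q.FactorsThroughFace hs) : p.Homotopic q := by
  obtain ⟨f, hf⟩ := hp
  obtain ⟨g, hg⟩ := hq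
  have h0 : f 0 = g 0 := ofFace_injective hs (by rw [← hf, ← hg, p.source, q.source])
  have h1 : f 1 = g 1 := ofFace_injective hs (by rw [← hf, ← hg, p.target, q.target])
  have : Nonempty s := by
    by_contra hn
    rw [not_nonempty_iff] at hn
    have := (f 0).2.2
    simp at this
  let f' : Path (f 0) (f 1) := ⟨f, rfl, rfl⟩
  let g' : Path (f 0) (f 1) := ⟨g, h0.symm, h1.symm⟩
  have key := (SimplyConnectedSpace.paths_homotopic f' g').map
    (⟨ofFace K s hs, continuous_ofFace s hs⟩ : C(_, _))
  have e0 : ofFace K s hs (f 0) = y := by rw [← hf, p.source]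
  have e1 : ofFace K s hs (f 1) = z := by rw [← hf, p.target]
  subst e0 e1
  have hp : p = f'.map (continuous_ofFace s hs) := by
    apply DFunLike.ext
    exact hf
  have hq : q = (g'.map (continuous_ofFace s hs)) := by
    apply DFunLike.ext
    exact hg
  rw [hp, hq]
  exact key

theorem factors_trans {x y z : K.Realization} {p : Path x y} {q : Path y z} {s : Finset V}
    {hs : s ∈ K} (hp : p.FactorsThroughFace hs) (hq : q.FactorsThroughFace hs) :
    (p.trans q).FactorsThroughFace hs := by
  obtain ⟨f, hf⟩ := hp
  obtain ⟨g, hg⟩ := hq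
  have h1 : f 1 = g 0 := ofFace_injective hs (by rw [← hf, ← hg, p.target, q.source])
  let f' : Path (f 0) (f 1) := ⟨f, rfl, rfl⟩
  let g' : Path (f 1) (g 1) := ⟨g, h1.symm, rfl⟩
  refine ⟨(f'.trans g').toContinuousMap, fun t => ?_⟩
  change _ = ofFace K s hs ((f'.trans g') t)
  rw [Path.trans_apply, Path.trans_apply]
  split_ifs
  · exact hf _
  · exact hg _

end AbstractSimplicialComplex.Realization

/-! ### Covering spaces of the realization and their parallel sections. -/

namespace AbstractSimplicialComplex.Realization

variable {V : Type*} {K : AbstractSimplicialComplex V}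

/-- The fibre bundle with discrete fibre over the realization that is glued from the trivial
bundles over the open stars by means of locally constant transition maps. -/
noncomputable def bundleCore {F : Type*} [TopologicalSpace F] [DiscreteTopology F]
    (τ : V → V → F → F) (hself : ∀ u s, τ u u s = s)
    (hcomp : ∀ (y : K.Realization) (u v w : V), 0 < y.coord u → 0 < y.coord v → 0 < y.coord w →
      ∀ s, τ v w (τ u v s) = τ u w s) : FiberBundleCore V K.Realization F where
  baseSet := openStar K
  isOpen_baseSet := isOpen_openStar
  indexAt y := y.exists_coord_pos.choose
  mem_baseSet_at y := y.exists_coord_pos.choose_spec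
  coordChange u v _ := τ u v
  coordChange_self u _ _ := hself u
  continuousOn_coordChange u v :=
    ((continuous_of_discreteTopology (f := τ u v)).comp continuous_snd).continuousOn
  coordChange_comp u v w y hy := hcomp y u v w hy.1.1 hy.1.2 hy.2

/-- Over a simply connected realization, a locally constant system of transition maps has a
parallel section through every point. -/
theorem exists_parallel_section_of_simplyConnected [SimplyConnectedSpace K.Realization]
    {F : Type*} (τ : V → V → F → F) (hself : ∀ u s, τ u u s = s)
    (hcomp : ∀ (y : K.Realization) (u v w : V), 0 < y.coord u → 0 < y.coord v → 0 < y.coord w →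
      ∀ s, τ v w (τ u v s) = τ u w s) (v₀ : V) (s₀ : F) :
    ∃ f : V → F, f v₀ = s₀ ∧ ∀ u v (t : Finset V), t ∈ K → u ∈ t → v ∈ t → f v = τ u v (f u) := by
  classical
  let _ : TopologicalSpace F := ⊥
  have : DiscreteTopology F := ⟨rfl⟩
  let Z := bundleCore τ hself hcomp
  have cov : IsCoveringMap (Bundle.TotalSpace.proj : Z.TotalSpace → K.Realization) :=
    FiberBundle.isCoveringMap
  let chart (v : V) (e : Z.TotalSpace) : F := τ (Z.indexAt e.1) v e.2
  have hchart (v : V) : ContinuousOn (chart v) (Bundle.TotalSpace.proj ⁻¹' openStar K v) :=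
    continuous_snd.comp_continuousOn (Z.localTriv v).continuousOn_toFun
  have hchange (u v : V) (e : Z.TotalSpace) (hu : 0 < e.1.coord u) (hv : 0 < e.1.coord v) :
      chart v e = τ u v (chart u e) :=
    (hcomp e.1 _ u v (Z.mem_baseSet_at e.1) hu hv _).symm
  -- The fibre coordinate refers to the chart chosen at `vert K v₀`; it is taken so that the chart
  -- of `v₀` reads `s₀`.
  let e₀ : Bundle.TotalSpace.proj ⁻¹' {vert K v₀} :=
    ⟨(⟨vert K v₀, τ v₀ (Z.indexAt (vert K v₀)) s₀⟩ : Z.TotalSpace), rfl⟩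
  let cl (v : V) : Path.Homotopic.Quotient (vert K v₀) (vert K v) :=
    .mk (PathConnectedSpace.somePath _ _)
  have hpos (v : V) : 0 < (vert K v).coord v := by
    rw [vert_coord_self]
    exact one_pos
  refine ⟨fun v => chart v (cov.monodromy (cl v) e₀).1, ?_, fun u v t ht hu hv => ?_⟩
  · have : cl v₀ = .refl _ := Subsingleton.elim _ _
    simp only [this, cov.monodromy_refl]
    have h1 : 0 < (vert K v₀).coord (Z.indexAt (vert K v₀)) := Z.mem_baseSet_at _
    exact (hcomp (vert K v₀) _ _ _ (hpos v₀) h1 (hpos v₀) _).trans (hself _ _)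
  · have hu' := supportedIn_vert (K := K) hu
    have hv' := supportedIn_vert (K := K) hv
    let γ := line (vert K u) (vert K v) ht hu' hv'
    have : cl v = (cl u).trans (.mk γ) := Subsingleton.elim _ _
    simp only [this, cov.monodromy_trans_apply]
    set e := cov.monodromy (cl u) e₀
    have he : γ.toContinuousMap 0 = Bundle.TotalSpace.proj e.1 := γ.source.trans e.2.symm
    set Γ := cov.liftPath γ.toContinuousMap e.1 he with hΓ
    have hlift (t : I) : (Γ t).1 = γ t := congrFun (cov.liftPath_lifts γ.toContinuousMap e.1 he) t
    have hend : (cov.monodromy (.mk γ) e).1 = Γ 1 := rfl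
    have hstart : Γ 0 = e.1 := cov.liftPath_zero ..
    rw [hend]
    -- The edge stays in the star of `u` before its end and in the star of `v` after its start. The
    -- chart of `u` is constant along the lift up to the midpoint, the chart of `v` from there on,
    -- and the transition map is applied at the midpoint.
    let m : I := ⟨1 / 2, by norm_num, by norm_num⟩
    have hγu (r : I) (hr : (r : ℝ) < 1) : 0 < (γ r).coord u := by
      rw [line_coord, vert_coord_self]
      have := mul_nonneg r.2.1 ((vert K v).coord_nonneg u)
      linarith
    have hγv (r : I) (hr : 0 < (r : ℝ)) : 0 < (γ r).coord v := by
      rw [line_coord, vert_coord_self]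
      have := mul_nonneg (sub_nonneg.2 r.2.2) ((vert K u).coord_nonneg v)
      linarith
    have hA : chart u (Γ 0) = chart u (Γ m) := by
      refine (isPreconnected_Iic (a := m)).constant (f := fun r => chart u (Γ r))
        ((hchart u).comp Γ.continuous.continuousOn ?_) ?_ ?_
      · intro r hr
        change 0 < (Γ r).1.coord u
        rw [hlift]
        refine hγu r (lt_of_le_of_lt (show (r : ℝ) ≤ 1 / 2 from hr) (by norm_num))
      · exact m.2.1
      · exact le_refl m
    have hB : chart v (Γ m) = chart v (Γ 1) := by
      refine (isPreconnected_Ici (a := m)).constant (f := fun r => chart v (Γ r))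
        ((hchart v).comp Γ.continuous.continuousOn ?_) ?_ ?_
      · intro r hr
        change 0 < (Γ r).1.coord v
        rw [hlift]
        refine hγv r (lt_of_lt_of_le (by norm_num) (show 1 / 2 ≤ (r : ℝ) from hr))
      · exact le_refl m
      · exact m.2.2
    rw [← hB, ← hstart, hA]
    refine hchange u v _ ?_ ?_
    · rw [hlift]
      exact hγu m (by norm_num [m])
    · rw [hlift]
      exact hγv m (by norm_num [m])

end AbstractSimplicialComplex.Realization

/-! ### Local systems on a graph. -/

namespace SimpleGraph

variable {V : Type*}

/-- A system of sets indexed by the vertices of a graph, with transport maps along the edges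
that are compatible with inverses and with triangles. -/
structure LocalSystem.{w} (G : SimpleGraph V) where
  fiber : V → Type w
  tr : ∀ {u v}, G.Adj u v → fiber u → fiber v
  tr_symm : ∀ {u v} (h : G.Adj u v) s, tr h.symm (tr h s) = s
  tr_tr : ∀ {u v w} (huv : G.Adj u v) (hvw : G.Adj v w) (huw : G.Adj u w) s,
    tr hvw (tr huv s) = tr huw s

/-- Combinatorial simple connectivity: every local system has a parallel section through every
point. -/
def HasParallelSections.{w} (G : SimpleGraph V) : Prop :=
  ∀ (X : LocalSystem.{_, w} G) (v₀ : V) (s₀ : X.fiber v₀),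
    ∃ f : ∀ v, X.fiber v, f v₀ = s₀ ∧ ∀ u v (h : G.Adj u v), f v = X.tr h (f u)

namespace LocalSystem

variable {G : SimpleGraph V} (X : LocalSystem G)

/-- Transport along a walk. -/
def walkTr : ∀ {u v}, G.Walk u v → X.fiber u → X.fiber v
  | _, _, .nil, s => s
  | _, _, .cons h p, s => walkTr p (X.tr h s)

theorem walkTr_append {u v w : V} (p : G.Walk u v) (q : G.Walk v w) (s : X.fiber u) :
    X.walkTr (p.append q) s = X.walkTr q (X.walkTr p s) := by
  induction p with
  | nil => rfl
  | cons h p ih => exact ih q _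

theorem walkTr_reverse {u v : V} (p : G.Walk u v) (s : X.fiber u) :
    X.walkTr p.reverse (X.walkTr p s) = s := by
  induction p with
  | nil => rfl
  | cons h p ih =>
    rw [Walk.reverse_cons, walkTr_append]
    change X.tr h.symm (X.walkTr p.reverse (X.walkTr p (X.tr h s))) = s
    rw [ih, X.tr_symm]

end LocalSystem

open AbstractSimplicialComplex.Realization in
-- Transport along chosen walks from `v₀` identifies all fibres with the one at `v₀`. The edge
-- transports become self-maps of a single set satisfying the cocycle condition on simplices, which
-- is what the covering space needs.
theorem hasParallelSections_of_simplyConnectedSpace.{w} {G : SimpleGraph V} (hG : G.Connected)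
    (K : AbstractSimplicialComplex V) (hK : ∀ s ∈ K, G.IsClique (s : Set V))
    (hedge : ∀ u v, G.Adj u v → ∃ s ∈ K, u ∈ s ∧ v ∈ s) [SimplyConnectedSpace K.Realization] :
    HasParallelSections.{_, w} G := by
  classical
  intro X v₀ s₀
  have p (v : V) : G.Walk v₀ v := (hG.preconnected v₀ v).some
  let a (v : V) : X.fiber v₀ → X.fiber v := X.walkTr (p v)
  let b (v : V) : X.fiber v → X.fiber v₀ := X.walkTr (p v).reverse
  have hba (v : V) (s) : b v (a v s) = s := X.walkTr_reverse _ _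
  have hab (v : V) (s) : a v (b v s) = s := by
    have := X.walkTr_reverse (p v).reverse s
    rwa [Walk.reverse_reverse] at this
  -- The identity on non-adjacent pairs matters only for `u = v`: distinct vertices of a simplex are
  -- adjacent.
  let τ (u v : V) (s : X.fiber v₀) : X.fiber v₀ :=
    if h : G.Adj u v then b v (X.tr h (a u s)) else s
  have hτ {u v : V} (h : G.Adj u v) (s) : τ u v s = b v (X.tr h (a u s)) := dif_pos h
  have hself (u : V) (s) : τ u u s = s := dif_neg (G.loopless.irrefl u)
  have hcomp (y : K.Realization) (u v w : V) (hu : 0 < y.coord u) (hv : 0 < y.coord v)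
      (hw : 0 < y.coord w) (s) : τ v w (τ u v s) = τ u w s := by
    obtain ⟨t, ht, hyt⟩ := y.exists_supportedIn
    have hc := hK t ht
    have hu := hyt.mem hu
    have hv := hyt.mem hv
    have hw := hyt.mem hw
    by_cases huv : u = v
    · subst huv
      rw [hself]
    by_cases hvw : v = w
    · subst hvw
      rw [hself]
    have h1 : G.Adj u v := hc hu hv huv
    have h2 : G.Adj v w := hc hv hw hvw
    by_cases huw : u = w
    · subst huw
      rw [hself, hτ h1, hτ h2, hab, X.tr_symm, hba]
    · have h3 : G.Adj u w := hc hu hw huw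
      rw [hτ h1, hτ h2, hτ h3, hab, X.tr_tr]
  obtain ⟨f, hf0, hf⟩ := exists_parallel_section_of_simplyConnected τ hself hcomp v₀ (b v₀ s₀)
  refine ⟨fun v => a v (f v), ?_, fun u v h => ?_⟩
  · beta_reduce
    rw [hf0, hab]
  · obtain ⟨s, hs, hu, hv⟩ := hedge u v h
    beta_reduce
    rw [hf u v s hs hu hv, hτ h, hab]

end SimpleGraph

/-! ### Path classes in the realization: squares, stars and subdivision. -/

/-- The two ways around the boundary of `I × I` are homotopic because `I × I` is contractible; the
map `H` carries this homotopy to `Y`. -/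
theorem Path.Homotopic.Quotient.mk_trans_eq_of_square {Y : Type*} [TopologicalSpace Y]
    {a b c d : Y} (p : Path a b) (q : Path b d) (r : Path a c) (s : Path c d) (H : C(I × I, Y))
    (hp : ∀ t, H (t, 0) = p t) (hq : ∀ t, H (1, t) = q t) (hr : ∀ t, H (0, t) = r t)
    (hs : ∀ t, H (t, 1) = s t) :
    (Path.Homotopic.Quotient.mk p).trans (.mk q) =
      (Path.Homotopic.Quotient.mk r).trans (.mk s) := by
  have : ContractibleSpace I := (convex_Icc (0 : ℝ) 1).contractibleSpace ⟨0, by simp⟩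
  obtain rfl : H (0, 0) = a := (hp 0).trans p.source
  obtain rfl : H (1, 0) = b := (hp 1).trans p.target
  obtain rfl : H (0, 1) = c := (hs 0).trans s.source
  obtain rfl : H (1, 1) = d := (hs 1).trans s.target
  let p' : Path ((0, 0) : I × I) (1, 0) := ⟨⟨fun t => (t, 0), by fun_prop⟩, rfl, rfl⟩
  let q' : Path ((1, 0) : I × I) (1, 1) := ⟨⟨fun t => (1, t), by fun_prop⟩, rfl, rfl⟩
  let r' : Path ((0, 0) : I × I) (0, 1) := ⟨⟨fun t => (0, t), by fun_prop⟩, rfl, rfl⟩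
  let s' : Path ((0, 1) : I × I) (1, 1) := ⟨⟨fun t => (t, 1), by fun_prop⟩, rfl, rfl⟩
  have ep : p = p'.map H.continuous := DFunLike.ext _ _ fun t => (hp t).symm
  have eq : q = q'.map H.continuous := DFunLike.ext _ _ fun t => (hq t).symm
  have er : r = r'.map H.continuous := DFunLike.ext _ _ fun t => (hr t).symm
  have es : s = s'.map H.continuous := DFunLike.ext _ _ fun t => (hs t).symm
  have key := (SimplyConnectedSpace.paths_homotopic (p'.trans q') (r'.trans s')).map H
  rw [← mk_trans, ← mk_trans, Path.Homotopic.Quotient.eq, ep, eq, er, es, ← Path.map_trans,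
    ← Path.map_trans]
  exact key

namespace AbstractSimplicialComplex.Realization

variable {V : Type*} {K : AbstractSimplicialComplex V}

/-- Two points of the realization that lie in a common closed simplex. -/
def InCommonFace (y z : K.Realization) : Prop := ∃ s ∈ K, y.SupportedIn s ∧ z.SupportedIn s

/-- The homotopy class of the segment between two points of a common closed simplex. -/
noncomputable def segment (y z : K.Realization) (h : InCommonFace y z) :
    Path.Homotopic.Quotient y z :=
  .mk (line y z h.choose_spec.1 h.choose_spec.2.1 h.choose_spec.2.2)

theorem segment_eq {y z : K.Realization} (h : InCommonFace y z) {s : Finset V} (hs : s ∈ K)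
    (hy : y.SupportedIn s) (hz : z.SupportedIn s) :
    segment y z h = .mk (line y z hs hy hz) := by
  rw [segment, line_eq_line]

theorem segment_trans_segment {x y z : K.Realization} (hxy : InCommonFace x y)
    (hyz : InCommonFace y z) (hxz : InCommonFace x z) {s : Finset V} (hs : s ∈ K)
    (hx : x.SupportedIn s) (hy : y.SupportedIn s) (hz : z.SupportedIn s) :
    (segment x y hxy).trans (segment y z hyz) = segment x z hxz := by
  rw [segment_eq hxy hs hx hy, segment_eq hyz hs hy hz, segment_eq hxz hs hx hz,
    ← Path.Homotopic.Quotient.mk_trans, Path.Homotopic.Quotient.eq]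
  exact homotopic_of_factors (factors_trans (factors_line ..) (factors_line ..))
    (factors_line ..)

theorem segment_self {y : K.Realization} (h : InCommonFace y y) :
    segment y y h = .refl y := by
  obtain ⟨s, hs, hy, -⟩ := id h
  rw [segment_eq _ hs hy hy, ← Path.Homotopic.Quotient.mk_refl, Path.Homotopic.Quotient.eq]
  exact homotopic_of_factors (factors_line y y hs hy hy)
    ⟨.const I (y.toFace hy), fun _ => (ofFace_toFace y hs hy).symm⟩

theorem inCommonFace_vert {y : K.Realization} {v : V} (h : 0 < y.coord v) :
    InCommonFace y (vert K v) :=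
  let ⟨s, hs, hy⟩ := y.exists_supportedIn
  ⟨s, hs, hy, supportedIn_vert (hy.mem h)⟩

open Classical in
/-- The segments from the points of the open star of `v` to `v`. -/
noncomputable def starContraction (K : AbstractSimplicialComplex V) (v : V) (y : K.Realization) :
    C(I, K.Realization) :=
  if h : 0 < y.coord v then
    (line y (vert K v) (inCommonFace_vert h).choose_spec.1 (inCommonFace_vert h).choose_spec.2.1
      (inCommonFace_vert h).choose_spec.2.2).toContinuousMap
  else .const I y

theorem starContraction_eq {v : V} {y : K.Realization} (h : 0 < y.coord v) {s : Finset V}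
    (hs : s ∈ K) (hy : y.SupportedIn s) :
    starContraction K v y =
      (line y (vert K v) hs hy (supportedIn_vert (hy.mem h))).toContinuousMap := by
  rw [starContraction, dif_pos h, line_eq_line]

/-- The coherent topology tests continuity of maps out of the realization, not out of its product
with `I`. Hence the contraction is treated as a map to `C(I, K.Realization)`, and on each closed
simplex it is the curried form of an evidently continuous map. -/
theorem continuousOn_starContraction (v : V) :
    ContinuousOn (starContraction K v) (openStar K v) := by
  classical
  rw [continuousOn_open_iff (isOpen_openStar v)]
  intro O hO
  refine isOpen_iff_forall_face.2 fun s hs => ?_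
  by_cases hv : v ∈ s
  · let c : stdSimplex ℝ s := (vert K v).toFace (supportedIn_vert hv)
    let ψ : C(stdSimplex ℝ s, C(I, K.Realization)) := ContinuousMap.curry
      ⟨fun p : stdSimplex ℝ s × I => ofFace K s hs (simplexLine p.1 c p.2),
        (continuous_ofFace s hs).comp (continuous_simplexLine.comp
          ((continuous_fst.prodMk continuous_const).prodMk continuous_snd))⟩
    have : ofFace K s hs ⁻¹' (openStar K v ∩ starContraction K v ⁻¹' O) =
        ofFace K s hs ⁻¹' openStar K v ∩ ψ ⁻¹' O := by
      ext x
      simp only [Set.mem_preimage, Set.mem_inter_iff]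
      refine and_congr_right fun hx => ?_
      have : starContraction K v (ofFace K s hs x) = ψ x := by
        rw [starContraction_eq hx hs (supportedIn_ofFace hs x)]
        ext t : 1
        change ofFace K s hs _ = ofFace K s hs (simplexLine x c t)
        rw [ofFace_injective hs (ofFace_toFace _ hs (supportedIn_ofFace hs x))]
      rw [this]
    rw [this]
    exact (isOpen_iff_forall_face.1 (isOpen_openStar v) s hs).inter (hO.preimage ψ.continuous)
  · have : ofFace K s hs ⁻¹' (openStar K v ∩ starContraction K v ⁻¹' O) = ∅ := by
      ext x
      simp [openStar, ofFace_coord_of_notMem x hv]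
    rw [this]
    exact isOpen_empty

/-- A path in the open star of `v` is homotopic to the path through `v`. -/
theorem mk_trans_segment_of_mem_openStar {x y : K.Realization} (γ : Path x y) {v : V}
    (h : ∀ t, 0 < (γ t).coord v) (hx : InCommonFace x (vert K v))
    (hy : InCommonFace y (vert K v)) :
    (Path.Homotopic.Quotient.mk γ).trans (segment y (vert K v) hy) =
      segment x (vert K v) hx := by
  have hcont : Continuous fun t => starContraction K v (γ t) :=
    (continuousOn_starContraction v).comp_continuous γ.continuous h
  -- `H (r, t)` is the point at time `t` of the segment from `γ r` to `v`. Its sides are `γ`, the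
  -- two end segments and the constant path at `v`.
  let H : C(I × I, K.Realization) := ContinuousMap.uncurry ⟨_, hcont⟩
  have hH (r t : I) {s : Finset V} (hs : s ∈ K) (hr : (γ r).SupportedIn s) :
      H (r, t) = line (γ r) (vert K v) hs hr (supportedIn_vert (hr.mem (h r))) t := by
    change starContraction K v (γ r) t = _
    rw [starContraction_eq (h r) hs hr]
    rfl
  obtain ⟨s, hs, hxs, hvs⟩ := id hx
  obtain ⟨s', hs', hys', hvs'⟩ := id hy
  rw [segment_eq _ hs hxs hvs, segment_eq _ hs' hys' hvs']
  refine (Path.Homotopic.Quotient.mk_trans_eq_of_square γ _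
    (line x (vert K v) hs hxs hvs) (Path.refl _) H
    (fun t => ?_) (fun t => ?_) (fun t => ?_) fun t => ?_).trans ?_
  · obtain ⟨s'', hs'', hy''⟩ := (γ t).exists_supportedIn
    rw [hH t 0 hs'' hy'', Path.source]
  · ext w
    rw [hH 1 t hs' (by rwa [γ.target]), line_coord, line_coord, γ.target]
  · ext w
    rw [hH 0 t hs (by rwa [γ.source]), line_coord, line_coord, γ.source]
  · obtain ⟨s'', hs'', hy''⟩ := (γ t).exists_supportedIn
    rw [hH t 1 hs'' hy'', Path.target]
    rfl
  · rw [Path.Homotopic.Quotient.mk_refl, Path.Homotopic.Quotient.trans_refl]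

/-- A family of path classes that is compatible with the paths in the open stars is compatible
with all paths. -/
theorem trans_mk_eq_of_forall_openStar {v₀ : K.Realization}
    (c : ∀ y, Path.Homotopic.Quotient v₀ y)
    (hc : ∀ {x y : K.Realization} (γ : Path x y) (v : V), (∀ t, 0 < (γ t).coord v) →
      (c x).trans (.mk γ) = c y) {x y : K.Realization} (γ : Path x y) :
    (c x).trans (.mk γ) = c y := by
  have hcast {x' y' : K.Realization} (hx : x' = x) (hy : y' = y)
      (h : (c x').trans (.mk (γ.cast hx hy)) = c y') : (c x).trans (.mk γ) = c y := by
    subst hx hy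
    exact h
  -- Lebesgue subdivision: each piece of `γ` stays in the open star of one vertex.
  obtain ⟨t, t0, tmono, ⟨n, hn⟩, hcov⟩ := exists_monotone_Icc_subset_open_cover_unitInterval
    (fun v => (isOpen_openStar (K := K) v).preimage γ.continuous)
    (fun r _ => Set.mem_iUnion.2 (γ r).exists_coord_pos)
  have key (m : ℕ) : (c (γ 0)).trans (.mk (γ.subpath 0 (t m))) = c (γ (t m)) := by
    induction m with
    | zero => rw [t0, Path.subpath_self, Path.Homotopic.Quotient.mk_refl,
        Path.Homotopic.Quotient.trans_refl]
    | succ m ih =>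
      obtain ⟨v, hv⟩ := hcov m
      have h1 : (c (γ (t m))).trans (.mk (γ.subpath (t m) (t (m + 1)))) = c (γ (t (m + 1))) := by
        refine hc _ v fun r => ?_
        have hr : γ.subpath (t m) (t (m + 1)) r ∈ γ '' Set.Icc (t m) (t (m + 1)) := by
          rw [← Path.range_subpath_of_le _ _ _ (tmono m.le_succ)]
          exact ⟨r, rfl⟩
        obtain ⟨r', hr', e⟩ := hr
        rw [← e]
        exact hv hr'
      rw [← h1, ← ih, Path.Homotopic.Quotient.trans_assoc, ← Path.Homotopic.Quotient.mk_trans,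
        Path.Homotopic.Quotient.eq.2 ⟨Path.Homotopy.subpathTransSubpath γ 0 (t m) (t (m + 1))⟩]
  have := key n
  rw [hn n le_rfl, Path.subpath_zero_one] at this
  exact hcast _ _ this

end AbstractSimplicialComplex.Realization

/-! ### From parallel sections to simple connectivity. -/

namespace SimpleGraph

open AbstractSimplicialComplex.Realization

/-- A parallel section of the path classes from `v₀` chooses a class to each vertex, compatibly with
edges. It extends to a class `c y` for every point with `c x · γ = c y` for every path `γ`. Thus `γ
= (c x)⁻¹ · c y` does not depend on `γ`. The case `u = w` of `htri` supplies the edges. -/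
theorem simplyConnectedSpace_of_hasParallelSections.{u} {V : Type u} {G : SimpleGraph V}
    (hG : G.Connected) (K : AbstractSimplicialComplex V)
    (hK : ∀ s ∈ K, G.IsClique (s : Set V))
    (htri : ∀ u v w : V, G.Adj u v → G.Adj v w → G.Adj u w ∨ u = w →
      ∃ s ∈ K, u ∈ s ∧ v ∈ s ∧ w ∈ s)
    (hsec : HasParallelSections.{u, u} G) : SimplyConnectedSpace K.Realization := by
  classical
  obtain ⟨v₀⟩ := hG.nonempty
  have hadj {u v : V} (h : G.Adj u v) : InCommonFace (vert K u) (vert K v) := by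
    obtain ⟨s, hs, hu, hv, -⟩ := htri u v u h h.symm (Or.inr rfl)
    exact ⟨s, hs, supportedIn_vert hu, supportedIn_vert hv⟩
  let X : LocalSystem.{u, u} G :=
    { fiber := fun v => Path.Homotopic.Quotient (vert K v₀) (vert K v)
      tr := fun h s => s.trans (segment _ _ (hadj h))
      tr_symm := by
        intro u v h s
        obtain ⟨t, ht, hu, hv, -⟩ := htri u v u h h.symm (Or.inr rfl)
        have hu := supportedIn_vert (K := K) hu
        have hv := supportedIn_vert (K := K) hv
        have huu : InCommonFace (vert K u) (vert K u) := ⟨t, ht, hu, hu⟩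
        rw [Path.Homotopic.Quotient.trans_assoc,
          segment_trans_segment _ _ huu ht hu hv hu, segment_self,
          Path.Homotopic.Quotient.trans_refl]
      tr_tr := by
        intro u v w huv hvw huw s
        obtain ⟨t, ht, hu, hv, hw⟩ := htri u v w huv hvw (Or.inl huw)
        rw [Path.Homotopic.Quotient.trans_assoc, segment_trans_segment _ _ (hadj huw) ht
          (supportedIn_vert hu) (supportedIn_vert hv) (supportedIn_vert hw)] }
  obtain ⟨f, -, hf⟩ := hsec X v₀ (.refl _)
  -- The class goes to a chosen vertex of the support of `y` and then straight to `y`; `hc` shows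
  -- that the choice is irrelevant.
  let c (y : K.Realization) : Path.Homotopic.Quotient (vert K v₀) y :=
    (f y.exists_coord_pos.choose).trans
      (segment y _ (inCommonFace_vert y.exists_coord_pos.choose_spec)).symm
  have hc (y : K.Realization) (v : V) (hv : 0 < y.coord v) :
      (c y).trans (segment y (vert K v) (inCommonFace_vert hv)) = f v := by
    have hw : 0 < y.coord y.exists_coord_pos.choose := y.exists_coord_pos.choose_spec
    change ((f y.exists_coord_pos.choose).trans (segment y _ (inCommonFace_vert hw)).symm).trans
      _ = _
    generalize y.exists_coord_pos.choose = w at hw ⊢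
    obtain ⟨s, hs, hys⟩ := y.exists_supportedIn
    by_cases hwv : w = v
    · subst hwv
      rw [Path.Homotopic.Quotient.trans_assoc, Path.Homotopic.Quotient.symm_trans,
        Path.Homotopic.Quotient.trans_refl]
    have hadj' : G.Adj w v := hK s hs (hys.mem hw) (hys.mem hv) hwv
    rw [hf w v hadj', ← segment_trans_segment (inCommonFace_vert hw) (hadj hadj')
      (inCommonFace_vert hv) hs hys (supportedIn_vert (hys.mem hw))
      (supportedIn_vert (hys.mem hv)), Path.Homotopic.Quotient.trans_assoc,
      ← Path.Homotopic.Quotient.trans_assoc (segment y _ _).symm,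
      Path.Homotopic.Quotient.symm_trans, Path.Homotopic.Quotient.refl_trans]
  have hc' {x y : K.Realization} (γ : _root_.Path x y) (v : V) (h : ∀ t, 0 < (γ t).coord v) :
      (c x).trans (.mk γ) = c y := by
    have hx : 0 < x.coord v := by simpa using h 0
    have hy : 0 < y.coord v := by simpa using h 1
    have h1 := hc x v hx
    rw [← mk_trans_segment_of_mem_openStar γ h (inCommonFace_vert hx) (inCommonFace_vert hy),
      ← hc y v hy, ← Path.Homotopic.Quotient.trans_assoc] at h1
    have h2 := congrArg (fun p => p.trans (segment y (vert K v) (inCommonFace_vert hy)).symm) h1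
    simpa only [Path.Homotopic.Quotient.trans_assoc, Path.Homotopic.Quotient.trans_symm,
      Path.Homotopic.Quotient.trans_refl] using h2
  rw [simply_connected_iff_paths_homotopic]
  refine ⟨⟨⟨vert K v₀⟩, fun x y => ?_⟩, fun x y => ⟨fun p q => ?_⟩⟩
  · obtain ⟨p, -⟩ := Path.Homotopic.Quotient.mk_surjective (c x)
    obtain ⟨q, -⟩ := Path.Homotopic.Quotient.mk_surjective (c y)
    exact ⟨p.symm.trans q⟩
  · obtain ⟨p, rfl⟩ := Path.Homotopic.Quotient.mk_surjective p
    obtain ⟨q, rfl⟩ := Path.Homotopic.Quotient.mk_surjective q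
    have h := (trans_mk_eq_of_forall_openStar c hc' p).trans
      (trans_mk_eq_of_forall_openStar c hc' q).symm
    have h2 := congrArg (fun r => (c x).symm.trans r) h
    simpa only [← Path.Homotopic.Quotient.trans_assoc, Path.Homotopic.Quotient.symm_trans,
      Path.Homotopic.Quotient.refl_trans] using h2

end SimpleGraph

end Realization

namespace SimpleGraph

variable {V : Type*} {G : SimpleGraph V}

/-! ### Distances two and three -/

theorem Connected.dist_eq_two (hG : G.Connected) {u p v : V} (h1 : G.Adj p u) (h2 : G.Adj p v)
    (hne : u ≠ v) (hn : ¬ G.Adj u v) : G.dist u v = 2 := by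
  have h3 := hG.one_lt_dist_of_ne_of_not_adj hne hn
  have h4 := hG.dist_triangle (u := u) (v := p) (w := v)
  rw [dist_eq_one_iff_adj.2 h1.symm, dist_eq_one_iff_adj.2 h2] at h4
  omega

theorem ne_of_dist_eq_two {u v : V} (h : G.dist u v = 2) : u ≠ v := by
  rintro rfl
  simp at h

theorem Connected.exists_adj_dist_add_one (hG : G.Connected) {u v : V} (h : u ≠ v) :
    ∃ x, G.Adj x v ∧ G.dist u x + 1 = G.dist u v := by
  obtain ⟨p, hp⟩ := hG.exists_walk_length_eq_dist v u
  cases p with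
  | nil => exact absurd rfl h
  | @cons _ x _ hx q =>
    refine ⟨x, hx.symm, ?_⟩
    have h1 := dist_le q
    have h2 := hG.dist_triangle (u := u) (v := x) (w := v)
    rw [dist_eq_one_iff_adj.2 hx.symm] at h2
    rw [Walk.length_cons] at hp
    rw [dist_comm (u := u), dist_comm (u := u)] at *
    omega

theorem Connected.exists_common_adj_of_dist_eq_two (hG : G.Connected) {u v : V}
    (h : G.dist u v = 2) : ∃ p, G.Adj p u ∧ G.Adj p v := by
  obtain ⟨p, hp, hd⟩ := hG.exists_adj_dist_add_one (ne_of_dist_eq_two h)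
  refine ⟨p, ?_, hp⟩
  rw [adj_comm, ← dist_eq_one_iff_adj]
  omega

theorem Adj.dist_le_dist_add_one (hG : G.Connected) {v w : V} (h : G.Adj v w) (u : V) :
    G.dist u v ≤ G.dist u w + 1 := by
  have := hG.dist_triangle (u := u) (v := w) (w := v)
  rwa [dist_eq_one_iff_adj.2 h.symm] at this

/-- The triangle condition at distance two. -/
def LocalTriangleCondition (G : SimpleGraph V) : Prop :=
  ∀ ⦃u v w p q : V⦄, G.Adj v w → G.Adj p u → G.Adj p v → u ≠ v → ¬ G.Adj u v → G.Adj q u →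
    G.Adj q w → u ≠ w → ¬ G.Adj u w → ∃ x, G.Adj x u ∧ G.Adj x v ∧ G.Adj x w

/-- The quadrangle condition at distances two and three. -/
def LocalQuadrangleCondition (G : SimpleGraph V) : Prop :=
  ∀ ⦃u v w z p q : V⦄, G.Adj z v → G.Adj z w → v ≠ w → ¬ G.Adj v w → G.Adj p u → G.Adj p v →
    u ≠ v → ¬ G.Adj u v → G.Adj q u → G.Adj q w → u ≠ w → ¬ G.Adj u w → u ≠ z → ¬ G.Adj u z →
    (∀ r, G.Adj r u → ¬ G.Adj r z) → ∃ x, G.Adj x u ∧ G.Adj x v ∧ G.Adj x w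

theorem IsLocallyWeaklyModular.localTriangleCondition (hG : G.Connected)
    (h : G.IsLocallyWeaklyModular) : G.LocalTriangleCondition :=
  fun u v w _ _ hvw h1 h2 h3 h4 h5 h6 h7 h8 =>
    (h u).1 v w hvw (hG.dist_eq_two h1 h2 h3 h4) (hG.dist_eq_two h5 h6 h7 h8)

theorem IsLocallyWeaklyModular.localQuadrangleCondition (hG : G.Connected)
    (h : G.IsLocallyWeaklyModular) : G.LocalQuadrangleCondition := by
  intro u v w z p q hzv hzw hne hn h1 h2 h3 h4 h5 h6 h7 h8 h9 h10 h11
  have huv := hG.dist_eq_two h1 h2 h3 h4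
  refine (h u).2 v w z hzv hzw (hG.dist_eq_two hzv hzw hne hn) huv
    (hG.dist_eq_two h5 h6 h7 h8) ?_
  have h12 := hzv.dist_le_dist_add_one hG u
  have h13 := hG.one_lt_dist_of_ne_of_not_adj h9 h10
  have h14 : G.dist u z ≠ 2 := fun h => by
    obtain ⟨r, hr⟩ := hG.exists_common_adj_of_dist_eq_two h
    exact h11 r hr.1 hr.2
  omega

theorem IsWeaklyModular.isLocallyWeaklyModular (h : G.IsWeaklyModular) :
    G.IsLocallyWeaklyModular := by
  intro u
  refine ⟨fun v w hvw huv huw => ?_, fun v w z hzv hzw hvw huv huw huz => ?_⟩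
  · obtain ⟨x, h1, h2, h3⟩ := (h u).1 v w (dist_eq_one_iff_adj.2 hvw) (by omega) (by omega)
    exact ⟨x, (dist_eq_one_iff_adj.1 (by omega : G.dist u x = 1)).symm, h1, h2⟩
  · obtain ⟨x, h1, h2, h3⟩ := (h u).2 v w z (dist_eq_one_iff_adj.2 hzv.symm)
      (dist_eq_one_iff_adj.2 hzw.symm) hvw (by omega) (by omega) (by omega)
    exact ⟨x, (dist_eq_one_iff_adj.1 (by omega : G.dist u x = 1)).symm, h1, h2⟩

/-! ### Reduced paths

A path is a list of vertices whose head is its endpoint. -/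

/-- Equivalence of paths generated by the replacement of an interior vertex by another common
neighbour of its two neighbours on the path. -/
inductive PathEqv (G : SimpleGraph V) : List V → List V → Prop
  | refl (l : List V) : PathEqv G l l
  | swap {z y y' x : V} (l : List V) (hzy : G.Adj z y) (hyx : G.Adj y x) (hzy' : G.Adj z y')
      (hyx' : G.Adj y' x) : PathEqv G (z :: y :: x :: l) (z :: y' :: x :: l)
  | cons (z : V) {l l' : List V} : PathEqv G l l' → PathEqv G (z :: l) (z :: l')
  | trans {l₁ l₂ l₃ : List V} : PathEqv G l₁ l₂ → PathEqv G l₂ l₃ → PathEqv G l₁ l₃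

namespace PathEqv

theorem symm {l l' : List V} (h : PathEqv G l l') : PathEqv G l' l := by
  induction h with
  | refl l => exact .refl l
  | swap l h1 h2 h3 h4 => exact .swap l h3 h4 h1 h2
  | cons z _ ih => exact ih.cons z
  | trans _ _ ih1 ih2 => exact ih2.trans ih1

theorem length_eq {l l' : List V} (h : PathEqv G l l') : l.length = l'.length := by
  induction h with
  | refl l => rfl
  | swap l h1 h2 h3 h4 => rfl
  | cons z _ ih => simpa using ih
  | trans _ _ ih1 ih2 => exact ih1.trans ih2

theorem head?_eq {l l' : List V} (h : PathEqv G l l') : l.head? = l'.head? := by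
  induction h with
  | refl l => rfl
  | swap l h1 h2 h3 h4 => rfl
  | cons z _ ih => rfl
  | trans _ _ ih1 ih2 => exact ih1.trans ih2

theorem head_eq {v w : V} {l l' : List V} (h : PathEqv G (v :: l) (w :: l')) : v = w := by
  simpa using h.head?_eq

theorem exists_eq_cons {v : V} {l m : List V} (h : PathEqv G (v :: l) m) :
    ∃ l', m = v :: l' := by
  cases m with
  | nil => simpa using h.length_eq
  | cons w l' => exact ⟨l', by rw [h.head_eq]⟩

end PathEqv

/-- A path from `v₀` is reduced if it is a walk and no equivalent path contains a backtrack or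
two sides of a triangle. -/
def ReducedPath (G : SimpleGraph V) (v₀ : V) : List V → Prop
  | [] => False
  | [v] => v = v₀
  | z :: v :: l => ReducedPath G v₀ (v :: l) ∧ G.Adj v z ∧
      ∀ u m, PathEqv G (v :: l) (v :: u :: m) → u ≠ z ∧ ¬ G.Adj u z

namespace ReducedPath

variable {v₀ : V}

theorem tail {z v : V} {l : List V} (h : ReducedPath G v₀ (z :: v :: l)) :
    ReducedPath G v₀ (v :: l) := h.1

theorem adj {z v : V} {l : List V} (h : ReducedPath G v₀ (z :: v :: l)) : G.Adj v z := h.2.1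

theorem ne_of_pred {z v u : V} {l m : List V} (h : ReducedPath G v₀ (z :: v :: l))
    (hu : PathEqv G (v :: l) (v :: u :: m)) : u ≠ z := (h.2.2 u m hu).1

theorem not_adj_of_pred {z v u : V} {l m : List V} (h : ReducedPath G v₀ (z :: v :: l))
    (hu : PathEqv G (v :: l) (v :: u :: m)) : ¬ G.Adj u z := (h.2.2 u m hu).2

/-- On a reduced path, vertices three steps apart are at distance three. -/
theorem three_steps (hT : G.LocalTriangleCondition) {z y x t : V} {l : List V}
    (h : ReducedPath G v₀ (z :: y :: x :: t :: l)) :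
    t ≠ z ∧ ¬ G.Adj t z ∧ ∀ r, G.Adj r t → ¬ G.Adj r z := by
  have hyz : G.Adj y z := h.adj
  have hxy : G.Adj x y := h.tail.adj
  have htx : G.Adj t x := h.tail.tail.adj
  have hty : ¬ G.Adj t y := h.tail.not_adj_of_pred (.refl _)
  have htny : t ≠ y := h.tail.ne_of_pred (.refl _)
  -- A common neighbour of `t` and `y` can replace `x`, hence is also a predecessor of `y`.
  have hnz {r : V} (h1 : G.Adj r t) (h2 : G.Adj r y) : r ≠ z ∧ ¬ G.Adj r z :=
    h.2.2 r (t :: l) (.swap l hxy.symm htx.symm h2.symm h1)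
  have h1 : t ≠ z := by
    rintro rfl
    exact hty hyz.symm
  have h2 : ¬ G.Adj t z := fun h2 => (hnz h2.symm hyz.symm).1 rfl
  refine ⟨h1, h2, fun r hr1 hr2 => ?_⟩
  obtain ⟨s, hs1, hs2, hs3⟩ := hT hyz htx.symm hxy htny hty hr1 hr2 h1 h2
  exact (hnz hs1 hs2).2 hs3

/-- The two last but one vertices of equivalent paths come from the same class, or the classes
have a common predecessor. -/
def TailsMeet (G : SimpleGraph V) (p q : List V) : Prop :=
  PathEqv G p q ∨ ∃ w₁ w₂ t m, PathEqv G p (w₁ :: t :: m) ∧ PathEqv G q (w₂ :: t :: m)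

theorem TailsMeet.of_pathEqv {p q r : List V} (h : TailsMeet G p q) (h' : PathEqv G q r) :
    TailsMeet G p r := by
  rcases h with h | ⟨w₁, w₂, t, m, h1, h2⟩
  · exact Or.inl (h.trans h')
  · exact Or.inr ⟨w₁, w₂, t, m, h1, h'.symm.trans h2⟩

/-- The two assertions feed each other in one induction on length. Invariance under an exchange
needs control of all predecessors of the new vertex, which is the meeting property for shorter
paths. The meeting property needs reducedness of equivalent paths in order to apply the local
conditions. -/
theorem invariant_and_tailsMeet (hT : G.LocalTriangleCondition)
    (hQ : G.LocalQuadrangleCondition) (n : ℕ) :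
    (∀ p q, p.length = n → ReducedPath G v₀ p → PathEqv G p q → ReducedPath G v₀ q) ∧
      (∀ p q, p.length = n → ReducedPath G v₀ p → PathEqv G p q → TailsMeet G p.tail q.tail) := by
  induction n using Nat.strong_induction_on with
  | _ n ih =>
  have inv' : ∀ p q, p.length < n → ReducedPath G v₀ p → PathEqv G p q → ReducedPath G v₀ q :=
    fun p q h => (ih _ h).1 p q rfl
  have meet' : ∀ p q, p.length < n → ReducedPath G v₀ p → PathEqv G p q →
      TailsMeet G p.tail q.tail := fun p q h => (ih _ h).2 p q rfl
  have inv : ∀ p q, p.length = n → ReducedPath G v₀ p → PathEqv G p q → ReducedPath G v₀ q := by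
    intro p q hn hp hpq
    induction hpq with
    | refl l => exact hp
    | trans h1 _ ih1 ih2 => exact ih2 (h1.length_eq ▸ hn) (ih1 hn hp)
    | @cons z l l' hl _ =>
      cases l with
      | nil =>
        have : l' = [] := by simpa [eq_comm] using hl.length_eq
        rwa [this]
      | cons v l =>
        obtain ⟨l', rfl⟩ := hl.exists_eq_cons
        have hlen : (v :: l).length < n := by simp at hn ⊢; omega
        exact ⟨inv' _ _ hlen hp.tail hl, hp.adj, fun u m hu => hp.2.2 u m (hl.trans hu)⟩
    | @swap z y y' x l hzy hyx hzy' hyx' =>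
      have hlen (c : V) : (c :: x :: l).length < n := by simp at hn ⊢; omega
      -- `z` is at distance three from every predecessor of `x`, not only from the one on the given
      -- path.
      have key {t : V} {m : List V} (ht : PathEqv G (x :: l) (x :: t :: m)) :
          t ≠ z ∧ ¬ G.Adj t z ∧ ∀ r, G.Adj r t → ¬ G.Adj r z := by
        refine three_steps (v₀ := v₀) (y := y) (x := x) (l := m) hT
          ⟨inv' _ _ (hlen y) hp.tail (ht.cons y), hp.adj, fun u k hu => ?_⟩
        exact hp.2.2 u k ((ht.cons y).trans hu)
      have hr : ReducedPath G v₀ (y' :: x :: l) := by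
        refine ⟨hp.tail.tail, hyx'.symm, fun t m ht => ⟨?_, fun h => ?_⟩⟩
        · rintro rfl
          exact (key ht).2.1 hzy'.symm
        · exact (key ht).2.2 y' h.symm hzy'.symm
      refine ⟨hr, hzy'.symm, fun s m hs => ?_⟩
      -- `s` and `x` are both predecessors of `y'`. Either they agree, or they share a predecessor
      -- `t`; in the latter case `s` equal or adjacent to `z` would bring `z` too close to `t`.
      rcases meet' _ _ (hlen y') hr hs with h | ⟨w₁, w₂, t, k, h1, h2⟩
      · obtain rfl := h.head_eq
        exact hp.2.2 x l (.refl _)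
      · obtain rfl := h1.head_eq
        obtain rfl := h2.head_eq
        have hst : G.Adj t s := by
          have hs' := (inv' _ _ (hlen y') hr hs).tail
          refine (inv' _ _ ?_ hs' h2).adj
          have := hs.length_eq
          have hlen := hlen y'
          simp only [List.length_cons] at this hlen ⊢
          omega
        refine ⟨?_, fun h => (key h1).2.2 s hst.symm h⟩
        rintro rfl
        exact (key h1).2.1 hst
  refine ⟨inv, ?_⟩
  intro p q hn hp hpq
  induction hpq with
  | refl l => exact Or.inl (.refl _)
  | @cons z l l' hl _ => exact Or.inl hl
  | @swap z y y' x l hzy hyx hzy' hyx' => exact Or.inr ⟨y, y', x, l, .refl _, .refl _⟩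
  | @trans p r q h1 h2 ih1 ih2 =>
    have hr := inv _ _ hn hp h1
    specialize ih1 hn hp
    specialize ih2 (h1.length_eq ▸ hn) hr
    rcases ih2 with h | ⟨w₁, w₂, t₂, m₂, h3, h4⟩
    · exact ih1.of_pathEqv h
    rcases ih1 with h | ⟨w, w', t₁, m₁, h5, h6⟩
    · exact Or.inr ⟨w₁, w₂, t₂, m₂, h.trans h3, h4⟩
    obtain rfl := (h6.symm.trans h3).head_eq
    have hne : p ≠ [] := by rintro rfl; exact hp
    obtain ⟨v, p, rfl⟩ := List.exists_cons_of_ne_nil hne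
    obtain ⟨r, rfl⟩ := h1.exists_eq_cons
    obtain ⟨q, rfl⟩ := h2.exists_eq_cons
    simp only [List.tail_cons] at h3 h4 h5 h6 ⊢
    have hlen1 := h5.length_eq
    have hlen2 := h6.length_eq
    have hlen3 := h3.length_eq
    have hlen4 := h1.length_eq
    simp only [List.length_cons] at hlen1 hlen2 hlen3 hlen4 hn
    have hr1 := inv _ _ (by simp; omega) hr (h6.cons v)
    -- `t₁` and `t₂` are predecessors of one class ending at `w`, so by induction they agree or have
    -- a common predecessor `s`.
    have hm := meet' _ _ (by simp; omega) hr1.tail (h6.symm.trans h3)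
    simp only [List.tail_cons] at hm
    rcases hm with h | ⟨s₁, s₂, s, k, h7, h8⟩
    · exact Or.inr ⟨w, w₂, t₂, m₂, h5.trans (h.cons w), h4⟩
    obtain rfl := h7.head_eq
    obtain rfl := h8.head_eq
    have hp' : ReducedPath G v₀ (v :: w :: t₁ :: s :: k) :=
      inv _ _ (by simp; omega) hp ((h5.trans (h7.cons w)).cons v)
    have hq' : ReducedPath G v₀ (v :: w₂ :: t₂ :: s :: k) := by
      refine inv _ _ ?_ hp ((h1.trans h2).trans ((h4.trans (h8.cons w₂)).cons v))
      simp; omega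
    by_cases hww : w = w₂
    · subst hww
      exact Or.inl ((h5.trans (h7.cons w)).trans (((PathEqv.swap k hp'.tail.adj.symm
        hp'.tail.tail.adj.symm hq'.tail.adj.symm hq'.tail.tail.adj.symm)).trans
        (h4.trans (h8.cons w)).symm))
    -- Seen from `s`, the vertices `w` and `w₂` are at distance two and `v` is at distance three.
    -- The local triangle or quadrangle condition gives `x`, the new common predecessor.
    have hx : ∃ x, G.Adj x s ∧ G.Adj x w ∧ G.Adj x w₂ := by
      have a1 : s ≠ w := hp'.tail.ne_of_pred (.refl _)
      have a2 : ¬ G.Adj s w := hp'.tail.not_adj_of_pred (.refl _)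
      have b1 : s ≠ w₂ := hq'.tail.ne_of_pred (.refl _)
      have b2 : ¬ G.Adj s w₂ := hq'.tail.not_adj_of_pred (.refl _)
      by_cases hadj : G.Adj w w₂
      · exact hT hadj hp'.tail.tail.adj.symm hp'.tail.adj a1 a2
          hq'.tail.tail.adj.symm hq'.tail.adj b1 b2
      · obtain ⟨c1, c2, c3⟩ := hp'.three_steps hT
        exact hQ hp'.adj.symm hq'.adj.symm hww hadj hp'.tail.tail.adj.symm hp'.tail.adj a1 a2
          hq'.tail.tail.adj.symm hq'.tail.adj b1 b2 c1 c2 c3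
    obtain ⟨x, hx1, hx2, hx3⟩ := hx
    exact Or.inr ⟨w, w₂, x, s :: k, (h5.trans (h7.cons w)).trans
      (.swap k hp'.tail.adj.symm hp'.tail.tail.adj.symm hx2.symm hx1),
      (h4.trans (h8.cons w₂)).trans
      (.swap k hq'.tail.adj.symm hq'.tail.tail.adj.symm hx3.symm hx1)⟩

theorem of_pathEqv (hT : G.LocalTriangleCondition) (hQ : G.LocalQuadrangleCondition)
    {p q : List V} (hp : ReducedPath G v₀ p) (h : PathEqv G p q) : ReducedPath G v₀ q :=
  (invariant_and_tailsMeet hT hQ _).1 _ _ rfl hp h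

theorem tailsMeet (hT : G.LocalTriangleCondition) (hQ : G.LocalQuadrangleCondition)
    {v : V} {p q : List V} (hp : ReducedPath G v₀ (v :: p)) (h : PathEqv G (v :: p) (v :: q)) :
    TailsMeet G p q :=
  (invariant_and_tailsMeet hT hQ _).2 _ _ rfl hp h

/-- Two classes with the same endpoint of a predecessor: either the predecessors agree or they
have a common predecessor. -/
theorem preds_meet (hT : G.LocalTriangleCondition) (hQ : G.LocalQuadrangleCondition)
    {v w₁ w₂ : V} {p q : List V} (hp : ReducedPath G v₀ (v :: w₁ :: p))
    (h : PathEqv G (v :: w₁ :: p) (v :: w₂ :: q)) :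
    PathEqv G (w₁ :: p) (w₂ :: q) ∨ ∃ t m, PathEqv G (w₁ :: p) (w₁ :: t :: m) ∧
      PathEqv G (w₂ :: q) (w₂ :: t :: m) := by
  rcases hp.tailsMeet hT hQ h with h | ⟨a, b, t, m, h1, h2⟩
  · exact Or.inl h
  · obtain rfl := h1.head_eq
    obtain rfl := h2.head_eq
    exact Or.inr ⟨t, m, h1, h2⟩

end ReducedPath

end SimpleGraph

/-! ### The covering of the graph by classes of reduced paths. -/

namespace SimpleGraph

variable {V : Type*} {G : SimpleGraph V} {v₀ : V}

/-- The classes of the reduced paths `v :: m` and `z :: k`, with adjacent endpoints, are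
neighbours: one is a predecessor of the other or they have a common predecessor. -/
def PathNb (G : SimpleGraph V) (v : V) (m : List V) (z : V) (k : List V) : Prop :=
  PathEqv G (v :: m) (v :: z :: k) ∨
    (∃ u l, PathEqv G (v :: m) (v :: u :: l) ∧ PathEqv G (z :: k) (z :: u :: l)) ∨
    PathEqv G (z :: k) (z :: v :: m)

namespace PathNb

theorem symm {v z : V} {m k : List V} (h : PathNb G v m z k) : PathNb G z k v m := by
  rcases h with h | ⟨u, l, h1, h2⟩ | h
  · exact Or.inr (Or.inr h)
  · exact Or.inr (Or.inl ⟨u, l, h2, h1⟩)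
  · exact Or.inl h

theorem congr_left {v z : V} {m m' k : List V} (h : PathNb G v m z k)
    (h' : PathEqv G (v :: m) (v :: m')) : PathNb G v m' z k := by
  rcases h with h | ⟨u, l, h1, h2⟩ | h
  · exact Or.inl (h'.symm.trans h)
  · exact Or.inr (Or.inl ⟨u, l, h'.symm.trans h1, h2⟩)
  · exact Or.inr (Or.inr (h.trans (h'.cons z)))

theorem congr_right {v z : V} {m k k' : List V} (h : PathNb G v m z k)
    (h' : PathEqv G (z :: k) (z :: k')) : PathNb G v m z k' :=
  (h.symm.congr_left h').symm

variable (hT : G.LocalTriangleCondition) (hQ : G.LocalQuadrangleCondition)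

include hT hQ

/-- Edges lift: if `z` is a predecessor of `v`, go down; if a predecessor of `v` is adjacent to `z`,
stay at the same level; otherwise appending `z` gives a reduced path. -/
theorem exists_of_adj {v z : V} {m : List V} (hm : ReducedPath G v₀ (v :: m))
    (h : G.Adj v z) : ∃ k, ReducedPath G v₀ (z :: k) ∧ PathNb G v m z k := by
  by_cases h1 : ∃ k, PathEqv G (v :: m) (v :: z :: k)
  · obtain ⟨k, hk⟩ := h1
    exact ⟨k, (hm.of_pathEqv hT hQ hk).tail, Or.inl hk⟩
  by_cases h2 : ∃ u l, PathEqv G (v :: m) (v :: u :: l) ∧ G.Adj u z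
  · obtain ⟨u, l, hu, huz⟩ := h2
    refine ⟨u :: l, ⟨(hm.of_pathEqv hT hQ hu).tail, huz, fun t j ht => ?_⟩,
      Or.inr (Or.inl ⟨u, l, hu, .refl _⟩)⟩
    have hr := hm.of_pathEqv hT hQ (hu.trans (ht.cons v))
    constructor
    · rintro rfl
      exact hr.not_adj_of_pred (.refl _) h.symm
    · intro htz
      exact h1 ⟨_, (hu.trans (ht.cons v)).trans
        (.swap j hr.adj.symm hr.tail.adj.symm h htz.symm)⟩
  · refine ⟨v :: m, ⟨hm, h, fun u l hu => ⟨?_, fun huz => h2 ⟨u, l, hu, huz⟩⟩⟩,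
      Or.inr (Or.inr (.refl _))⟩
    rintro rfl
    exact h1 ⟨l, hu⟩

theorem unique_aux {v z : V} {m k k' : List V} (hm : ReducedPath G v₀ (v :: m))
    (hk : ReducedPath G v₀ (z :: k)) (hk' : ReducedPath G v₀ (z :: k'))
    (h : PathEqv G (v :: m) (v :: z :: k)) (h' : PathNb G v m z k') :
    PathEqv G (z :: k) (z :: k') := by
  have hr := hm.of_pathEqv hT hQ h
  rcases h' with h' | ⟨u, l, h1, h2⟩ | h'
  · rcases hr.preds_meet hT hQ (h.symm.trans h') with h | ⟨t, j, h1, h2⟩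
    · exact h
    · exact h1.trans h2.symm
  · have hk2 := hk'.of_pathEqv hT hQ h2
    rcases hr.preds_meet hT hQ (h.symm.trans h1) with h3 | ⟨t, j, h3, h4⟩
    · exact absurd (h3.head_eq ▸ hk2.adj) (G.loopless.irrefl _)
    · exact absurd (hk.of_pathEqv hT hQ h3).adj
        ((hk2.of_pathEqv hT hQ (h4.cons z)).not_adj_of_pred (.refl _))
  · exact absurd rfl ((hk'.of_pathEqv hT hQ (h'.trans (h.cons z))).ne_of_pred (.refl _))

/-- Lifts of an edge are unique: two lifts through different predecessors of `v` can be rerouted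
through a common predecessor of those, and lifts at different levels contradict reducedness. -/
theorem unique {v z : V} {m k k' : List V} (hm : ReducedPath G v₀ (v :: m))
    (hk : ReducedPath G v₀ (z :: k)) (hk' : ReducedPath G v₀ (z :: k'))
    (h : PathNb G v m z k) (h' : PathNb G v m z k') : PathEqv G (z :: k) (z :: k') := by
  have mixed {k k' : List V} (hk' : ReducedPath G v₀ (z :: k')) {u : V} {l : List V}
      (h1 : PathEqv G (v :: m) (v :: u :: l)) (h2 : PathEqv G (z :: k) (z :: u :: l))
      (hk : ReducedPath G v₀ (z :: k)) (h' : PathEqv G (z :: k') (z :: v :: m)) : False :=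
    (hk'.of_pathEqv hT hQ (h'.trans (h1.cons z))).not_adj_of_pred (.refl _)
      (hk.of_pathEqv hT hQ h2).adj
  rcases h with h | ⟨u, l, h1, h2⟩ | h
  · exact unique_aux hT hQ hm hk hk' h h'
  · rcases h' with h' | ⟨u', l', h3, h4⟩ | h'
    · exact (unique_aux hT hQ hm hk' hk h' (Or.inr (Or.inl ⟨u, l, h1, h2⟩))).symm
    · have hr := hm.of_pathEqv hT hQ h1
      refine h2.trans (PathEqv.trans ?_ h4.symm)
      rcases hr.preds_meet hT hQ (h1.symm.trans h3) with h | ⟨t, j, h5, h6⟩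
      · exact h.cons z
      · have e1 := hk.of_pathEqv hT hQ (h2.trans (h5.cons z))
        have e2 := hk'.of_pathEqv hT hQ (h4.trans (h6.cons z))
        exact (h5.cons z).trans ((PathEqv.swap j e1.adj.symm e1.tail.adj.symm e2.adj.symm
          e2.tail.adj.symm).trans (h6.cons z).symm)
    · exact (mixed hk' h1 h2 hk h').elim
  · rcases h' with h' | ⟨u', l', h3, h4⟩ | h'
    · exact (unique_aux hT hQ hm hk' hk h' (Or.inr (Or.inr h))).symm
    · exact (mixed hk h3 h4 hk' h).elim
    · exact h.trans h'.symm

theorem trans_aux {v z w : V} {m k j : List V} (hm : ReducedPath G v₀ (v :: m))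
    (hk : ReducedPath G v₀ (z :: k)) (hj : ReducedPath G v₀ (w :: j)) (hzw : G.Adj z w)
    (h : PathEqv G (v :: m) (v :: z :: k)) (h' : PathNb G v m w j) : PathNb G z k w j := by
  have hr := hm.of_pathEqv hT hQ h
  rcases h' with h' | ⟨u, l, h1, h2⟩ | h'
  · rcases hr.preds_meet hT hQ (h.symm.trans h') with h3 | ⟨t, i, h3, h4⟩
    · exact absurd (h3.head_eq ▸ hzw) (G.loopless.irrefl _)
    · exact Or.inr (Or.inl ⟨t, i, h3, h4⟩)
  · rcases hr.preds_meet hT hQ (h.symm.trans h1) with h3 | ⟨t, i, h3, h4⟩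
    · exact Or.inr (Or.inr (h2.trans (h3.cons w).symm))
    · have e1 := hj.of_pathEqv hT hQ (h2.trans (h4.cons w))
      have e2 := hk.of_pathEqv hT hQ h3
      exact Or.inr (Or.inr ((h2.trans (h4.cons w)).trans ((PathEqv.swap i e1.adj.symm
        e1.tail.adj.symm hzw.symm e2.adj.symm).trans (h3.cons w).symm)))
  · exact absurd hzw ((hj.of_pathEqv hT hQ (h'.trans (h.cons w))).not_adj_of_pred (.refl _))

/-- Triangles lift. In the level case with distinct predecessors, the triangle condition applied to
`zw` from a vertex two steps down gives a predecessor shared by `z` and `w`. -/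
theorem trans {v z w : V} {m k j : List V} (hm : ReducedPath G v₀ (v :: m))
    (hk : ReducedPath G v₀ (z :: k)) (hj : ReducedPath G v₀ (w :: j)) (hzw : G.Adj z w)
    (h : PathNb G v m z k) (h' : PathNb G v m w j) : PathNb G z k w j := by
  have mixed {z w : V} {k j : List V} (hk : ReducedPath G v₀ (z :: k))
      (hj : ReducedPath G v₀ (w :: j)) (hzw : G.Adj z w) {u : V} {l : List V}
      (h1 : PathEqv G (v :: m) (v :: u :: l)) (h2 : PathEqv G (z :: k) (z :: u :: l))
      (h' : PathEqv G (w :: j) (w :: v :: m)) : PathNb G z k w j := by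
    have e1 := hj.of_pathEqv hT hQ (h'.trans (h1.cons w))
    have e2 := hk.of_pathEqv hT hQ h2
    exact Or.inr (Or.inr ((h'.trans (h1.cons w)).trans ((PathEqv.swap l e1.adj.symm
      e1.tail.adj.symm hzw.symm e2.adj.symm).trans (h2.cons w).symm)))
  rcases h with h | ⟨u, l, h1, h2⟩ | h
  · exact trans_aux hT hQ hm hk hj hzw h h'
  · rcases h' with h' | ⟨u', l', h3, h4⟩ | h'
    · exact (trans_aux hT hQ hm hj hk hzw.symm h' (Or.inr (Or.inl ⟨u, l, h1, h2⟩))).symm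
    · have hr := hm.of_pathEqv hT hQ h1
      rcases hr.preds_meet hT hQ (h1.symm.trans h3) with h | ⟨t, i, h5, h6⟩
      · exact Or.inr (Or.inl ⟨u', l', h2.trans (h.cons z), h4⟩)
      · have g1 := h2.trans (h5.cons z)
        have g2 := h4.trans (h6.cons w)
        have e1 := hk.of_pathEqv hT hQ g1
        have e2 := hj.of_pathEqv hT hQ g2
        obtain ⟨r, hr1, hr2, hr3⟩ := hT hzw e1.tail.adj.symm e1.adj
          (e1.ne_of_pred (.refl _)) (e1.not_adj_of_pred (.refl _)) e2.tail.adj.symm e2.adj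
          (e2.ne_of_pred (.refl _)) (e2.not_adj_of_pred (.refl _))
        exact Or.inr (Or.inl ⟨r, t :: i,
          g1.trans (.swap i e1.adj.symm e1.tail.adj.symm hr2.symm hr1),
          g2.trans (.swap i e2.adj.symm e2.tail.adj.symm hr3.symm hr1)⟩)
    · exact mixed hk hj hzw h1 h2 h'
  · rcases h' with h' | ⟨u', l', h3, h4⟩ | h'
    · exact (trans_aux hT hQ hm hj hk hzw.symm h' (Or.inr (Or.inr h))).symm
    · exact (mixed hj hk hzw.symm h3 h4 h).symm
    · exact Or.inr (Or.inl ⟨v, m, h, h'⟩)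

end PathNb

/-- The reduced paths from `v₀` to `v`, up to equivalence. -/
def reducedPathSetoid (G : SimpleGraph V) (v₀ v : V) :
    Setoid {m : List V // ReducedPath G v₀ (v :: m)} where
  r a b := PathEqv G (v :: a.1) (v :: b.1)
  iseqv := ⟨fun _ => .refl _, fun h => h.symm, fun h h' => h.trans h'⟩

/-- The local system of the classes of reduced paths. -/
noncomputable def reducedPathSystem (hT : G.LocalTriangleCondition)
    (hQ : G.LocalQuadrangleCondition) (v₀ : V) : LocalSystem G where
  fiber v := Quotient (reducedPathSetoid G v₀ v)
  tr h a := Quotient.mk _ ⟨(PathNb.exists_of_adj hT hQ a.out.2 h).choose,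
    (PathNb.exists_of_adj hT hQ a.out.2 h).choose_spec.1⟩
  tr_symm := by
    intro u v h a
    conv_rhs => rw [← Quotient.out_eq a]
    refine Quotient.sound ?_
    generalize_proofs h1 _ h3
    have e : PathEqv G (v :: h1.choose) (v :: (Quotient.mk (reducedPathSetoid G v₀ v)
      ⟨h1.choose, h1.choose_spec.1⟩).out.1) :=
        (Quotient.mk_out (s := reducedPathSetoid G v₀ v) ⟨h1.choose, h1.choose_spec.1⟩).symm
    exact PathNb.unique hT hQ (h1.choose_spec.1.of_pathEqv hT hQ e) h3.choose_spec.1 a.out.2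
      h3.choose_spec.2 (h1.choose_spec.2.congr_right e).symm
  tr_tr := by
    intro u v w huv hvw huw a
    refine Quotient.sound ?_
    generalize_proofs h1 _ h3 _ h4
    have e : PathEqv G (v :: h1.choose) (v :: (Quotient.mk (reducedPathSetoid G v₀ v)
      ⟨h1.choose, h1.choose_spec.1⟩).out.1) :=
        (Quotient.mk_out (s := reducedPathSetoid G v₀ v) ⟨h1.choose, h1.choose_spec.1⟩).symm
    exact PathNb.unique hT hQ (h1.choose_spec.1.of_pathEqv hT hQ e) h3.choose_spec.1
      h4.choose_spec.1 h3.choose_spec.2 (PathNb.trans hT hQ a.out.2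
        (h1.choose_spec.1.of_pathEqv hT hQ e) h4.choose_spec.1 hvw
        (h1.choose_spec.2.congr_right e) h4.choose_spec.2)

theorem reducedPathSystem_tr {hT : G.LocalTriangleCondition}
    {hQ : G.LocalQuadrangleCondition} {v z : V} (h : G.Adj v z) {m k : List V}
    (hm : ReducedPath G v₀ (v :: m)) (hk : ReducedPath G v₀ (z :: k))
    (hmk : PathNb G v m z k) :
    (reducedPathSystem hT hQ v₀).tr h (Quotient.mk _ ⟨m, hm⟩) = Quotient.mk _ ⟨k, hk⟩ := by
  refine Quotient.sound ?_
  generalize_proofs h1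
  have e : PathEqv G (v :: m) (v :: (Quotient.mk (reducedPathSetoid G v₀ v) ⟨m, hm⟩).out.1) :=
    (Quotient.mk_out (s := reducedPathSetoid G v₀ v) ⟨m, hm⟩).symm
  exact PathNb.unique hT hQ (hm.of_pathEqv hT hQ e) h1.choose_spec.1 hk h1.choose_spec.2
    (hmk.congr_left e)

/-! ### One-sheetedness of the covering and global weak modularity. -/

namespace ReducedPath

/-- The section through the trivial path must, by induction along any reduced path, take the class
of that path at its end. Hence all reduced paths to `v` have the same class. -/
theorem pathEqv_of_hasParallelSections.{u} {V : Type u} {G : SimpleGraph V} {v₀ : V}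
    (hT : G.LocalTriangleCondition) (hQ : G.LocalQuadrangleCondition)
    (hsec : HasParallelSections.{u, u} G) {v : V} {m k : List V}
    (hm : ReducedPath G v₀ (v :: m)) (hk : ReducedPath G v₀ (v :: k)) :
    PathEqv G (v :: m) (v :: k) := by
  obtain ⟨f, hf0, hf⟩ := hsec (reducedPathSystem hT hQ v₀) v₀ (Quotient.mk _ ⟨[], rfl⟩)
  have key (m : List V) : ∀ v (hm : ReducedPath G v₀ (v :: m)),
      f v = Quotient.mk _ ⟨m, hm⟩ := by
    induction m with
    | nil =>
      intro v hm
      obtain rfl : v = v₀ := hm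
      exact hf0
    | cons u l ih =>
      intro v hm
      rw [hf u v hm.adj, ih u hm.tail]
      exact reducedPathSystem_tr hm.adj hm.tail hm (Or.inr (Or.inr (.refl _)))
  exact Quotient.exact ((key m v hm).symm.trans (key k v hk))

theorem dist_le_length (hG : G.Connected) (m : List V) :
    ∀ v, ReducedPath G v₀ (v :: m) → G.dist v₀ v ≤ m.length := by
  induction m with
  | nil =>
    intro v hm
    obtain rfl : v = v₀ := hm
    simp
  | cons u l ih =>
    intro v hm
    have h1 := ih u hm.tail
    have h2 := hm.adj.symm.dist_le_dist_add_one hG v₀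
    simp only [List.length_cons]
    omega

theorem exists_length_le (hG : G.Connected) (hT : G.LocalTriangleCondition)
    (hQ : G.LocalQuadrangleCondition) (n : ℕ) :
    ∀ v, G.dist v₀ v = n → ∃ m, ReducedPath G v₀ (v :: m) ∧ m.length ≤ n := by
  induction n with
  | zero =>
    intro v hv
    obtain rfl := hG.dist_eq_zero_iff.1 hv
    exact ⟨[], rfl, le_rfl⟩
  | succ n ih =>
    intro v hv
    have hne : v₀ ≠ v := by
      rintro rfl
      simp at hv
    obtain ⟨x, hx, hd⟩ := hG.exists_adj_dist_add_one hne
    obtain ⟨m, hm, hl⟩ := ih x (by omega)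
    obtain ⟨k, hk, h⟩ := PathNb.exists_of_adj hT hQ hm hx
    refine ⟨k, hk, ?_⟩
    rcases h with h | ⟨u, l, h1, h2⟩ | h
    · have := h.length_eq
      simp only [List.length_cons] at this
      omega
    · have := h1.length_eq
      have := h2.length_eq
      simp only [List.length_cons] at *
      omega
    · have := h.length_eq
      simp only [List.length_cons] at this
      omega

end ReducedPath

/-- A locally weakly modular graph that is combinatorially simply connected is weakly modular. -/
theorem IsLocallyWeaklyModular.isWeaklyModular.{u} {V : Type u} {G : SimpleGraph V}
    (hG : G.Connected) (h : G.IsLocallyWeaklyModular) (hsec : HasParallelSections.{u, u} G) :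
    G.IsWeaklyModular := by
  have hT := h.localTriangleCondition hG
  have hQ := h.localQuadrangleCondition hG
  intro v₀
  -- Equivalent paths have equal length, some reduced path is no longer than the distance, and no
  -- walk is shorter.
  have hlen {v : V} {m : List V} (hm : ReducedPath G v₀ (v :: m)) : m.length = G.dist v₀ v := by
    obtain ⟨k, hk, hl⟩ := ReducedPath.exists_length_le hG hT hQ _ v rfl
    have h1 := (hm.pathEqv_of_hasParallelSections hT hQ hsec hk).length_eq
    have h2 := hm.dist_le_length hG
    simp only [List.length_cons] at h1
    omega
  have hex (v : V) : ∃ m, ReducedPath G v₀ (v :: m) :=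
    let ⟨m, hm, _⟩ := ReducedPath.exists_length_le hG hT hQ _ v rfl
    ⟨m, hm⟩
  refine ⟨fun v w hvw hv hvw' => ?_, fun v w z hvz hwz hvw _ hd hz => ?_⟩
  · rw [dist_eq_one_iff_adj] at hvw
    obtain ⟨m, hm⟩ := hex v
    obtain ⟨k, hk, hnb⟩ := PathNb.exists_of_adj hT hQ hm hvw
    have h1 := hlen hm
    have h2 := hlen hk
    rcases hnb with h | ⟨u, l, h3, h4⟩ | h
    · have := h.length_eq
      simp only [List.length_cons] at this
      omega
    · have h5 := hm.of_pathEqv hT hQ h3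
      refine ⟨u, h5.adj, (hk.of_pathEqv hT hQ h4).adj, ?_⟩
      rw [← hlen h5.tail, ← hlen h5]
      rfl
    · have := h.length_eq
      simp only [List.length_cons] at this
      omega
  · rw [dist_eq_one_iff_adj] at hvz hwz
    have up {v : V} (hvz : G.Adj v z) (hd : G.dist v₀ v + 1 = G.dist v₀ z) :
        ∃ m, ReducedPath G v₀ (z :: v :: m) := by
      obtain ⟨m, hm⟩ := hex v
      obtain ⟨k, hk, hnb⟩ := PathNb.exists_of_adj hT hQ hm hvz
      have h1 := hlen hm
      have h2 := hlen hk
      rcases hnb with h | ⟨u, l, h3, h4⟩ | h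
      · have := h.length_eq
        simp only [List.length_cons] at this
        omega
      · have := h3.length_eq
        have := h4.length_eq
        simp only [List.length_cons] at *
        omega
      · exact ⟨m, hk.of_pathEqv hT hQ h⟩
    obtain ⟨m, hm⟩ := up hvz (by omega)
    obtain ⟨k, hk⟩ := up hwz hz
    have he := hm.pathEqv_of_hasParallelSections hT hQ hsec hk
    rcases hm.preds_meet hT hQ he with h | ⟨t, i, h1, h2⟩
    · exact absurd h.head_eq (ne_of_dist_eq_two hvw)
    · have h3 := hm.tail.of_pathEqv hT hQ h1
      refine ⟨t, h3.adj, (hk.tail.of_pathEqv hT hQ h2).adj, ?_⟩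
      rw [← hlen h3.tail, ← hlen h3]
      rfl

end SimpleGraph

namespace SimpleGraph

variable {V : Type*} {G : SimpleGraph V}

/-! ### Squares -/

/-- The vertices `a, b, c, d` form an induced 4-cycle, in this order. -/
structure IsSquare (G : SimpleGraph V) (a b c d : V) : Prop where
  ab : G.Adj a b
  bc : G.Adj b c
  cd : G.Adj c d
  da : G.Adj d a
  ac_ne : a ≠ c
  bd_ne : b ≠ d
  ac : ¬ G.Adj a c
  bd : ¬ G.Adj b d

namespace IsSquare

variable {a b c d : V}

theorem rotate (h : G.IsSquare a b c d) : G.IsSquare b c d a :=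
  ⟨h.bc, h.cd, h.da, h.ab, h.bd_ne, h.ac_ne.symm, h.bd, fun h' => h.ac h'.symm⟩

theorem flip (h : G.IsSquare a b c d) : G.IsSquare a d c b :=
  ⟨h.da.symm, h.cd.symm, h.bc.symm, h.ab.symm, h.ac_ne, h.bd_ne.symm, h.ac, fun h' => h.bd h'.symm⟩

end IsSquare

/-- A vertex adjacent to the four given vertices. -/
def HasHub (G : SimpleGraph V) (a b c d : V) : Prop :=
  ∃ h, G.Adj h a ∧ G.Adj h b ∧ G.Adj h c ∧ G.Adj h d

/-- Four pairwise adjacent vertices, each adjacent to the ends of exactly one side of the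
4-cycle `a, b, c, d`. -/
def HasCap (G : SimpleGraph V) (a b c d : V) : Prop :=
  ∃ p q r s, (G.Adj p a ∧ G.Adj p b ∧ ¬ G.Adj p c ∧ ¬ G.Adj p d) ∧
    (¬ G.Adj q a ∧ G.Adj q b ∧ G.Adj q c ∧ ¬ G.Adj q d) ∧
    (¬ G.Adj r a ∧ ¬ G.Adj r b ∧ G.Adj r c ∧ G.Adj r d) ∧
    (G.Adj s a ∧ ¬ G.Adj s b ∧ ¬ G.Adj s c ∧ G.Adj s d) ∧
    G.Adj p q ∧ G.Adj q r ∧ G.Adj r s ∧ G.Adj s p ∧ G.Adj p r ∧ G.Adj q s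

/-- The square is contained in a `W₄` or in an `M₄`. -/
def IsGoodSquare (G : SimpleGraph V) (a b c d : V) : Prop := HasHub G a b c d ∨ HasCap G a b c d

theorem IsGoodSquare.rotate {a b c d : V} (h : G.IsGoodSquare a b c d) :
    G.IsGoodSquare b c d a := by
  rcases h with ⟨h, h1, h2, h3, h4⟩ | ⟨p, q, r, s, hp, hq, hr, hs, h1, h2, h3, h4, h5, h6⟩
  · exact Or.inl ⟨h, h2, h3, h4, h1⟩
  · exact Or.inr ⟨q, r, s, p, by tauto, by tauto, by tauto, by tauto, h2, h3, h4, h1, h6, h5.symm⟩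

theorem IsGoodSquare.flip {a b c d : V} (h : G.IsGoodSquare a b c d) :
    G.IsGoodSquare a d c b := by
  rcases h with ⟨h, h1, h2, h3, h4⟩ | ⟨p, q, r, s, hp, hq, hr, hs, h1, h2, h3, h4, h5, h6⟩
  · exact Or.inl ⟨h, h1, h4, h3, h2⟩
  · exact Or.inr ⟨s, r, q, p, by tauto, by tauto, by tauto, by tauto, h3.symm, h2.symm, h1.symm,
      h4.symm, h6.symm, h5.symm⟩

/-- The local conditions satisfied by pre-median graphs. -/
structure IsLocallyPreMedian (G : SimpleGraph V) : Prop where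
  triangle : G.LocalTriangleCondition
  quadrangle : G.LocalQuadrangleCondition
  not_bipartite : ∀ ⦃a b x y z : V⦄, a ≠ b → ¬ G.Adj a b → x ≠ y → ¬ G.Adj x y → x ≠ z →
    ¬ G.Adj x z → y ≠ z → ¬ G.Adj y z → G.Adj a x → G.Adj a y → G.Adj a z → G.Adj b x →
    G.Adj b y → G.Adj b z → False
  spoke : ∀ ⦃a b c d h : V⦄, G.IsSquare a b c d → G.Adj h b → G.Adj h c → G.Adj h d → h ≠ a →
    G.Adj h a

/-! ### Link components -/

/-- Adjacency in the link of `a`. -/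
def LinkAdj (G : SimpleGraph V) (a x y : V) : Prop := G.Adj a x ∧ G.Adj a y ∧ G.Adj x y

/-- Being in the same connected component of the link of `a`. -/
def LinkConn (G : SimpleGraph V) (a : V) : V → V → Prop := Relation.ReflTransGen (G.LinkAdj a)

theorem LinkConn.symm {a x y : V} (h : G.LinkConn a x y) : G.LinkConn a y x := by
  induction h with
  | refl => exact .refl
  | tail _ h ih => exact .head ⟨h.2.1, h.1, h.2.2.symm⟩ ih

theorem LinkConn.trans {a x y z : V} (h : G.LinkConn a x y) (h' : G.LinkConn a y z) :
    G.LinkConn a x z := Relation.ReflTransGen.trans h h'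

theorem linkConn_of_adj {a x y : V} (hx : G.Adj a x) (hy : G.Adj a y) (h : G.Adj x y) :
    G.LinkConn a x y := .single ⟨hx, hy, h⟩

theorem IsGoodSquare.linkConn {a b c d : V} (hsq : G.IsSquare a b c d)
    (h : G.IsGoodSquare a b c d) : G.LinkConn a b d := by
  rcases h with ⟨h, h1, h2, h3, h4⟩ | ⟨p, q, r, s, hp, hq, hr, hs, h1, h2, h3, h4, h5, h6⟩
  · exact (linkConn_of_adj hsq.ab h1.symm h2.symm).trans (linkConn_of_adj h1.symm hsq.da.symm h4)
  · exact ((linkConn_of_adj hsq.ab hp.1.symm hp.2.1.symm).trans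
      (linkConn_of_adj hp.1.symm hs.1.symm h4.symm)).trans
      (linkConn_of_adj hs.1.symm hsq.da.symm hs.2.2.2)

namespace IsLocallyPreMedian

variable (hL : G.IsLocallyPreMedian) {a b c d : V}

include hL

/-- A vertex adjacent to two adjacent vertices of a square without hub is not adjacent to the
other two. -/
theorem not_adj_of_adj_side (hsq : G.IsSquare a b c d) (hbad : ¬ G.HasHub a b c d) {t : V}
    (ha : G.Adj t a) (hb : G.Adj t b) : ¬ G.Adj t c ∧ ¬ G.Adj t d := by
  have hc : t ≠ c := by
    rintro rfl
    exact hsq.ac ha.symm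
  have hd : t ≠ d := by
    rintro rfl
    exact hsq.bd hb.symm
  have h1 : G.Adj t c → ¬ G.Adj t d := fun h1 h2 => hbad ⟨t, ha, hb, h1, h2⟩
  have h2 : G.Adj t d → G.Adj t c := fun h => hL.spoke hsq.rotate.rotate h ha hb hc
  have h3 : G.Adj t c → G.Adj t d := fun h => hL.spoke hsq.rotate.rotate.rotate ha hb h hd
  exact ⟨fun h => h1 h (h3 h), fun h => h1 (h2 h) h⟩

/-- A vertex adjacent to two adjacent vertices of a square without hub spans a triangular prism
together with the square. -/
theorem exists_prism (hsq : G.IsSquare a b c d) (hbad : ¬ G.HasHub a b c d) {t : V}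
    (ha : G.Adj t a) (hb : G.Adj t b) :
    ∃ s, G.Adj s t ∧ G.Adj s c ∧ G.Adj s d ∧ ¬ G.Adj s a ∧ ¬ G.Adj s b := by
  obtain ⟨h1, h2⟩ := hL.not_adj_of_adj_side hsq hbad ha hb
  obtain ⟨s, hs1, hs2, hs3⟩ := hL.triangle hsq.cd hb.symm hsq.bc
    (by rintro rfl; exact hsq.ac ha.symm) h1 ha.symm hsq.da.symm
    (by rintro rfl; exact hsq.bd hb.symm) h2
  refine ⟨s, hs1, hs2, hs3, ?_⟩
  refine hL.not_adj_of_adj_side hsq.rotate.rotate ?_ hs2 hs3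
  rintro ⟨h, h1, h2, h3, h4⟩
  exact hbad ⟨h, h3, h4, h1, h2⟩

/-- A third common neighbour of `a` and `c` would form `K_{2,3}` with the square if adjacent to
neither `b` nor `d`; otherwise the missing spoke is forced and it is a hub. -/
theorem eq_or_eq_of_common_adj (hsq : G.IsSquare a b c d) (hbad : ¬ G.HasHub a b c d) {x : V}
    (ha : G.Adj x a) (hc : G.Adj x c) : x = b ∨ x = d := by
  by_contra! hne
  obtain ⟨hb, hd⟩ := hne
  by_cases h1 : G.Adj x b
  · exact (hL.not_adj_of_adj_side hsq hbad ha h1).1 hc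
  by_cases h2 : G.Adj x d
  · exact h1 (hL.spoke hsq.rotate hc h2 ha hb)
  exact hL.not_bipartite hsq.ac_ne hsq.ac hsq.bd_ne hsq.bd hb.symm (fun h => h1 h.symm) hd.symm
    (fun h => h2 h.symm) hsq.ab hsq.da.symm ha.symm hsq.bc.symm hsq.cd hc.symm

/-- Adjacent vertices that form triangles with consecutive sides of a square. -/
theorem isGoodSquare_of_adj_adj (hsq : G.IsSquare a b c d) {p h : V} (hpa : G.Adj p a)
    (hpb : G.Adj p b) (hha : G.Adj h a) (hhd : G.Adj h d) (hph : G.Adj p h) :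
    G.IsGoodSquare a b c d := by
  by_contra hbad
  have hub : ¬ G.HasHub a b c d := fun h => hbad (Or.inl h)
  have hub' : ¬ G.HasHub a d c b := fun ⟨h, h1, h2, h3, h4⟩ => hub ⟨h, h1, h4, h3, h2⟩
  obtain ⟨pc, pd⟩ := hL.not_adj_of_adj_side hsq hub hpa hpb
  obtain ⟨hc, hb⟩ := hL.not_adj_of_adj_side hsq.flip hub' hha hhd
  obtain ⟨s, sp, sc, sd, sa, sb⟩ := hL.exists_prism hsq hub hpa hpb
  obtain ⟨k, kh, kc, kb, ka, kd⟩ := hL.exists_prism hsq.flip hub' hha hhd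
  have ne {x y z : V} (h1 : G.Adj x z) (h2 : ¬ G.Adj y z) : x ≠ y := fun e => h2 (e ▸ h1)
  -- Otherwise `k h p b` is a square in which `a` sees all vertices but `k`, an induced `W₄⁻`. The
  -- next two adjacencies are forced in the same manner.
  have kp : G.Adj k p := by
    by_contra hn
    exact ka (hL.spoke (a := k) (b := h) (c := p) (d := b)
      ⟨kh, hph.symm, hpb, kb.symm, ne kc pc, ne hhd hsq.bd, hn, hb⟩ hha.symm hpa.symm hsq.ab
      (ne kc hsq.ac).symm).symm
  have hs : G.Adj s h := by
    by_contra hn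
    exact sa (hL.spoke (a := s) (b := p) (c := h) (d := d)
      ⟨sp, hph, hhd, sd.symm, ne sc hc, ne hpb fun h => hsq.bd h.symm, hn, pd⟩ hpa.symm
      hha.symm hsq.da.symm (ne sc hsq.ac).symm).symm
  have ks : G.Adj k s := by
    by_contra hn
    exact sb (hL.spoke (a := s) (b := p) (c := k) (d := c)
      ⟨sp, kp.symm, kc, sc.symm, (ne kb sb).symm, ne hpa fun h => hsq.ac h.symm, fun h => hn h.symm,
        pc⟩ hpb.symm kb.symm hsq.bc (ne sd hsq.bd).symm).symm
  exact hbad (Or.inr ⟨p, k, s, h, ⟨hpa, hpb, pc, pd⟩, ⟨ka, kb, kc, kd⟩, ⟨sa, sb, sc, sd⟩,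
    ⟨hha, hb, hc, hhd⟩, kp.symm, ks, hs, hph.symm, sp.symm, kh⟩)

/-- Squares that are not good propagate along the triangles at one of their sides. -/
theorem exists_bad_square (hsq : G.IsSquare a b c d) (hbad : ¬ G.IsGoodSquare a b c d) {t : V}
    (ha : G.Adj t a) (hb : G.Adj t b) :
    ∃ s, G.IsSquare a t s d ∧ ¬ G.IsGoodSquare a t s d := by
  have hub : ¬ G.HasHub a b c d := fun h => hbad (Or.inl h)
  have ne {x y z : V} (h1 : G.Adj x z) (h2 : ¬ G.Adj y z) : x ≠ y := fun e => h2 (e ▸ h1)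
  obtain ⟨tc, td⟩ := hL.not_adj_of_adj_side hsq hub ha hb
  obtain ⟨s, st, sc, sd, sa, sb⟩ := hL.exists_prism hsq hub ha hb
  refine ⟨s, ⟨ha.symm, st.symm, sd, hsq.da, (ne sc hsq.ac).symm, ne hb fun h => hsq.bd h.symm,
    fun h => sa h.symm, td⟩, ?_⟩
  rintro (⟨h, h1, h2, -, h4⟩ | ⟨e₁, e₂, e₃, e₄, ⟨ea1, et1, es1, ed1⟩, ⟨ea2, et2, es2, ed2⟩,
    -, ⟨ea4, et4, es4, ed4⟩, h12, -, -, h41, -, -⟩)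
  · exact hbad (hL.isGoodSquare_of_adj_adj hsq ha hb h1 h4 h2.symm)
  have hub' : ¬ G.HasHub a d c b := fun ⟨h, h1, h2, h3, h4⟩ => hub ⟨h, h1, h4, h3, h2⟩
  -- The remaining case is a cap over `a t s d`. It is excluded by looking from `c`: neither `e₁`
  -- nor `e₂` is adjacent to `b` or `d`, the only common neighbours of `a` and `c`.
  have e1b : ¬ G.Adj e₁ b := fun h =>
    hbad (hL.isGoodSquare_of_adj_adj hsq ea1 h ea4 ed4 h41.symm)
  have e1b' : e₁ ≠ b := by
    rintro rfl
    exact (hL.not_adj_of_adj_side hsq.flip hub' ea4 ed4).2 h41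
  have hsq' : G.IsSquare b t s c := ⟨hb.symm, st.symm, sc, hsq.bc.symm, (ne sd hsq.bd).symm,
    ne ha fun h => hsq.ac h.symm, fun h => sb h.symm, tc⟩
  have hub2 : ¬ G.HasHub b t s c := by
    rintro ⟨h, h1, h2, -, h4⟩
    exact hbad (hL.isGoodSquare_of_adj_adj hsq.rotate.flip hb ha h1 h4
      h2.symm).flip.rotate.rotate.rotate
  have e2b : ¬ G.Adj e₂ b := fun h =>
    (hL.not_adj_of_adj_side hsq'.rotate (fun ⟨h, h1, h2, h3, h4⟩ => hub2 ⟨h, h4, h1, h2, h3⟩)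
      et2 es2).2 h
  have e2c : ¬ G.Adj e₂ c := fun h =>
    (hL.not_adj_of_adj_side hsq'.rotate (fun ⟨h, h1, h2, h3, h4⟩ => hub2 ⟨h, h4, h1, h2, h3⟩)
      et2 es2).1 h
  have e1c : ¬ G.Adj e₁ c := fun h => by
    rcases hL.eq_or_eq_of_common_adj hsq hub ea1 h with rfl | rfl
    · exact e1b' rfl
    · exact td et1.symm
  have ca : ¬ G.Adj c a := fun h => hsq.ac h.symm
  -- If `e₁` were at distance two from `c`, the triangle condition for `a e₁` would make `b` or `d`
  -- adjacent to `e₁`. So the distance is three, and the quadrangle condition makes `b` or `d`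
  -- adjacent to `e₂`.
  have far (r : V) (rc : G.Adj r c) : ¬ G.Adj r e₁ := fun re => by
    obtain ⟨x, xc, xa, xe⟩ := hL.triangle (u := c) (v := a) (w := e₁) ea1.symm hsq.bc
      hsq.ab.symm hsq.ac_ne.symm ca rc re (ne hsq.bc.symm e1b) fun h => e1c h.symm
    rcases hL.eq_or_eq_of_common_adj hsq hub xa xc with rfl | rfl
    · exact e1b xe.symm
    · exact ed1 xe.symm
  obtain ⟨x, xc, xa, xe⟩ := hL.quadrangle (u := c) (v := a) (w := e₂) (z := e₁) ea1 h12
    (ne es2 fun h => sa h.symm).symm (fun h => ea2 h.symm) hsq.bc hsq.ab.symm hsq.ac_ne.symm ca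
    sc es2.symm (ne hsq.bc.symm e2b) (fun h => e2c h.symm) (ne hsq.bc.symm e1b)
    (fun h => e1c h.symm) far
  rcases hL.eq_or_eq_of_common_adj hsq hub xa xc with rfl | rfl
  · exact e2b xe.symm
  · exact ed2 xe.symm

/-- Badness is carried from `b` along the link component of `a` until `b` becomes `d`, which leaves
a square with two equal opposite corners. -/
theorem isGoodSquare_of_linkConn (hsq : G.IsSquare a b c d) (h : G.LinkConn a b d) :
    G.IsGoodSquare a b c d := by
  by_contra hbad
  have key (p : V) (hp : G.LinkConn a b p) :
      ∃ s, G.IsSquare a p s d ∧ ¬ G.IsGoodSquare a p s d := by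
    induction hp with
    | refl => exact ⟨c, hsq, hbad⟩
    | tail _ h ih =>
      obtain ⟨s, hs, hs'⟩ := ih
      exact hL.exists_bad_square hs hs' h.2.1.symm h.2.2.symm
  obtain ⟨s, hs, -⟩ := key d h
  exact hs.bd_ne rfl

end IsLocallyPreMedian

end SimpleGraph

namespace SimpleGraph

variable {V : Type*} {G : SimpleGraph V}

/-! ### Induced subgraphs -/

theorem not_bipartite_of_not_isIndContained
    (h : ¬ completeBipartiteGraph (Fin 2) (Fin 3) ⊴ G) {a b x y z : V} (hab : a ≠ b)
    (nab : ¬ G.Adj a b) (hxy : x ≠ y) (nxy : ¬ G.Adj x y) (hxz : x ≠ z) (nxz : ¬ G.Adj x z)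
    (hyz : y ≠ z) (nyz : ¬ G.Adj y z) (ax : G.Adj a x) (ay : G.Adj a y) (az : G.Adj a z)
    (bx : G.Adj b x) (bY : G.Adj b y) (bz : G.Adj b z) : False := by
  refine h ⟨⟨⟨Sum.elim ![a, b] ![x, y, z], ?_⟩, ?_⟩⟩
  · rintro (i | i) (j | j) <;> fin_cases i <;> fin_cases j <;>
      simp [hab, hab.symm, hxy, hxy.symm, hxz, hxz.symm, hyz, hyz.symm, ax.ne, ax.ne', ay.ne,
        ay.ne', az.ne, az.ne', bx.ne, bx.ne', bY.ne, bY.ne', bz.ne, bz.ne']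
  · intro i j
    change G.Adj (Sum.elim ![a, b] ![x, y, z] i) (Sum.elim ![a, b] ![x, y, z] j) ↔ _
    revert i j
    rintro (i | i) (j | j) <;> fin_cases i <;> fin_cases j <;>
      simp [nab, nxy, nxz, nyz, ax, ay, az, bx, bY, bz, G.adj_comm b a, G.adj_comm y x,
        G.adj_comm z x, G.adj_comm z y, ax.symm, ay.symm, az.symm, bx.symm, bY.symm, bz.symm]

theorem IsSquare.cycle_adj {q : Fin 4 → V} (h : G.IsSquare (q 0) (q 1) (q 2) (q 3))
    (i j : Fin 4) : G.Adj (q i) (q j) ↔ (cycleGraph 4).Adj i j := by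
  have h1 := h.ab
  have h2 := h.bc
  have h3 := h.cd
  have h4 := h.da
  have h5 := h.ac
  have h6 := h.bd
  have h7 : ¬ G.Adj (q 2) (q 0) := fun h => h5 h.symm
  have h8 : ¬ G.Adj (q 3) (q 1) := fun h => h6 h.symm
  fin_cases i <;> fin_cases j <;>
    simp [h1, h2, h3, h4, h1.symm, h2.symm, h3.symm, h4.symm, h5, h6, h7, h8, cycleGraph_adj] <;>
    decide

theorem IsSquare.cycle_injective {q : Fin 4 → V} (h : G.IsSquare (q 0) (q 1) (q 2) (q 3)) :
    Function.Injective q := by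
  intro i j
  have h1 := h.ab.ne
  have h2 := h.bc.ne
  have h3 := h.cd.ne
  have h4 := h.da.ne
  have h5 := h.ac_ne
  have h6 := h.bd_ne
  fin_cases i <;> fin_cases j <;>
    simp [h1, h2, h3, h4, h1.symm, h2.symm, h3.symm, h4.symm, h5, h6, h5.symm, h6.symm]

theorem isSquare_of_cycleEmbedding (q : cycleGraph 4 ↪g G) :
    G.IsSquare (q 0) (q 1) (q 2) (q 3) := by
  have h (i j : Fin 4) : G.Adj (q i) (q j) ↔ (cycleGraph 4).Adj i j := q.map_adj_iff
  exact ⟨(h _ _).2 (by decide), (h _ _).2 (by decide), (h _ _).2 (by decide),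
    (h _ _).2 (by decide), q.injective.ne (by decide), q.injective.ne (by decide),
    fun h' => absurd ((h _ _).1 h') (by decide), fun h' => absurd ((h _ _).1 h') (by decide)⟩

theorem spoke_of_not_isIndContained (h : ¬ almostWheelFour ⊴ G) {a b c d k : V}
    (hsq : G.IsSquare a b c d) (hb : G.Adj k b) (hc : G.Adj k c) (hd : G.Adj k d)
    (hne : k ≠ a) : G.Adj k a := by
  by_contra hn
  let q : Fin 4 → V := ![a, b, c, d]
  have hq : G.IsSquare (q 0) (q 1) (q 2) (q 3) := hsq
  have hk (i : Fin 4) : k ≠ q i := by fin_cases i <;> simp [q, hne, hb.ne, hc.ne, hd.ne]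
  have hk' (i : Fin 4) : G.Adj k (q i) ↔ i ≠ 0 := by fin_cases i <;> simp [q, hn, hb, hc, hd]
  refine h ⟨⟨⟨fun o => o.elim k q, ?_⟩, ?_⟩⟩
  · rintro (_ | i) (_ | j) hij
    · rfl
    · exact absurd hij (hk j)
    · exact absurd hij.symm (hk i)
    · exact congrArg some (hq.cycle_injective hij)
  · rintro (_ | i) (_ | j)
    · exact iff_of_false G.irrefl (SimpleGraph.irrefl _)
    · exact (hk' j).trans (by simp [almostWheelFour, wheelFour])
    · exact (G.adj_comm _ _).trans ((hk' i).trans (by simp [almostWheelFour, wheelFour]))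
    · exact (hq.cycle_adj i j).trans (by simp [almostWheelFour, wheelFour])

theorem IsPreMedian.isLocallyPreMedian (hG : G.Connected) (h : G.IsPreMedian) :
    G.IsLocallyPreMedian where
  triangle := h.1.isLocallyWeaklyModular.localTriangleCondition hG
  quadrangle := h.1.isLocallyWeaklyModular.localQuadrangleCondition hG
  not_bipartite _ _ _ _ _ := not_bipartite_of_not_isIndContained h.2.1
  spoke _ _ _ _ _ := spoke_of_not_isIndContained h.2.2

theorem exists_wheel_or_mFour_of_isGoodSquare (q : cycleGraph 4 ↪g G)
    (h : G.IsGoodSquare (q 0) (q 1) (q 2) (q 3)) :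
    (∃ f : wheelFour ↪g G, Set.range q ⊆ Set.range f) ∨
      (∃ f : graphMFour ↪g G, Set.range q ⊆ Set.range f) := by
  have hsq := isSquare_of_cycleEmbedding q
  rcases h with ⟨k, h0, h1, h2, h3⟩ | ⟨e₀, e₁, e₂, e₃, p0, p1, p2, p3, h01, h12, h23, h30, h02, h13⟩
  · refine Or.inl ⟨⟨⟨fun o => o.elim k q, ?_⟩, ?_⟩, ?_⟩
    · have hk (i : Fin 4) : k ≠ q i := by
        fin_cases i
        exacts [h0.ne, h1.ne, h2.ne, h3.ne]
      rintro (_ | i) (_ | j) hij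
      · rfl
      · exact absurd hij (hk j)
      · exact absurd hij.symm (hk i)
      · exact congrArg some (q.injective hij)
    · have hk (i : Fin 4) : G.Adj k (q i) := by
        fin_cases i
        exacts [h0, h1, h2, h3]
      rintro (_ | i) (_ | j)
      · exact iff_of_false G.irrefl id
      · exact iff_of_true (hk j) trivial
      · exact iff_of_true (hk i).symm trivial
      · exact hsq.cycle_adj i j
    · rintro _ ⟨i, rfl⟩
      exact ⟨some i, rfl⟩
  · let e : Fin 4 → V := ![e₀, e₁, e₂, e₃]
    have hqe (i j : Fin 4) : G.Adj (e j) (q i) ↔ i = j ∨ i = j + 1 := by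
      fin_cases i <;> fin_cases j <;> simp [e, p0, p1, p2, p3]
    have hee (i j : Fin 4) : G.Adj (e i) (e j) ↔ i ≠ j := by
      fin_cases i <;> fin_cases j <;> simp [e, h01, h12, h23, h30, h02, h13, h01.symm,
        h12.symm, h23.symm, h30.symm, h02.symm, h13.symm]
    -- The neighbours on the rim are opposite for a rim vertex and consecutive for an apex.
    have hne (i j : Fin 4) : q i ≠ e j := by
      intro h
      have h1 := hqe (i + 1) j
      have h2 := hqe (i + 3) j
      rw [← h, hsq.cycle_adj] at h1 h2
      have : ∀ i j : Fin 4, ((cycleGraph 4).Adj i (i + 1) ↔ i + 1 = j ∨ i + 1 = j + 1) →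
          ¬ ((cycleGraph 4).Adj i (i + 3) ↔ i + 3 = j ∨ i + 3 = j + 1) := by decide
      exact this i j h1 h2
    refine Or.inr ⟨⟨⟨Sum.elim q e, ?_⟩, ?_⟩, ?_⟩
    · rintro (i | i) (j | j) hij
      · exact congrArg _ (q.injective hij)
      · exact absurd hij (hne i j)
      · exact absurd hij.symm (hne j i)
      · by_contra hn
        have := (hee i j).2 fun h => hn (h ▸ rfl)
        exact this.ne hij
    · rintro (i | i) (j | j)
      · exact hsq.cycle_adj i j
      · exact (G.adj_comm _ _).trans (hqe i j)
      · exact hqe j i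
      · exact hee i j
    · rintro _ ⟨i, rfl⟩
      exact ⟨.inl i, rfl⟩

theorem hasHub_of_wheel (q : cycleGraph 4 ↪g G) (f : wheelFour ↪g G)
    (h : Set.range q ⊆ Set.range f) : G.HasHub (q 0) (q 1) (q 2) (q 3) := by
  have h0 : ∀ i : Fin 4, i ≠ i + 2 := by decide
  have h2 : ∀ i : Fin 4, ¬ (cycleGraph 4).Adj i (i + 2) := by decide
  have key (i : Fin 4) : G.Adj (f none) (q i) := by
    obtain ⟨x, hx⟩ := h ⟨i, rfl⟩
    obtain ⟨y, hy⟩ := h ⟨i + 2, rfl⟩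
    cases x with
    | some x =>
      rw [← hx]
      exact f.map_adj_iff.2 trivial
    | none =>
      cases y with
      | none => exact absurd (q.injective (hx.symm.trans hy)) (h0 i)
      | some y =>
        have h1 : G.Adj (f none) (f (some y)) := f.map_adj_iff.2 trivial
        rw [hx, hy, q.map_adj_iff] at h1
        exact absurd h1 (h2 i)
  exact ⟨f none, key 0, key 1, key 2, key 3⟩

instance : DecidableRel graphMFour.Adj
  | .inl i, .inl j => inferInstanceAs (Decidable ((cycleGraph 4).Adj i j))
  | .inr i, .inr j => inferInstanceAs (Decidable (i ≠ j))
  | .inl i, .inr j => inferInstanceAs (Decidable (i = j ∨ i = j + 1))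
  | .inr j, .inl i => inferInstanceAs (Decidable (i = j ∨ i = j + 1))

/-- The apex over a side of the rim of `M₄`. -/
def mFourApex : Fin 4 ⊕ Fin 4 → Fin 4 ⊕ Fin 4 → Fin 4 ⊕ Fin 4
  | .inl i, .inl j => if j = i + 1 then .inr i else .inr j
  | x, _ => x

-- A square inside a copy of `M₄` need not be its rim: it may also use apexes, and then it has a
-- hub.
set_option maxRecDepth 100000 in
set_option synthInstance.maxHeartbeats 400000 in
set_option synthInstance.maxSize 4000 in
theorem mFour_square : ∀ a b, graphMFour.Adj a b → ∀ c, graphMFour.Adj b c → a ≠ c →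
    ¬ graphMFour.Adj a c → ∀ d, graphMFour.Adj c d → graphMFour.Adj d a → b ≠ d →
    ¬ graphMFour.Adj b d →
    (∃ h, graphMFour.Adj h a ∧ graphMFour.Adj h b ∧ graphMFour.Adj h c ∧ graphMFour.Adj h d) ∨
    ((graphMFour.Adj (mFourApex a b) a ∧ graphMFour.Adj (mFourApex a b) b ∧
      ¬ graphMFour.Adj (mFourApex a b) c ∧ ¬ graphMFour.Adj (mFourApex a b) d) ∧
    (¬ graphMFour.Adj (mFourApex b c) a ∧ graphMFour.Adj (mFourApex b c) b ∧
      graphMFour.Adj (mFourApex b c) c ∧ ¬ graphMFour.Adj (mFourApex b c) d) ∧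
    (¬ graphMFour.Adj (mFourApex c d) a ∧ ¬ graphMFour.Adj (mFourApex c d) b ∧
      graphMFour.Adj (mFourApex c d) c ∧ graphMFour.Adj (mFourApex c d) d) ∧
    (graphMFour.Adj (mFourApex d a) a ∧ ¬ graphMFour.Adj (mFourApex d a) b ∧
      ¬ graphMFour.Adj (mFourApex d a) c ∧ graphMFour.Adj (mFourApex d a) d) ∧
    graphMFour.Adj (mFourApex a b) (mFourApex b c) ∧
    graphMFour.Adj (mFourApex b c) (mFourApex c d) ∧
    graphMFour.Adj (mFourApex c d) (mFourApex d a) ∧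
    graphMFour.Adj (mFourApex d a) (mFourApex a b) ∧
    graphMFour.Adj (mFourApex a b) (mFourApex c d) ∧
    graphMFour.Adj (mFourApex b c) (mFourApex d a)) := by
  decide

theorem isGoodSquare_of_mFour (q : cycleGraph 4 ↪g G) (f : graphMFour ↪g G)
    (h : Set.range q ⊆ Set.range f) : G.IsGoodSquare (q 0) (q 1) (q 2) (q 3) := by
  have hsq := isSquare_of_cycleEmbedding q
  obtain ⟨a, ha⟩ := h ⟨0, rfl⟩
  obtain ⟨b, hb⟩ := h ⟨1, rfl⟩
  obtain ⟨c, hc⟩ := h ⟨2, rfl⟩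
  obtain ⟨d, hd⟩ := h ⟨3, rfl⟩
  rw [← ha, ← hb, ← hc, ← hd] at hsq ⊢
  obtain ⟨h1, h2, h3, h4, h5, h6, h7, h8⟩ := hsq
  rw [f.map_adj_iff] at h1 h2 h3 h4 h7 h8
  rcases mFour_square a b h1 c h2 (fun e => h5 (congrArg f e)) h7 d h3 h4
    (fun e => h6 (congrArg f e)) h8 with ⟨k, hk⟩ | hk
  · refine Or.inl ⟨f k, ?_⟩
    simpa only [f.map_adj_iff] using hk
  · refine Or.inr ⟨f (mFourApex a b), f (mFourApex b c), f (mFourApex c d),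
      f (mFourApex d a), ?_⟩
    simpa only [f.map_adj_iff] using hk

theorem squaresInWheelFourOrMFour_iff : G.SquaresInWheelFourOrMFour ↔
    ∀ a b c d, G.IsSquare a b c d → G.IsGoodSquare a b c d := by
  constructor
  · intro h a b c d hsq
    let q' : Fin 4 → V := ![a, b, c, d]
    have hq : G.IsSquare (q' 0) (q' 1) (q' 2) (q' 3) := hsq
    let q : cycleGraph 4 ↪g G := ⟨⟨q', hq.cycle_injective⟩, hq.cycle_adj _ _⟩
    change G.IsGoodSquare (q 0) (q 1) (q 2) (q 3)
    rcases h q with ⟨f, hf⟩ | ⟨f, hf⟩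
    · exact Or.inl (hasHub_of_wheel q f hf)
    · exact isGoodSquare_of_mFour q f hf
  · intro h q
    exact exists_wheel_or_mFour_of_isGoodSquare q (h _ _ _ _ (isSquare_of_cycleEmbedding q))

end SimpleGraph

namespace SimpleGraph

variable {V : Type*} {G : SimpleGraph V}

/-! ### Weakly modular graphs and confluence of geodesic descents -/

/-- The bound on the distance can be dropped: at distance one `u` itself serves. -/
theorem IsWeaklyModular.triangle (hW : G.IsWeaklyModular) (hG : G.Connected) {u v w : V}
    (hvw : G.Adj v w) (h : G.dist u v = G.dist u w) :
    ∃ x, G.Adj x v ∧ G.Adj x w ∧ G.dist u x + 1 = G.dist u v := by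
  by_cases h0 : G.dist u v = 0
  · exact absurd ((hG.dist_eq_zero_iff.1 h0).symm.trans (hG.dist_eq_zero_iff.1 (h ▸ h0))) hvw.ne
  by_cases h1 : G.dist u v = 1
  · exact ⟨u, dist_eq_one_iff_adj.1 h1, dist_eq_one_iff_adj.1 (h ▸ h1), by simp [h1]⟩
  exact (hW u).1 v w (dist_eq_one_iff_adj.2 hvw) (by omega) h

theorem IsWeaklyModular.quadrangle (hW : G.IsWeaklyModular) (hG : G.Connected) {u v w z : V}
    (hvz : G.Adj v z) (hwz : G.Adj w z) (hne : v ≠ w) (hn : ¬ G.Adj v w)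
    (h : G.dist u v + 1 = G.dist u z) (h' : G.dist u w + 1 = G.dist u z) :
    ∃ x, G.Adj x v ∧ G.Adj x w ∧ G.dist u x + 1 = G.dist u v := by
  by_cases h0 : G.dist u v = 0
  · exact absurd ((hG.dist_eq_zero_iff.1 h0).symm.trans
      (hG.dist_eq_zero_iff.1 (by omega : G.dist u w = 0))) hne
  by_cases h1 : G.dist u v = 1
  · exact ⟨u, dist_eq_one_iff_adj.1 h1, dist_eq_one_iff_adj.1 (by omega), by simp [h1]⟩
  exact (hW u).2 v w z (dist_eq_one_iff_adj.2 hvz) (dist_eq_one_iff_adj.2 hwz)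
    (hG.dist_eq_two hvz.symm hwz.symm hne hn) (by omega) (by omega) (by omega)

/-- A symmetric relation on states lying over the vertices of a graph such that paths of length
two can be modified along triangles and squares of the graph. -/
structure IsLiftedRelation (G : SimpleGraph V) {σ : Type*} (π : σ → V) (R : σ → σ → Prop) :
    Prop where
  symm : ∀ ⦃X Y⦄, R X Y → R Y X
  adj : ∀ ⦃X Y⦄, R X Y → G.Adj (π X) (π Y)
  triangle : ∀ ⦃X Y v⦄, R X Y → G.Adj v (π X) → G.Adj v (π Y) → ∃ Z, π Z = v ∧ R X Z ∧ R Z Y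
  eq : ∀ ⦃X W Y⦄, R X W → R W Y → π X = π Y → X = Y
  chord : ∀ ⦃X W Y⦄, R X W → R W Y → G.Adj (π X) (π Y) → R X Y
  square : ∀ ⦃X W Y v⦄, R X W → R W Y → π X ≠ π Y → ¬ G.Adj (π X) (π Y) → G.Adj v (π X) →
    G.Adj v (π Y) → ∃ Z, π Z = v ∧ R X Z ∧ R Z Y

namespace IsLiftedRelation

open Relation

variable {σ : Type*} {π : σ → V} {R : σ → σ → Prop}

/-- A step towards `u`. -/
def Descent (G : SimpleGraph V) (π : σ → V) (R : σ → σ → Prop) (u : V) (X Y : σ) : Prop :=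
  R X Y ∧ G.dist u (π Y) + 1 = G.dist u (π X)

variable (hR : IsLiftedRelation G π R) (hG : G.Connected) (hW : G.IsWeaklyModular) (u : V)

include hR

theorem reflTransGen_symm {X Y : σ} (h : ReflTransGen R X Y) : ReflTransGen R Y X := by
  induction h with
  | refl => exact .refl
  | tail _ h ih => exact .head (hR.symm h) ih

include hG

theorem dist_le_of_descent {X Y : σ} (h : ReflTransGen (Descent G π R u) X Y) :
    G.dist u (π Y) + G.dist (π Y) (π X) ≤ G.dist u (π X) := by
  induction h with
  | refl => simp
  | @tail Y Z _ h ih =>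
    have h1 := hG.dist_triangle (u := π Z) (v := π Y) (w := π X)
    rw [dist_eq_one_iff_adj.2 (hR.adj h.1).symm] at h1
    have h2 := h.2
    omega

theorem eq_of_descent {X Y : σ} (h : ReflTransGen (Descent G π R u) X Y)
    (hle : G.dist u (π X) ≤ G.dist u (π Y)) : X = Y := by
  rcases h.cases_head with h | ⟨Z, h1, h2⟩
  · exact h
  · have h3 := h1.2
    have h4 := hR.dist_le_of_descent hG u h2
    omega

include hW

/-- Two descents from one state close up in one more step each, by the triangle or quadrangle
condition lifted to states. Confluence then gives any two connected states a common descendant. -/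
theorem join {X Y : σ} (h : ReflTransGen R X Y) :
    Join (ReflTransGen (Descent G π R u)) X Y := by
  have hconf : ∀ X Y Z, Descent G π R u X Y → Descent G π R u X Z →
      ∃ W, ReflGen (Descent G π R u) Y W ∧ ReflTransGen (Descent G π R u) Z W := by
    intro X Y Z ⟨h1, h2⟩ ⟨h3, h4⟩
    by_cases heq : π Y = π Z
    · obtain rfl := hR.eq (hR.symm h1) h3 heq
      exact ⟨Y, .refl, .refl⟩
    by_cases hadj : G.Adj (π Y) (π Z)
    · have h5 := hR.chord (hR.symm h1) h3 hadj
      obtain ⟨x, hx1, hx2, hx3⟩ := hW.triangle hG (u := u) hadj (by omega)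
      obtain ⟨W, rfl, h6, h7⟩ := hR.triangle h5 hx1 hx2
      exact ⟨W, .single ⟨h6, hx3⟩, .single ⟨hR.symm h7, by omega⟩⟩
    · obtain ⟨x, hx1, hx2, hx3⟩ := hW.quadrangle hG (u := u) (hR.adj h1).symm (hR.adj h3).symm
        heq hadj h2 h4
      obtain ⟨W, rfl, h6, h7⟩ := hR.square (hR.symm h1) h3 heq hadj hx1 hx2
      exact ⟨W, .single ⟨h6, hx3⟩, .single ⟨hR.symm h7, by omega⟩⟩
  have hE := equivalence_join_reflTransGen hconf
  induction h with
  | refl => exact hE.refl X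
  | @tail Y Z _ h ih =>
    refine hE.trans ih ?_
    have h1 := (hR.adj h).dist_le_dist_add_one hG u
    have h2 := (hR.adj h).symm.dist_le_dist_add_one hG u
    rcases lt_trichotomy (G.dist u (π Y)) (G.dist u (π Z)) with h3 | h3 | h3
    · exact ⟨Y, .refl, .single ⟨hR.symm h, by omega⟩⟩
    · obtain ⟨x, hx1, hx2, hx3⟩ := hW.triangle hG (hR.adj h) h3
      obtain ⟨W, rfl, h6, h7⟩ := hR.triangle h hx1 hx2
      exact ⟨W, .single ⟨h6, hx3⟩, .single ⟨hR.symm h7, by omega⟩⟩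
    · exact ⟨Z, .single ⟨h, by omega⟩, .refl⟩

/-- Descend towards `π X`: the common descendant must be `X`, and it is a single step below `Y`. -/
theorem of_reflTransGen {X Y : σ} (h : ReflTransGen R X Y) (ha : G.Adj (π X) (π Y)) : R X Y := by
  obtain ⟨Z, h1, h2⟩ := hR.join hG hW (π X) h
  obtain rfl := hR.eq_of_descent hG _ h1 (by simp)
  rcases h2.cases_head with h | ⟨W, h3, h4⟩
  · exact absurd (h ▸ ha) G.irrefl
  · have h5 := h3.2
    rw [dist_eq_one_iff_adj.2 ha] at h5
    have h6 := hR.eq_of_descent hG _ h4 (by omega)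
    exact hR.symm (h6 ▸ h3.1)

/-- The gate is a projected state closest to `u`. It has no proper descent, so every other state
descends to it, and descents are geodesic. -/
theorem isGated (X₀ : σ) : G.IsGated {v | ∃ X, ReflTransGen R X₀ X ∧ π X = v} := by
  intro u _
  have hne : ∃ n X, ReflTransGen R X₀ X ∧ G.dist u (π X) = n := ⟨_, X₀, .refl, rfl⟩
  classical
  obtain ⟨X, hX, hd⟩ := Nat.find_spec hne
  refine ⟨π X, ⟨X, hX, rfl⟩, ?_⟩
  rintro _ ⟨Y, hY, rfl⟩
  obtain ⟨Z, h1, h2⟩ := hR.join hG hW u ((hR.reflTransGen_symm hX).trans hY)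
  have hlift : ReflTransGen R X Z := ReflTransGen.mono (fun A B h => h.1) _ _ h1
  have hmin := Nat.find_min' hne ⟨Z, hX.trans hlift, rfl⟩
  obtain rfl := hR.eq_of_descent hG u h1 (by omega)
  exact le_antisymm (hR.dist_le_of_descent hG u h2) hG.dist_triangle

end IsLiftedRelation

/-- A connected set of vertices of a weakly modular graph which contains all common neighbours of
any two of its vertices that are adjacent or have a common neighbour in the set is gated. -/
theorem IsWeaklyModular.isGated (hW : G.IsWeaklyModular) (hG : G.Connected) {S : Set V} (hne : S.Nonempty)
    (hconn : ∀ x ∈ S, ∀ y ∈ S, Relation.ReflTransGen (fun a b => G.Adj a b ∧ a ∈ S ∧ b ∈ S) x y)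
    (h1 : ∀ ⦃x y v⦄, x ∈ S → y ∈ S → G.Adj x y → G.Adj v x → G.Adj v y → v ∈ S)
    (h2 : ∀ ⦃x w y v⦄, x ∈ S → w ∈ S → y ∈ S → G.Adj w x → G.Adj w y → x ≠ y → ¬ G.Adj x y →
      G.Adj v x → G.Adj v y → v ∈ S) : G.IsGated S := by
  obtain ⟨x₀, hx₀⟩ := hne
  have hR : IsLiftedRelation G id (fun a b => G.Adj a b ∧ a ∈ S ∧ b ∈ S) :=
    { symm := fun X Y h => ⟨h.1.symm, h.2.2, h.2.1⟩
      adj := fun X Y h => h.1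
      triangle := fun X Y v h hX hY =>
        have hv := h1 h.2.1 h.2.2 h.1 hX hY
        ⟨v, rfl, ⟨hX.symm, h.2.1, hv⟩, hY, hv, h.2.2⟩
      eq := fun X W Y _ _ h => h
      chord := fun X W Y h h' ha => ⟨ha, h.2.1, h'.2.2⟩
      square := fun X W Y v h h' hne hn hX hY =>
        have hv := h2 h.2.1 h.2.2 h'.2.2 h.1.symm h'.1 hne hn hX hY
        ⟨v, rfl, ⟨hX.symm, h.2.1, hv⟩, hY, hv, h'.2.2⟩ }
  convert hR.isGated hG hW x₀ using 1
  ext v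
  constructor
  · exact fun hv => ⟨v, hconn _ hx₀ _ hv, rfl⟩
  · rintro ⟨X, hX, rfl⟩
    rcases hX.cases_tail with h | ⟨Y, _, h⟩
    · exact h ▸ hx₀
    · exact h.2.2

/-! ### Gate maps -/

/-- The map `g` sends every vertex to its gate in `A`. -/
structure IsGateMap (G : SimpleGraph V) (A : Set V) (g : V → V) : Prop where
  mem : ∀ u, g u ∈ A
  dist_add : ∀ u, ∀ y ∈ A, G.dist u (g u) + G.dist (g u) y = G.dist u y

theorem IsGated.exists_isGateMap {A : Set V} (h : G.IsGated A) : ∃ g, G.IsGateMap A g := by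
  have : ∀ x, ∃ x' ∈ A, ∀ y ∈ A, G.dist x x' + G.dist x' y = G.dist x y := by
    intro x
    by_cases hx : x ∈ A
    · exact ⟨x, hx, by simp⟩
    · exact h x hx
  choose g h1 h2 using this
  exact ⟨g, h1, h2⟩

namespace IsGateMap

variable {A : Set V} {g : V → V} (hg : G.IsGateMap A g) (hG : G.Connected)

include hg

include hG

theorem eq_of_dist_le {u x : V} (hx : x ∈ A) (h : G.dist u x ≤ G.dist u (g u)) : g u = x := by
  have := hg.dist_add u x hx
  exact hG.dist_eq_zero_iff.1 (by omega)

theorem eq_self {u : V} (hu : u ∈ A) : g u = u := hg.eq_of_dist_le hG hu (by simp)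

theorem eq_self_iff {u : V} : g u = u ↔ u ∈ A := ⟨fun h => h ▸ hg.mem u, hg.eq_self hG⟩

/-- An edge is either contracted by the gate map or sent to an edge, and in the second case its ends
have equal height above `A`. -/
theorem eq_or_adj {u v : V} (h : G.Adj u v) :
    g u = g v ∨ G.Adj (g u) (g v) ∧ G.dist u (g u) = G.dist v (g v) := by
  have h1 := hg.dist_add u _ (hg.mem v)
  have h2 := hg.dist_add v _ (hg.mem u)
  have h3 := hG.dist_triangle (u := u) (v := v) (w := g v)
  have h4 := hG.dist_triangle (u := v) (v := u) (w := g u)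
  rw [dist_comm (u := g v)] at h2
  rw [dist_eq_one_iff_adj.2 h] at h3
  rw [dist_eq_one_iff_adj.2 h.symm] at h4
  by_cases h0 : G.dist (g u) (g v) = 0
  · exact Or.inl (hG.dist_eq_zero_iff.1 h0)
  · exact Or.inr ⟨dist_eq_one_iff_adj.1 (by omega), by omega⟩

theorem eq_of_geodesic {u w : V} (h : G.dist u w + G.dist w (g u) = G.dist u (g u)) :
    g w = g u := by
  have h1 := hg.dist_add w _ (hg.mem u)
  have h2 := hg.dist_add u _ (hg.mem w)
  have h3 := hG.dist_triangle (u := u) (v := w) (w := g w)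
  rw [dist_comm (u := g w)] at h1
  exact (hG.dist_eq_zero_iff.1 (by omega)).symm

theorem mem_of_geodesic {x y w : V} (hx : x ∈ A) (hy : y ∈ A)
    (h : G.dist x w + G.dist w y = G.dist x y) : w ∈ A := by
  have h1 := hg.dist_add w x hx
  have h2 := hg.dist_add w y hy
  have h3 := hG.dist_triangle (u := x) (v := g w) (w := y)
  rw [dist_comm (u := g w), dist_comm (u := w) (v := x)] at h1
  exact (hg.eq_self_iff hG).1 (hG.dist_eq_zero_iff.1 (by omega)).symm

theorem mem_of_adj_of_adj {x y w : V} (hx : x ∈ A) (hy : y ∈ A) (hne : x ≠ y) (h1 : G.Adj w x)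
    (h2 : G.Adj w y) : w ∈ A := by
  by_contra hw
  have h3 := hg.dist_add w x hx
  have h4 := hg.dist_add w y hy
  rw [dist_eq_one_iff_adj.2 h1] at h3
  rw [dist_eq_one_iff_adj.2 h2] at h4
  have h5 : G.dist w (g w) ≠ 0 := fun h => hw ((hG.dist_eq_zero_iff.1 h) ▸ hg.mem w)
  have h6 : g w = x := hG.dist_eq_zero_iff.1 (by omega)
  have h7 : g w = y := hG.dist_eq_zero_iff.1 (by omega)
  exact hne (h6.symm.trans h7)

end IsGateMap

/-! ### The gated set spanned by a component of a link -/

/-- A state is a vertex with a set of vertices, related states carrying the link components that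
contain each other's vertex. Over a square whose components match at `w`, goodness of the square
makes them match at all corners. -/
theorem IsLocallyPreMedian.isLiftedRelation (hL : G.IsLocallyPreMedian) :
    IsLiftedRelation G (Prod.fst : V × Set V → V) (fun X Y => G.Adj X.1 Y.1 ∧
      X.2 = {z | G.LinkConn X.1 Y.1 z} ∧ Y.2 = {z | G.LinkConn Y.1 X.1 z}) := by
  have hset : ∀ {x y z : V}, G.LinkConn x y z →
      {t | G.LinkConn x y t} = {t | G.LinkConn x z t} := fun h =>
    Set.ext fun t => ⟨fun h' => h.symm.trans h', fun h' => h.trans h'⟩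
  have htri : ∀ ⦃X Y : V × Set V⦄ ⦃v : V⦄, (G.Adj X.1 Y.1 ∧
      X.2 = {z | G.LinkConn X.1 Y.1 z} ∧ Y.2 = {z | G.LinkConn Y.1 X.1 z}) → G.Adj v X.1 →
      G.Adj v Y.1 → X.2 = {z | G.LinkConn X.1 v z} := fun X Y v h h1 h2 =>
    h.2.1.trans (hset (linkConn_of_adj h.1 h1.symm h2.symm))
  refine ⟨fun X Y h => ⟨h.1.symm, h.2.2, h.2.1⟩, fun X Y h => h.1, ?_, ?_, ?_, ?_⟩
  · intro X Y v h h1 h2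
    exact ⟨(v, {z | G.LinkConn v X.1 z}), rfl, ⟨h1.symm, htri h h1 h2, rfl⟩, h2,
      hset (linkConn_of_adj h1 h2 h.1), htri ⟨h.1.symm, h.2.2, h.2.1⟩ h2 h1⟩
  · rintro ⟨x, X⟩ ⟨w, W⟩ ⟨y, Y⟩ h h' (rfl : x = y)
    exact Prod.ext rfl (h.2.1.trans h'.2.2.symm)
  · intro X W Y h h' ha
    exact ⟨ha, htri h ha.symm h'.1.symm, htri ⟨h'.1.symm, h'.2.2, h'.2.1⟩ ha h.1⟩
  · rintro ⟨x, X⟩ ⟨w, W⟩ ⟨y, Y⟩ v h h' hne hn h1 h2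
    have hw : G.LinkConn w x y := by
      change y ∈ {z | G.LinkConn w x z}
      rw [← show W = _ from h.2.2, show W = _ from h'.2.1]
      exact .refl
    have key : G.LinkConn x w v ∧ G.LinkConn y w v ∧ G.LinkConn v x y := by
      by_cases hv : w = v
      · subst hv
        exact ⟨.refl, .refl, hw⟩
      by_cases ha : G.Adj w v
      · exact ⟨linkConn_of_adj h.1 h1.symm ha, linkConn_of_adj h'.1.symm h2.symm ha,
          (linkConn_of_adj h1 ha.symm h.1).trans (linkConn_of_adj ha.symm h2 h'.1)⟩
      have hsq : G.IsSquare w x v y :=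
        ⟨h.1.symm, h1.symm, h2, h'.1.symm, hv, hne, ha, hn⟩
      have hgood := hL.isGoodSquare_of_linkConn hsq hw
      exact ⟨(hgood.rotate.linkConn hsq.rotate).symm,
        hgood.rotate.rotate.rotate.linkConn hsq.rotate.rotate.rotate,
        hgood.flip.rotate.rotate.linkConn hsq.flip.rotate.rotate⟩
    refine ⟨(v, {z | G.LinkConn v x z}), rfl, ⟨h1.symm, ?_, rfl⟩, h2, hset key.2.2, ?_⟩
    · exact h.2.1.trans (hset key.1)
    · exact h'.2.2.trans (hset key.2.1)

theorem IsPreMedian.exists_isGated_link (hG : G.Connected) (hP : G.IsPreMedian) (a b : V) :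
    ∃ H : Set V, G.IsGated H ∧ a ∈ H ∧
      (∀ z, G.Adj a z → (z ∈ H ↔ G.LinkConn a b z)) ∧
      ∀ x ∈ H, ∀ y ∈ H, ∀ z ∈ H, G.Adj x y → G.Adj x z → G.LinkConn x y z := by
  have hR := (hP.isLocallyPreMedian hG).isLiftedRelation
  set R : V × Set V → V × Set V → Prop := fun X Y => G.Adj X.1 Y.1 ∧
    X.2 = {z | G.LinkConn X.1 Y.1 z} ∧ Y.2 = {z | G.LinkConn Y.1 X.1 z} with hRdef
  set X₀ : V × Set V := (a, {z | G.LinkConn a b z})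
  have key : ∀ ⦃X Y⦄, Relation.ReflTransGen R X₀ X → Relation.ReflTransGen R X₀ Y →
      G.Adj X.1 Y.1 → Y.1 ∈ X.2 ∧ X.2 = {z | G.LinkConn X.1 Y.1 z} := by
    intro X Y hX hY ha
    have h := hR.of_reflTransGen hG hP.1 ((hR.reflTransGen_symm hX).trans hY) ha
    refine ⟨?_, h.2.1⟩
    rw [h.2.1]
    exact .refl
  refine ⟨_, hR.isGated hG hP.1 X₀, ⟨X₀, .refl, rfl⟩, fun z haz => ⟨?_, fun h => ?_⟩, ?_⟩
  · rintro ⟨Z, hZ, rfl⟩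
    exact (key .refl hZ haz).1
  · refine ⟨(z, {t | G.LinkConn z a t}), .single ⟨haz, ?_, rfl⟩, rfl⟩
    exact Set.ext fun t => ⟨fun h' => h.symm.trans h', fun h' => h.trans h'⟩
  · rintro _ ⟨X, hX, rfl⟩ _ ⟨Y, hY, rfl⟩ _ ⟨Z, hZ, rfl⟩ h1 h2
    have := (key hX hZ h2).1
    rwa [(key hX hY h1).2] at this

end SimpleGraph

namespace SimpleGraph

variable {V : Type*} {G : SimpleGraph V}

/-! ### Fibres of a gate map -/

namespace IsGateMap

variable {H : Set V} {g : V → V} (hg : G.IsGateMap H g) (hG : G.Connected)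

include hg

/-- The distance between a vertex and the gate of one of its neighbours in another fibre. -/
theorem dist_gate_adj {u v : V} (h : G.Adj (g u) (g v)) :
    G.dist (g v) u = G.dist (g u) u + 1 := by
  have h1 := hg.dist_add u _ (hg.mem v)
  rw [dist_eq_one_iff_adj.2 h] at h1
  rw [dist_comm, ← h1, dist_comm]

include hG

theorem dist_eq_of_adj {u v : V} (h : G.Adj u v) (hne : g u ≠ g v) :
    G.dist (g u) u = G.dist (g v) v := by
  rw [dist_comm, ((hg.eq_or_adj hG h).resolve_left hne).2, dist_comm]

theorem adj_of_adj {u v : V} (h : G.Adj u v) (hne : g u ≠ g v) : G.Adj (g u) (g v) :=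
  ((hg.eq_or_adj hG h).resolve_left hne).1

theorem eq_of_adj_dist {u p : V} (h : G.Adj p u) (hd : G.dist (g u) p + 1 = G.dist (g u) u) :
    g p = g u := by
  refine hg.eq_of_geodesic hG ?_
  rw [dist_eq_one_iff_adj.2 h.symm, dist_comm (u := p), dist_comm (u := u)]
  omega

theorem reflTransGen_fibre_of {P : V → Prop} {x : V}
    (hP : ∀ u p, g u = x → P u → G.Adj p u → G.dist x p + 1 = G.dist x u → P p) :
    ∀ u, g u = x → P u → Relation.ReflTransGen
      (fun a b => G.Adj a b ∧ (g a = x ∧ P a) ∧ (g b = x ∧ P b)) u x := by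
  have key : ∀ n u, G.dist x u = n → g u = x → P u → Relation.ReflTransGen
      (fun a b => G.Adj a b ∧ (g a = x ∧ P a) ∧ (g b = x ∧ P b)) u x := by
    intro n
    induction n with
    | zero =>
      intro u h _ _
      rw [hG.dist_eq_zero_iff.1 h]
    | succ n ih =>
      intro u h hu hPu
      have hne : x ≠ u := by
        rintro rfl
        simp at h
      obtain ⟨p, hp, hd⟩ := hG.exists_adj_dist_add_one hne
      have hgp : g p = x := (hg.eq_of_adj_dist hG hp (hu.symm ▸ hd)).trans hu
      have hPp := hP u p hu hPu hp hd
      exact .head ⟨hp.symm, ⟨hu, hPu⟩, hgp, hPp⟩ (ih p (by omega) hgp hPp)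
  exact fun u => key _ u rfl

variable (hW : G.IsWeaklyModular) (hL : G.IsLocallyPreMedian)

include hW hL

/-- If `w` lay in another fibre, take `x` below `u, v` in their fibre and `y` below `x, w` towards
`g w`. Then `v` sees three vertices of the square `y x u w`, so it sees `y`, which is too far. -/
theorem eq_of_triangle {u v w : V} (h : g u = g v) (huv : G.Adj u v) (hwu : G.Adj w u)
    (hwv : G.Adj w v) : g w = g u := by
  by_contra hne
  have hne' : g w ≠ g v := h ▸ hne
  have h1 := hg.dist_eq_of_adj hG hwu hne
  have h2 := hg.dist_eq_of_adj hG hwv hne'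
  have h3 := hg.dist_gate_adj (hg.adj_of_adj hG hwu hne).symm
  have h4 := hg.dist_gate_adj (hg.adj_of_adj hG hwv hne').symm
  obtain ⟨x, hx1, hx2, hx3⟩ := hW.triangle hG (u := g u) huv (by rw [h] at h1 ⊢; omega)
  have hx4 := hg.eq_of_adj_dist hG hx1 hx3
  have h5 : ¬ G.Adj w x := fun h => by
    have := hg.dist_eq_of_adj hG h (hx4 ▸ hne)
    rw [hx4] at this
    omega
  have h6 : G.dist (g w) x = G.dist (g u) x + 1 := by
    rw [hg.dist_gate_adj (hx4 ▸ (hg.adj_of_adj hG hwu hne).symm), hx4]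
  obtain ⟨y, hy1, hy2, hy3⟩ := hW.quadrangle hG (u := g w) (z := u) hx1 hwu
    (by rintro rfl; exact hne hx4) (fun h => h5 h.symm) (by omega) (by omega)
  have nu : ¬ G.Adj u y := fun h => by
    have := h.dist_le_dist_add_one hG (g w)
    omega
  have nv : ¬ G.Adj v y := fun h => by
    have := h.dist_le_dist_add_one hG (g w)
    omega
  have hsq : G.IsSquare y x u w := ⟨hy1, hx1, hwu.symm, hy2.symm, by rintro rfl; omega,
    by rintro rfl; exact hne hx4, fun h => nu h.symm, fun h => h5 h.symm⟩
  exact nv (hL.spoke hsq hx2.symm huv.symm hwv.symm (by rintro rfl; omega))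

/-- A vertex with two neighbours `u, v` in a fibre that have a common neighbour `m` in this fibre,
in the case where `m` is closer to `H`. -/
theorem eq_of_square_of_lt {u v m w : V} (huv : g u = g v) (hum : g u = g m) (hne : u ≠ v)
    (hn : ¬ G.Adj u v) (mu : G.Adj m u) (mv : G.Adj m v) (wu : G.Adj w u) (wv : G.Adj w v)
    (hd : G.dist (g u) m + 1 = G.dist (g u) u) : g w = g u := by
  by_contra hw
  have h1 := hg.dist_eq_of_adj hG wu hw
  have h2 := hg.dist_eq_of_adj hG wv (huv ▸ hw)
  have ha := hg.adj_of_adj hG wu hw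
  have h3 := hg.dist_gate_adj ha.symm
  have h4 := hg.dist_gate_adj (v := w) (u := v) (huv ▸ ha.symm)
  have h5 := hg.dist_gate_adj (v := w) (u := m) (hum ▸ ha.symm)
  rw [← hum] at h5
  have hwm : ¬ G.Adj w m := fun h => by
    have := hg.dist_eq_of_adj hG h (hum ▸ hw)
    rw [← hum] at this
    omega
  have hwm' : w ≠ m := by
    rintro rfl
    exact hw hum.symm
  -- From `g w`, both `w` and `m` are one closer than `u` and `v`. With the common neighbour `z`
  -- below, `{w, m}` and `{u, v, z}` span a `K_{2,3}`.
  obtain ⟨z, hz1, hz2, hz3⟩ := hW.quadrangle hG (u := g w) wu mu hwm' hwm (by omega) (by omega)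
  rw [← huv] at h2 h4
  exact hL.not_bipartite hwm' hwm hne hn (z := z) (by rintro rfl; omega)
    (fun h => by have := h.dist_le_dist_add_one hG (g w); omega) (by rintro rfl; omega)
    (fun h => by have := h.dist_le_dist_add_one hG (g w); omega) wu wv hz1.symm mu mv hz2.symm

theorem eq_of_square {u v m w : V} (huv : g u = g v) (hum : g u = g m) (hne : u ≠ v)
    (hn : ¬ G.Adj u v) (mu : G.Adj m u) (mv : G.Adj m v) (wu : G.Adj w u) (wv : G.Adj w v) :
    g w = g u := by
  by_contra hw
  have h1 := hg.dist_eq_of_adj hG wu hw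
  have h2 := hg.dist_eq_of_adj hG wv (huv ▸ hw)
  rw [← huv] at h2
  have hm1 := mu.dist_le_dist_add_one hG (g u)
  have hm2 := mu.symm.dist_le_dist_add_one hG (g u)
  rcases lt_trichotomy (G.dist (g u) m) (G.dist (g u) u) with h | h | h
  · exact hw (hg.eq_of_square_of_lt hG hW hL huv hum hne hn mu mv wu wv (by omega))
  · have hwm : ¬ G.Adj w m := fun h =>
      hw (hg.eq_of_triangle hG hW hL hum mu.symm wu h)
    have hwm' : w ≠ m := by
      rintro rfl
      exact hw hum.symm
    have ha := hg.adj_of_adj hG wu hw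
    have h3 := hg.dist_gate_adj ha.symm
    obtain ⟨e, he1, he2, he3⟩ := hW.triangle hG (u := g u) mu.symm h.symm
    have he4 := hg.eq_of_adj_dist hG he1 he3
    have h5 := hg.dist_gate_adj (v := w) (u := e) (he4 ▸ ha.symm)
    rw [he4] at h5
    have hwe : ¬ G.Adj w e := fun h => by
      have := hg.dist_eq_of_adj hG h (he4 ▸ hw)
      rw [he4] at this
      omega
    obtain ⟨f, hf1, hf2, hf3⟩ := hW.quadrangle hG (u := g w) he1 wu
      (by rintro rfl; exact hw he4) (fun h => hwe h.symm) (by omega) (by omega)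
    have hf4 := hg.eq_of_adj_dist hG hf2 (by omega)
    have hfx : ∀ t, g t = g u → G.dist (g u) t = G.dist (g u) u → ¬ G.Adj t f := by
      intro t ht hdt h
      have := hg.dist_eq_of_adj hG h (by rw [ht, hf4]; exact Ne.symm hw)
      rw [ht, hf4] at this
      omega
    have hmf := hfx m hum.symm h
    -- `m` is level with `u`; `e` lies below both and `f` below `w`. The local triangle condition
    -- from `m` to the edge `wf` gives `n` in the fibre of `w`, and `{m, w}`, `{u, v, n}` span a
    -- `K_{2,3}`.
    obtain ⟨n, hn1, hn2, hn3⟩ := hL.triangle hf2.symm mu.symm wu.symm hwm'.symm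
      (fun h => hwm h.symm) he2 hf1.symm (by rintro rfl; exact hw (hf4.symm.trans hum.symm)) hmf
    have hnx : ∀ t, g t = g u → G.Adj m t → n ≠ t → ¬ G.Adj t n := by
      intro t ht hmt hnt h
      have h6 := hg.eq_of_triangle hG hW hL (hum.symm.trans ht.symm) hmt hn1 h.symm
      have h7 := hg.eq_of_triangle hG hW hL hf4.symm hf2.symm hn2 hn3
      exact hw (h7.symm.trans (h6.trans hum.symm))
    have hnu : n ≠ u := by
      rintro rfl
      exact hfx n rfl rfl hn3
    have hnv : n ≠ v := by
      rintro rfl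
      exact hfx n huv.symm (by omega) hn3
    exact hL.not_bipartite hwm'.symm (fun h => hwm h.symm) hne hn hnu.symm
      (hnx u rfl mu hnu) hnv.symm (hnx v huv.symm mv hnv) mu mv hn1.symm wu wv hn2.symm
  -- If `m` is higher, replace it by a common neighbour `p` below `u` and `v`.
  · obtain ⟨p, hp1, hp2, hp3⟩ := hW.quadrangle hG (u := g u) mu.symm mv.symm hne hn (by omega)
      (by omega)
    have hp4 := hg.eq_of_adj_dist hG hp1 hp3
    exact hw (hg.eq_of_square_of_lt hG hW hL huv hp4.symm hne hn hp1 hp2 wu wv hp3)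

theorem isGated_fibre {x : V} (hx : x ∈ H) : G.IsGated {u | g u = x} := by
  refine hW.isGated hG ⟨x, hg.eq_self hG hx⟩ ?_ ?_ ?_
  · have key := hg.reflTransGen_fibre_of hG (P := fun _ => True) (x := x) (by simp)
    simp only [and_true] at key
    intro u hu v hv
    refine (key u hu trivial).trans ?_
    have := (key v hv trivial).swap
    refine Relation.ReflTransGen.mono (fun a b h => ?_) _ _ this
    exact ⟨h.1.symm, h.2.2, h.2.1⟩
  · intro u v w hu hv huv hwu hwv
    exact (hg.eq_of_triangle hG hW hL (hu.trans hv.symm) huv hwu hwv).trans hu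
  · intro u m v w hu hm hv mu mv hne hn wu wv
    exact (hg.eq_of_square hG hW hL (hu.trans hv.symm) (hu.trans hm.symm) hne hn mu mv wu wv).trans
      hu

theorem eq_of_adj_of_adj {u v w : V} (h : g u = g v) (hne : u ≠ v) (wu : G.Adj w u)
    (wv : G.Adj w v) : g w = g u := by
  obtain ⟨k, hk⟩ := (hg.isGated_fibre hG hW hL (hg.mem u)).exists_isGateMap
  exact hk.mem_of_adj_of_adj hG (A := {t | g t = g u}) rfl h.symm hne wu wv

end IsGateMap

end SimpleGraph

/-! ### Boundaries of fibres and gated amalgams. -/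

namespace SimpleGraph

variable {V : Type*} {G : SimpleGraph V}

/-- A set containing a gated set through which every edge entering it from outside enters is
gated. -/
theorem IsGated.of_boundary (hG : G.Connected) {S B : Set V} (hS : G.IsGated S) (hSB : S ⊆ B)
    (h : ∀ p ∉ B, ∀ q ∈ B, G.Adj p q → q ∈ S) : G.IsGated B := by
  obtain ⟨g, hg⟩ := hS.exists_isGateMap
  -- Every geodesic from outside `B` to a point of `B` meets `S` where it enters `B`.
  have key : ∀ n x y, G.dist y x = n → x ∉ B → y ∈ B →
      ∃ q ∈ S, G.dist x q + G.dist q y = G.dist x y := by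
    intro n
    induction n with
    | zero =>
      intro x y hd hx hy
      exact absurd (hG.dist_eq_zero_iff.1 hd ▸ hy) hx
    | succ n ih =>
      intro x y hd hx hy
      obtain ⟨p, hp, hpd⟩ := hG.exists_adj_dist_add_one (u := y) (v := x)
        (by rintro rfl; exact hx hy)
      by_cases hpB : p ∈ B
      · refine ⟨p, h x hx p hpB hp.symm, ?_⟩
        rw [dist_eq_one_iff_adj.2 hp.symm, dist_comm, dist_comm (u := x)]
        omega
      · obtain ⟨q, hq, hqd⟩ := ih p y (by omega) hpB hy
        refine ⟨q, hq, le_antisymm ?_ hG.dist_triangle⟩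
        have := hG.dist_triangle (u := x) (v := p) (w := q)
        rw [dist_eq_one_iff_adj.2 hp.symm] at this
        rw [dist_comm (u := y), dist_comm (u := y)] at hpd
        omega
  intro x hx
  refine ⟨g x, hSB (hg.mem x), fun y hy => le_antisymm ?_ hG.dist_triangle⟩
  obtain ⟨q, hq, hqd⟩ := key _ x y rfl hx hy
  have h1 := hg.dist_add x q hq
  have h2 := hG.dist_triangle (u := g x) (v := q) (w := y)
  omega

namespace IsGateMap

variable {H : Set V} {g : V → V} (hg : G.IsGateMap H g) (hG : G.Connected)

include hg hG

theorem dist_le (u v : V) : G.dist (g u) (g v) ≤ G.dist u v := by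
  have h1 := hg.dist_add u _ (hg.mem v)
  have h2 := hg.dist_add v _ (hg.mem u)
  have h3 := hG.dist_triangle (u := u) (v := v) (w := g v)
  have h4 := hG.dist_triangle (u := v) (v := u) (w := g u)
  rw [dist_comm (u := g v)] at h2
  rw [dist_comm (u := v) (v := u)] at h4
  omega

theorem eq_of_adj {u m : V} (hu : u ∉ H) (hm : m ∈ H) (h : G.Adj u m) : g u = m := by
  refine hg.eq_of_dist_le hG hm ?_
  rw [dist_eq_one_iff_adj.2 h, Nat.one_le_iff_ne_zero]
  exact fun h => hu (hG.dist_eq_zero_iff.1 h ▸ hg.mem u)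

theorem exists_adj_toward {x y : V} (hx : x ∈ H) (hy : y ∈ H) (hne : x ≠ y) :
    ∃ z ∈ H, G.Adj z y ∧ G.dist x z + 1 = G.dist x y := by
  obtain ⟨z, hz, hd⟩ := hG.exists_adj_dist_add_one hne
  refine ⟨z, hg.mem_of_geodesic hG hx hy ?_, hz, hd⟩
  rwa [dist_eq_one_iff_adj.2 hz]

variable (hW : G.IsWeaklyModular) (hL : G.IsLocallyPreMedian)

include hW hL

theorem exists_common_mate {u m z : V} (hum : G.Adj u m) (hne : g u ≠ g m) (hz : z ∈ H)
    (hzu : G.Adj z (g u)) (hzm : G.Adj z (g m)) : ∃ n, G.Adj n u ∧ G.Adj n m ∧ g n = z := by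
  have hgz := hg.eq_self hG hz
  have h1 := hg.dist_eq_of_adj hG hum hne
  have h2 := hg.dist_gate_adj (u := u) (v := z) (by rw [hgz]; exact hzu.symm)
  have h3 := hg.dist_gate_adj (u := m) (v := z) (by rw [hgz]; exact hzm.symm)
  rw [hgz] at h2 h3
  obtain ⟨n, hn1, hn2, hn3⟩ := hW.triangle hG (u := z) hum (by omega)
  refine ⟨n, hn1, hn2, ?_⟩
  have h4 : g n ≠ g u := fun h =>
    hne (hg.eq_of_triangle hG hW hL h hn1 hn2.symm hum.symm |>.trans h).symm
  have h5 := hg.dist_eq_of_adj hG hn1 h4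
  have h6 := hg.dist_add n z hz
  rw [dist_comm, dist_comm (u := n)] at h6
  exact (hG.dist_eq_zero_iff.1 (by rw [dist_comm] at h6; rw [dist_comm (u := n)] at h6; omega))

/-- One neighbour of `u` in another fibre yields a neighbour over each vertex of the corresponding
link component, one triangle at a time. -/
theorem exists_mate {u m y : V} (hum : G.Adj m u)
    (h : G.LinkConn (g u) (g m) y) : ∃ n, G.Adj n u ∧ g n = y := by
  induction h with
  | refl => exact ⟨m, hum, rfl⟩
  | @tail b c _ hbc ih =>
    obtain ⟨n, hn, rfl⟩ := ih
    have hc : c ∈ H := hg.mem_of_adj_of_adj hG (hg.mem u) (hg.mem n) hbc.1.ne hbc.2.1.symm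
      hbc.2.2.symm
    obtain ⟨t, ht, _, ht'⟩ := hg.exists_common_mate hG hW hL hn.symm hbc.1.ne hc hbc.2.1.symm
      hbc.2.2.symm
    exact ⟨t, ht, ht'⟩

/-- Let `k` be the gate map of the fibre over `y`. If a neighbour `p` of a boundary vertex `u` has
`k p ≠ k u`, then `p` has height one above that fibre. Failure of this is excluded by distances or
by closedness of the fibre over `x`. -/
theorem isGated_boundary {x y : V} (hx : x ∈ H) (hy : y ∈ H) (hxy : G.Adj x y) :
    G.IsGated {u | g u = x ∧ ∃ m, G.Adj m u ∧ g m = y} := by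
  obtain ⟨k, hk⟩ := (hg.isGated_fibre hG hW hL hy).exists_isGateMap
  have hmem : ∀ {u}, g u = x → u ∉ {u | g u = y} := fun hu h => hxy.ne (hu.symm.trans h)
  have hadj : ∀ {u m}, g u = x → G.Adj m u → g m = y → k u = m := fun hu hm hmy =>
    hk.eq_of_adj hG (hmem hu) hmy hm.symm
  have hnext : ∀ {u p}, g u = x → (∃ m, G.Adj m u ∧ g m = y) → G.Adj p u → k p ≠ k u →
      ∃ m, G.Adj m p ∧ g m = y := by
    rintro u p hu ⟨m, hm, hmy⟩ hpu hne
    have h1 := hk.dist_eq_of_adj hG hpu hne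
    rw [hadj hu hm hmy, dist_eq_one_iff_adj.2 hm] at h1
    exact ⟨k p, dist_eq_one_iff_adj.1 h1, hk.mem p⟩
  have hconn := hg.reflTransGen_fibre_of hG (P := fun u => ∃ m, G.Adj m u ∧ g m = y) (x := x) <| by
    rintro u p hu ⟨m, hm, hmy⟩ hpu hd
    have hp : g p = x := (hg.eq_of_adj_dist hG hpu (hu.symm ▸ hd)).trans hu
    refine hnext hu ⟨m, hm, hmy⟩ hpu fun he => ?_
    have h1 := hk.dist_add p y (hg.eq_self hG hy)
    rw [he, hadj hu hm hmy] at h1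
    have h2 := hg.dist_eq_of_adj hG hm (by rw [hu, hmy]; exact hxy.ne')
    rw [hu, hmy] at h2
    have h3 := hg.dist_gate_adj (u := p) (v := y) (by rwa [hp, hg.eq_self hG hy])
    rw [hp, hg.eq_self hG hy] at h3
    rw [dist_comm (v := y), dist_comm (v := y)] at h1
    have h4 : p = m := hG.dist_eq_zero_iff.1 (by omega)
    exact hxy.ne (hp.symm.trans (h4 ▸ hmy))
  have hclosed : ∀ {u v p}, (g u = x ∧ ∃ m, G.Adj m u ∧ g m = y) →
      (g v = x ∧ ∃ m, G.Adj m v ∧ g m = y) → u ≠ v → G.Adj p u → G.Adj p v →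
      (g p = x ∧ ∃ m, G.Adj m p ∧ g m = y) := by
    intro u v p ⟨hu, hu'⟩ ⟨hv, hv'⟩ hne hpu hpv
    refine ⟨(hg.eq_of_adj_of_adj hG hW hL (hu.trans hv.symm) hne hpu hpv).trans hu, ?_⟩
    by_cases h1 : k p = k u
    · by_cases h2 : k p = k v
      · exfalso
        obtain ⟨m, hm, hmy⟩ := hu'
        obtain ⟨n, hn, hny⟩ := hv'
        have h3 : m = n := by rw [← hadj hu hm hmy, ← hadj hv hn hny, ← h1, h2]
        subst h3
        have := hg.eq_of_adj_of_adj hG hW hL (hu.trans hv.symm) hne hm hn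
        exact hxy.ne (by rw [← hu, ← this, hmy])
      · exact hnext hv hv' hpv h2
    · exact hnext hu hu' hpu h1
  refine hW.isGated hG ⟨x, hg.eq_self hG hx, y, hxy.symm, hg.eq_self hG hy⟩ ?_ ?_ ?_
  · intro u hu v hv
    refine (hconn u hu.1 hu.2).trans ?_
    refine Relation.ReflTransGen.mono (fun a b h => ?_) _ _ (hconn v hv.1 hv.2).swap
    exact ⟨h.1.symm, h.2.2, h.2.1⟩
  · exact fun u v p hu hv huv hpu hpv => hclosed hu hv huv.ne hpu hpv
  · exact fun u m v p hu _ hv _ _ hne _ hpu hpv => hclosed hu hv hne hpu hpv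

/-- If some vertex has no neighbour in another fibre, then the graph is a gated amalgam of its
fibre and the complement of the interior of the fibre. -/
theorem isProperGatedAmalgam {u : V} (hu : ∀ m, G.Adj m u → g m = g u) {y : V} (hy : y ∈ H)
    (hxy : G.Adj (g u) y) (hlink : ∀ z ∈ H, G.Adj (g u) z → G.LinkConn (g u) z y) :
    G.IsProperGatedAmalgam := by
  have hS := hg.isGated_boundary hG hW hL (hg.mem u) hy hxy
  set x := g u with hxdef
  have hgx : g x = x := hg.eq_self hG (hg.mem u)
  have hgy : g y = y := hg.eq_self hG hy
  set S := {v | g v = x ∧ ∃ m, G.Adj m v ∧ g m = y} with hSdef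
  have hmate : ∀ {v m}, g v = x → G.Adj m v → g m ≠ x → v ∈ S := by
    intro v m hv hm hne
    have ha := hg.adj_of_adj hG hm (hv ▸ hne)
    refine ⟨hv, hg.exists_mate hG hW hL hm ?_⟩
    rw [hv]
    exact hlink _ (hg.mem m) (hv ▸ ha.symm)
  -- The second set consists of the other fibres and the boundary `S`; `u` is missing from it, since
  -- all its neighbours are in its own fibre.
  refine ⟨{v | g v = x}, {v | g v = x → v ∈ S}, hg.isGated_fibre hG hW hL (hg.mem u),
    hS.of_boundary hG (fun v hv _ => hv) ?_, ⟨x, hgx, fun _ => ⟨hgx, y, hxy.symm, hgy⟩⟩,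
    fun h => ?_, fun h => ?_, ?_, fun v w hvw => ?_⟩
  · intro p hp q hq hpq
    simp only [Set.mem_ofPred_eq, Classical.not_imp] at hp hq
    refine hq (by_contra fun hne => hp.2 (hmate hp.1 hpq.symm hne))
  · have : y ∈ {v | g v = x} := h ▸ Set.mem_univ y
    exact hxy.ne (this.symm.trans hgy)
  · have : u ∈ {v | g v = x → v ∈ S} := h ▸ Set.mem_univ u
    obtain ⟨_, m, hm, hmy⟩ := this rfl
    exact hxy.ne ((hu m hm).symm.trans hmy)
  · refine Set.eq_univ_of_forall fun v => ?_
    by_cases h : g v = x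
    · exact Or.inl h
    · exact Or.inr fun h' => absurd h' h
  · by_cases hv : g v = x <;> by_cases hw : g w = x
    · exact Or.inl ⟨hv, hw⟩
    · exact Or.inr ⟨fun _ => hmate hv hvw.symm hw, fun h => absurd h hw⟩
    · exact Or.inr ⟨fun h => absurd h hv, fun _ => hmate hw hvw hv⟩
    · exact Or.inr ⟨fun h => absurd h hv, fun h => absurd h hw⟩

/-! ### Coordinates in `H` and in a fibre, and the Cartesian product. -/

section Product

variable {x₀ : V} (hx₀ : x₀ ∈ H) {k : V → V} (hk : G.IsGateMap {u | g u = x₀} k)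
  (hmate : ∀ u, ∀ y ∈ H, G.Adj y (g u) → ∃ m, G.Adj m u ∧ g m = y)

include hx₀ hk hmate

-- Lifting a geodesic of `H` from `g u` to `x₀` step by step bounds the distance above; the gate map
-- not increasing distances bounds it below.
omit hW hL in
theorem dist_fibre : ∀ u, G.dist u (k u) = G.dist x₀ (g u) := by
  have key : ∀ n u, G.dist x₀ (g u) = n → G.dist u (k u) ≤ n := by
    intro n
    induction n with
    | zero =>
      intro u hu
      rw [hk.eq_self hG (hG.dist_eq_zero_iff.1 hu).symm]
      simp
    | succ n ih =>
      intro u hu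
      obtain ⟨y, hy, hyu, hd⟩ := hg.exists_adj_toward hG hx₀ (hg.mem u)
        (by rintro h; simp [← h] at hu)
      obtain ⟨m, hm, rfl⟩ := hmate u y hy hyu
      have h1 := ih m (by omega)
      have h2 := hk.dist_add u _ (hk.mem m)
      have h3 := hG.dist_triangle (u := u) (v := m) (w := k m)
      rw [dist_eq_one_iff_adj.2 hm.symm] at h3
      omega
  intro u
  refine le_antisymm (key _ u rfl) ?_
  have := hg.dist_le hG u (k u)
  rwa [show g (k u) = x₀ from hk.mem u, dist_comm] at this

/-- An edge with ends at different heights above the fibre over `x₀` is contracted by `k`. For equal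
heights, a common neighbour over a vertex closer to `x₀` links the ends by two such edges. -/
theorem fibre_gate_eq {u m : V} (h : G.Adj u m) (hne : g u ≠ g m) : k u = k m := by
  have hd := hg.dist_fibre hG hx₀ hk hmate
  have hlt : ∀ {u v}, G.Adj u v → G.dist x₀ (g u) ≠ G.dist x₀ (g v) → k u = k v := by
    intro u v huv hne
    refine (hk.eq_or_adj hG huv).resolve_right fun h' => hne ?_
    rw [← hd, ← hd, h'.2]
  by_cases he : G.dist x₀ (g u) = G.dist x₀ (g m)
  · have ha := hg.adj_of_adj hG h hne
    obtain ⟨z, hz1, hz2, hz3⟩ := hW.triangle hG ha he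
    have hz : z ∈ H := hg.mem_of_adj_of_adj hG (hg.mem u) (hg.mem m) hne hz1 hz2
    obtain ⟨n, hn1, hn2, rfl⟩ := hg.exists_common_mate hG hW hL h hne hz hz1 hz2
    exact (hlt hn1 (by omega)).symm.trans (hlt hn2 (by omega))
  · exact hlt h he

/-- Moving two vertices of a fibre to a fibre closer to `x₀`. -/
theorem fibre_induction {P : V → V → Prop} (h0 : ∀ u v, g u = x₀ → g v = x₀ → P u v)
    (hs : ∀ u v u' v', G.Adj u' u → G.Adj v' v → g u = g v → g u' = g v' → g u' ≠ g u →
      k u' = k u → k v' = k v → P u' v' → P u v) : ∀ u v, g u = g v → P u v := by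
  have key : ∀ n u v, G.dist x₀ (g u) = n → g u = g v → P u v := by
    intro n
    induction n with
    | zero =>
      intro u v hu huv
      have := (hG.dist_eq_zero_iff.1 hu).symm
      exact h0 u v this (huv ▸ this)
    | succ n ih =>
      intro u v hu huv
      obtain ⟨y, hy, hyu, hd⟩ := hg.exists_adj_toward hG hx₀ (hg.mem u)
        (by rintro h; simp [← h] at hu)
      obtain ⟨m, hm, rfl⟩ := hmate u y hy hyu
      obtain ⟨m', hm', he⟩ := hmate v _ hy (huv ▸ hyu)
      refine hs u v m m' hm hm' huv he.symm hyu.ne ?_ ?_ (ih m m' (by omega) he.symm)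
      · exact hg.fibre_gate_eq hG hW hL hx₀ hk hmate hm hyu.ne
      · exact hg.fibre_gate_eq hG hW hL hx₀ hk hmate hm' (by rw [he, ← huv]; exact hyu.ne)
  exact fun u v => key _ u v rfl

theorem fibre_gate_injective : ∀ u v, g u = g v → k u = k v → u = v := by
  refine hg.fibre_induction hG hW hL hx₀ hk hmate ?_ ?_
  · intro u v hu hv h
    rwa [hk.eq_self hG hu, hk.eq_self hG hv] at h
  · intro u v u' v' hu hv huv huv' hne h1 h2 ih h
    obtain rfl := ih (by rw [h1, h2, h])
    by_contra hn
    exact hne (hg.eq_of_adj_of_adj hG hW hL huv hn hu hv)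

theorem adj_of_fibre_gate_adj : ∀ u v, g u = g v → G.Adj (k u) (k v) → G.Adj u v := by
  refine hg.fibre_induction hG hW hL hx₀ hk hmate ?_ ?_
  · intro u v hu hv h
    rwa [hk.eq_self hG hu, hk.eq_self hG hv] at h
  · intro u v u' v' hu hv huv huv' hne h1 h2 ih h
    have ha := ih (by rwa [h1, h2])
    obtain ⟨j, hj⟩ := (hg.isGated_fibre hG hW hL (hg.mem u)).exists_isGateMap
    have hj1 : j u' = u := hj.eq_of_adj hG (H := {t | g t = g u}) hne rfl hu
    have hj2 : j v' = v := hj.eq_of_adj hG (H := {t | g t = g u})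
      (by rw [Set.mem_ofPred_eq, ← huv']; exact hne) huv.symm hv
    rcases hj.eq_or_adj hG ha with h' | h'
    · rw [hj1, hj2] at h'
      exact absurd (h' ▸ h) G.irrefl
    · rw [hj1, hj2] at h'
      exact h'.1

theorem exists_fibre_gate_eq {a b : V} (ha : a ∈ H) (hb : g b = x₀) : ∃ u, g u = a ∧ k u = b := by
  have key : ∀ n a, G.dist x₀ a = n → a ∈ H → ∃ u, g u = a ∧ k u = b := by
    intro n
    induction n with
    | zero =>
      intro a h _
      exact ⟨b, hb.trans (hG.dist_eq_zero_iff.1 h), hk.eq_self hG hb⟩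
    | succ n ih =>
      intro a h ha
      obtain ⟨y, hy, hya, hd⟩ := hg.exists_adj_toward hG hx₀ ha (by rintro rfl; simp at h)
      obtain ⟨u, rfl, rfl⟩ := ih y (by omega) hy
      obtain ⟨m, hm, rfl⟩ := hmate u a ha hya.symm
      exact ⟨m, rfl, hg.fibre_gate_eq hG hW hL hx₀ hk hmate hm hya.ne'⟩
  exact key _ a rfl ha

end Product

end IsGateMap

theorem IsGated.isProperCartesianProduct.{u} {V : Type u} {G : SimpleGraph V} (hG : G.Connected)
    (hW : G.IsWeaklyModular) (hL : G.IsLocallyPreMedian) {H : Set V} {g : V → V}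
    (hg : G.IsGateMap H g) (hne : H ≠ Set.univ) (hnt : H.Nontrivial)
    (hmate : ∀ u, ∀ y ∈ H, G.Adj y (g u) → ∃ m, G.Adj m u ∧ g m = y) :
    G.IsProperCartesianProduct := by
  obtain ⟨w, hw⟩ := (Set.ne_univ_iff_exists_notMem H).1 hne
  have hx₀ : g w ∈ H := hg.mem w
  obtain ⟨k, hk⟩ := (hg.isGated_fibre hG hW hL hx₀).exists_isGateMap
  set x₀ := g w
  have hgx : g x₀ = x₀ := hg.eq_self hG hx₀
  let f : V → H × {u | g u = x₀} := fun u => (⟨g u, hg.mem u⟩, ⟨k u, hk.mem u⟩)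
  have hf : Function.Bijective f := by
    refine ⟨fun u v h => ?_, fun ⟨⟨a, ha⟩, ⟨b, hb⟩⟩ => ?_⟩
    · simp only [f, Prod.mk.injEq, Subtype.mk.injEq] at h
      exact hg.fibre_gate_injective hG hW hL hx₀ hk hmate u v h.1 h.2
    · obtain ⟨u, rfl, rfl⟩ := hg.exists_fibre_gate_eq hG hW hL hx₀ hk hmate ha hb
      exact ⟨u, rfl⟩
  refine ⟨H, {u | g u = x₀}, G.induce H, G.induce {u | g u = x₀}, hnt.coe_sort,
    Set.Nontrivial.coe_sort ⟨x₀, hgx, w, rfl, fun h => hw (h ▸ hx₀)⟩,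
    ⟨⟨Equiv.ofBijective f hf, ?_⟩⟩⟩
  intro u v
  simp only [Equiv.ofBijective_apply, boxProd_adj, f, comap_adj, Function.Embedding.subtype_apply,
    Subtype.mk.injEq]
  constructor
  · rintro (⟨h1, h2⟩ | ⟨h1, h2⟩)
    · obtain ⟨m, hm, hm'⟩ := hmate v _ (hg.mem u) h1
      have h3 := hg.fibre_gate_eq hG hW hL hx₀ hk hmate hm (by rw [hm']; exact h1.ne)
      rwa [hg.fibre_gate_injective hG hW hL hx₀ hk hmate u m hm'.symm (by rw [h3, h2])]
    · exact hg.adj_of_fibre_gate_adj hG hW hL hx₀ hk hmate u v h2 h1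
  · intro h
    by_cases he : g u = g v
    · refine Or.inr ⟨((hk.eq_or_adj hG h).resolve_left fun h' => ?_).1, he⟩
      exact h.ne (hg.fibre_gate_injective hG hW hL hx₀ hk hmate u v he h')
    · exact Or.inl ⟨hg.adj_of_adj hG h he, hg.fibre_gate_eq hG hW hL hx₀ hk hmate h he⟩

/-! ### Prime pre-median graphs -/

/-- Otherwise the gated set spanned by the component of `b` misses `d`. A vertex confined to its
fibre gives a gated amalgam, and if there is none all mates exist and give a product. -/
theorem IsPrime.linkConn (hG : G.Connected) (hP : G.IsPreMedian) (h : G.IsPrime) {a b d : V}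
    (hb : G.Adj a b) (hd : G.Adj a d) : G.LinkConn a b d := by
  obtain ⟨H, hH, ha, hab, hlink⟩ := hP.exists_isGated_link hG a b
  rw [← hab d hd]
  have hbH : b ∈ H := (hab b hb).2 .refl
  by_contra hdH
  have hL := hP.isLocallyPreMedian hG
  obtain ⟨g, hg⟩ := hH.exists_isGateMap
  have hnt : H.Nontrivial := ⟨a, ha, b, hbH, hb.ne⟩
  have hnb : ∀ x ∈ H, ∃ y ∈ H, G.Adj x y := by
    intro x hx
    obtain ⟨y, hy, hne⟩ := hnt.exists_ne x
    obtain ⟨z, hz, hzx, _⟩ := hg.exists_adj_toward hG hy hx hne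
    exact ⟨z, hz, hzx.symm⟩
  by_cases hu : ∃ u, ∀ m, G.Adj m u → g m = g u
  · obtain ⟨u, hu⟩ := hu
    obtain ⟨y, hy, hxy⟩ := hnb _ (hg.mem u)
    exact h.2.2 (hg.isProperGatedAmalgam hG hP.1 hL hu hy hxy fun z hz hz' =>
      hlink _ (hg.mem u) z hz y hy hz' hxy)
  · push Not at hu
    refine h.2.1 (IsGated.isProperCartesianProduct hG hP.1 hL hg
      (fun h => hdH (h ▸ Set.mem_univ d)) hnt fun u y hy hyu => ?_)
    obtain ⟨m, hm, hne⟩ := hu u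
    exact hg.exists_mate hG hP.1 hL hm (hlink _ (hg.mem u) _ (hg.mem m) _ hy
      (hg.adj_of_adj hG hm hne).symm hyu.symm)

theorem IsPrime.isGoodSquare (hG : G.Connected) (hP : G.IsPreMedian) (h : G.IsPrime)
    {a b c d : V} (hsq : G.IsSquare a b c d) : G.IsGoodSquare a b c d :=
  (hP.isLocallyPreMedian hG).isGoodSquare_of_linkConn hsq (h.linkConn hG hP hsq.ab hsq.da.symm)

theorem IsPrime.isTwoConnected (hG : G.Connected) (h : G.IsPrime) : G.IsTwoConnected := by
  refine ⟨h.1, hG, fun c => ?_⟩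
  have hne : Nonempty ({c}ᶜ : Set V) := by
    have := h.1
    obtain ⟨b, hb⟩ := exists_ne c
    exact ⟨b, hb⟩
  refine ⟨?_⟩
  by_contra hpre
  simp only [Preconnected, not_forall] at hpre
  obtain ⟨a, b, hab⟩ := hpre
  -- With `c` a cut vertex and `D` a component of its complement, `D ∪ {c}` and the complement of
  -- `D` are entered only through `c`, hence form a gated amalgam.
  let D : Set V := {v | ∃ hv : v ∈ ({c}ᶜ : Set V), (G.induce {c}ᶜ).Reachable a ⟨v, hv⟩}
  have hcD : c ∉ D := fun ⟨hv, _⟩ => hv rfl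
  have hD : ∀ {p q}, G.Adj p q → q ∈ D → p ≠ c → p ∈ D := fun {p q} hpq ⟨hq, hr⟩ hp =>
    ⟨hp, hr.trans (Adj.reachable (G := G.induce {c}ᶜ) (u := ⟨q, hq⟩) (v := ⟨p, hp⟩) hpq.symm)⟩
  have hc : G.IsGated {c} := fun x _ => ⟨c, rfl, by simp⟩
  refine h.2.2 ⟨insert c D, Dᶜ, hc.of_boundary hG (by simp) ?_, hc.of_boundary hG (by simpa) ?_,
    ⟨c, by simp, hcD⟩, fun he => ?_, fun he => ?_, ?_, fun u v huv => ?_⟩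
  · rintro p hp q (rfl | hq) hpq
    · rfl
    · exact absurd (Or.inr (hD hpq hq fun h => hp (Or.inl h))) hp
  · intro p hp q hq hpq
    by_contra hqc
    exact hq (hD hpq.symm (not_not.1 hp) hqc)
  · have : b.1 ∈ insert c D := he ▸ Set.mem_univ _
    rcases this with h' | ⟨hb, hr⟩
    · exact b.2 h'
    · exact hab hr
  · have : a.1 ∈ Dᶜ := he ▸ Set.mem_univ _
    exact this ⟨a.2, .refl _⟩
  · ext v
    simp only [Set.mem_union, Set.mem_insert_iff, Set.mem_compl_iff, Set.mem_univ, iff_true]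
    tauto
  · by_cases hu : u ∈ D <;> by_cases hv : v ∈ D
    · exact Or.inl ⟨Or.inr hu, Or.inr hv⟩
    · exact Or.inl ⟨Or.inr hu, or_iff_not_imp_left.2 fun h => hD huv.symm hu h⟩
    · exact Or.inl ⟨or_iff_not_imp_left.2 fun h => hD huv hv h, Or.inr hv⟩
    · exact Or.inr ⟨hu, hv⟩

end SimpleGraph

namespace SimpleGraph

variable {V : Type*} {G : SimpleGraph V}

/-! ### Gated sets in two-connected graphs -/

/-- Otherwise a walk from `w ∉ H` avoiding `g w` could never leave the part of the fibre of `w`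
outside `H`, so `g w` would separate `w` from the rest of `H`. -/
theorem IsGateMap.exists_adj_of_isTwoConnected (hG : G.Connected) {H : Set V} {g : V → V}
    (hg : G.IsGateMap H g) (h2 : G.IsTwoConnected) (hnt : H.Nontrivial) (hne : H ≠ Set.univ) :
    ∃ p q, G.Adj p q ∧ g p ≠ g q ∧ p ∉ H := by
  by_contra! hcon
  obtain ⟨w, hw⟩ := (Set.ne_univ_iff_exists_notMem H).1 hne
  obtain ⟨y, hy, hyx⟩ := hnt.exists_ne (g w)
  have hwx : w ≠ g w := fun h => hw (h ▸ hg.mem w)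
  have key : ∀ (a b : ({g w}ᶜ : Set V)), (G.induce {g w}ᶜ).Walk a b →
      a.1 ∉ H ∧ g a.1 = g w → b.1 ∉ H ∧ g b.1 = g w := by
    intro a b p
    induction p with
    | nil => exact id
    | @cons a b c hab _ ih =>
      intro ha
      refine ih ?_
      have h1 : g b.1 = g w := by
        by_contra h
        exact ha.1 (hcon a.1 b.1 hab (by rw [ha.2]; exact Ne.symm h))
      exact ⟨fun h => b.2 ((hg.eq_self hG h).symm.trans h1), h1⟩
  obtain ⟨p⟩ := (h2.2.2 (g w)).preconnected ⟨w, hwx⟩ ⟨y, hyx⟩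
  exact (key _ _ p ⟨hw, rfl⟩).1 hy

/-- The quadrangle condition slides an edge between two fibres down towards `H` until it is at
height one. -/
theorem IsGateMap.exists_isSquare (hG : G.Connected) (hW : G.IsWeaklyModular) {H : Set V}
    {g : V → V} (hg : G.IsGateMap H g) {p q : V} (hpq : G.Adj p q) (hne : g p ≠ g q)
    (hp : p ∉ H) : ∃ p q, p ∉ H ∧ q ∉ H ∧ g p ≠ g q ∧ G.IsSquare (g p) p q (g q) := by
  have key : ∀ n p q, G.dist (g p) p = n + 1 → G.Adj p q → g p ≠ g q →
      ∃ p q, p ∉ H ∧ q ∉ H ∧ g p ≠ g q ∧ G.IsSquare (g p) p q (g q) := by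
    intro n
    induction n with
    | zero =>
      intro p q hd hpq hne
      have hd' := hg.dist_eq_of_adj hG hpq hne
      have ha := hg.adj_of_adj hG hpq hne
      have h1 := hg.dist_gate_adj ha
      have h2 := hg.dist_gate_adj ha.symm
      have hp : p ∉ H := fun h => by simp [hg.eq_self hG h] at hd
      have hq : q ∉ H := fun h => by simp [hd', hg.eq_self hG h] at hd
      refine ⟨p, q, hp, hq, hne, dist_eq_one_iff_adj.1 hd, hpq,
        (dist_eq_one_iff_adj.1 (hd' ▸ hd)).symm, ha.symm, ?_, ?_, fun h => ?_, fun h => ?_⟩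
      · rintro h
        exact hq (h ▸ hg.mem p)
      · rintro h
        exact hp (h ▸ hg.mem q)
      · rw [dist_eq_one_iff_adj.2 h] at h2
        omega
      · rw [dist_eq_one_iff_adj.2 h.symm] at h1
        omega
    | succ n ih =>
      intro p q hd hpq hne
      have hd' := hg.dist_eq_of_adj hG hpq hne
      have ha := hg.adj_of_adj hG hpq hne
      have h1 := hg.dist_gate_adj ha
      obtain ⟨p', hp', hpd⟩ := hG.exists_adj_dist_add_one (u := g p) (v := p)
        (fun h => by rw [h, dist_self] at hd; omega)
      have hgp := hg.eq_of_adj_dist hG hp' hpd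
      have h2 := hg.dist_gate_adj (u := p') (v := q) (hgp ▸ ha)
      rw [hgp] at h2
      obtain ⟨q', hq1, hq2, hq3⟩ := hW.quadrangle hG (u := g q) hp' hpq.symm
        (by rintro rfl; exact hne hgp.symm) (fun h => by
          have := hg.dist_eq_of_adj hG h (hgp ▸ hne)
          rw [hgp] at this
          omega) (by omega) (by omega)
      have hgq := hg.eq_of_adj_dist hG hq2 (by omega)
      exact ih p' q' (by rw [hgp]; omega) hq1.symm (by rwa [hgp, hgq])
  refine key (G.dist (g p) p - 1) p q ?_ hpq hne
  have : G.dist (g p) p ≠ 0 := fun h => hp (hG.dist_eq_zero_iff.1 h ▸ hg.mem p)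
  omega

/-- Every proper gated set has at most one vertex. -/
def HasTrivialGatedSets (G : SimpleGraph V) : Prop :=
  ∀ A : Set V, G.IsGated A → A.Subsingleton ∨ A = Set.univ

/-- A proper gated set with at least two vertices produces a square with a side in this set. -/
theorem hasTrivialGatedSets_of_isSquare (hG : G.Connected) (hW : G.IsWeaklyModular)
    (h2 : G.IsTwoConnected)
    (h : ∀ (H : Set V) (g : V → V) (p q : V), G.IsGateMap H g → p ∉ H → q ∉ H → g p ≠ g q →
      ¬ G.IsSquare (g p) p q (g q)) : G.HasTrivialGatedSets := by
  intro H hH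
  by_contra! hcon
  obtain ⟨g, hg⟩ := hH.exists_isGateMap
  obtain ⟨p, q, hpq, hne, hp⟩ := hg.exists_adj_of_isTwoConnected hG h2 hcon.1 hcon.2
  obtain ⟨p, q, hp, hq, hne, hsq⟩ := hg.exists_isSquare hG hW hpq hne hp
  exact h H g p q hg hp hq hne hsq

open Classical in
/-- The transport by permutations which is nontrivial around squares with a side in a gated set. -/
noncomputable def gateTransport (H : Set V) (g : V → V) (c u v : V) : Equiv.Perm (Fin 3) :=
  if g u = g v then
    (if u ∈ H then 1 else Equiv.swap 1 2)⁻¹ * (if v ∈ H then 1 else Equiv.swap 1 2)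
  else (if g u = c then 1 else Equiv.swap 0 1)⁻¹ * (if g v = c then 1 else Equiv.swap 0 1)

theorem gateTransport_symm (H : Set V) (g : V → V) (c u v : V) :
    gateTransport H g c u v * gateTransport H g c v u = 1 := by
  unfold gateTransport
  by_cases h : g u = g v
  · rw [if_pos h, if_pos h.symm]
    group
  · rw [if_neg h, if_neg (Ne.symm h)]
    group

/-- A triangle lies in one fibre or meets three fibres, so all its edges use the same one of the two
coboundary formulas. -/
theorem gateTransport_mul (hG : G.Connected) (hW : G.IsWeaklyModular)
    (hL : G.IsLocallyPreMedian) {H : Set V} {g : V → V} (hg : G.IsGateMap H g) (c : V) {u v w : V}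
    (huv : G.Adj u v) (hvw : G.Adj v w) (huw : G.Adj u w) :
    gateTransport H g c u v * gateTransport H g c v w = gateTransport H g c u w := by
  unfold gateTransport
  by_cases h1 : g u = g v <;> by_cases h2 : g v = g w
  · rw [if_pos h1, if_pos h2, if_pos (h1.trans h2)]
    group
  · exact absurd (h1.symm.trans
      (hg.eq_of_triangle hG hW hL h1 huv huw.symm hvw.symm).symm) h2
  · exact absurd (hg.eq_of_triangle hG hW hL h2 hvw huv huw) h1
  · have h3 : g u ≠ g w := fun h3 =>
      h1 (hg.eq_of_triangle hG hW hL h3 huw huv.symm hvw).symm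
    rw [if_neg h1, if_neg h2, if_neg h3]
    group

theorem HasParallelSections.hasTrivialGatedSets (hG : G.Connected) (hP : G.IsPreMedian)
    (h2 : G.IsTwoConnected) (hsec : HasParallelSections.{_, 0} G) : G.HasTrivialGatedSets := by
  refine hasTrivialGatedSets_of_isSquare hG hP.1 h2 fun H g p q hg hp hq hne hsq => ?_
  have hL := hP.isLocallyPreMedian hG
  let X : LocalSystem.{_, 0} G :=
    { fiber := fun _ => Equiv.Perm (Fin 3)
      tr := fun {u v} _ s => s * gateTransport H g (g p) u v
      tr_symm := fun {u v} _ s => by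
        rw [mul_assoc, gateTransport_symm, mul_one]
      tr_tr := fun {u v w} huv hvw huw s => by
        rw [mul_assoc, gateTransport_mul hG hP.1 hL hg _ huv hvw huw] }
  obtain ⟨f, -, hf⟩ := hsec X p 1
  have h1 : f p = f (g p) * _ := hf _ _ hsq.ab
  have h3 : f q = f p * _ := hf _ _ hsq.bc
  have h4 : f (g q) = f q * _ := hf _ _ hsq.cd
  have h5 : f (g p) = f (g q) * _ := hf _ _ hsq.da
  have hgp := hg.eq_self hG (hg.mem p)
  have hgq := hg.eq_self hG (hg.mem q)
  rw [h4, h3, h1, mul_assoc, mul_assoc, mul_assoc, left_eq_mul] at h5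
  simp only [gateTransport, hgp, hgq, hg.mem, hp, hq, hne, hne.symm, if_true, if_false] at h5
  -- The holonomy around the square is the commutator of two transpositions sharing one point.
  have h6 : (1 : Equiv.Perm (Fin 3))⁻¹ * Equiv.swap 1 2 * (1⁻¹ * Equiv.swap 0 1 *
      ((Equiv.swap 1 2)⁻¹ * 1 * ((Equiv.swap 0 1)⁻¹ * 1))) ≠ 1 := by decide
  exact h6 h5

/-! ### Primality -/

theorem dist_boxProd {α β : Type*} {A : SimpleGraph α} {B : SimpleGraph β} (hA : A.Connected)
    (hB : B.Connected) (x y : α × β) :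
    (A □ B).dist x y = A.dist x.1 y.1 + B.dist x.2 y.2 := by
  rw [dist, edist_boxProd, ENat.toNat_add]
  · rfl
  · exact edist_ne_top_iff_reachable.2 (hA.preconnected _ _)
  · exact edist_ne_top_iff_reachable.2 (hB.preconnected _ _)

theorem Connected.dist_map_le {W : Type*} {G' : SimpleGraph W} (hG : G.Connected) (f : G →g G')
    (u v : V) : G'.dist (f u) (f v) ≤ G.dist u v := by
  obtain ⟨p, hp⟩ := hG.exists_walk_length_eq_dist u v
  rw [← hp, ← p.length_map f]
  exact dist_le _

theorem Connected.dist_map_iso {W : Type*} {G' : SimpleGraph W} (hG : G.Connected) (φ : G ≃g G')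
    (u v : V) : G'.dist (φ u) (φ v) = G.dist u v := by
  refine le_antisymm (hG.dist_map_le φ.toHom u v) ?_
  simpa using (φ.connected_iff.1 hG).dist_map_le φ.symm.toHom (φ u) (φ v)

/-- A layer of a product is a proper gated set with two vertices, and two intersecting sets with at
most one vertex each cannot cover an amalgam. -/
theorem HasTrivialGatedSets.isPrime (hG : G.Connected) (hV : Nontrivial V)
    (h : G.HasTrivialGatedSets) : G.IsPrime := by
  refine ⟨hV, ?_, ?_⟩
  · rintro ⟨α, β, A, B, hα, hβ, ⟨φ⟩⟩
    have hAB : (A □ B).Connected := φ.connected_iff.1 hG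
    obtain ⟨a, a', ha⟩ := hα
    obtain ⟨b, b', hb⟩ := hβ
    have hgated : G.IsGated {u | (φ u).2 = b} := by
      intro u _
      refine ⟨φ.symm ((φ u).1, b), by simp, fun y (hy : (φ y).2 = b) => ?_⟩
      have hd := dist_boxProd hAB.ofBoxProdLeft hAB.ofBoxProdRight
      rw [← hG.dist_map_iso φ u, ← hG.dist_map_iso φ _ y, ← hG.dist_map_iso φ u]
      simp [hd, hy, add_comm]
    rcases h _ hgated with h | h
    · have := h (x := φ.symm (a, b)) (by simp) (y := φ.symm (a', b)) (by simp)
      simp [ha] at this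
    · have : φ.symm (a, b') ∈ {u | (φ u).2 = b} := h ▸ Set.mem_univ _
      simp [hb.symm] at this
  · rintro ⟨A, B, hA, hB, ⟨x, hxA, hxB⟩, hA', hB', hAB, -⟩
    have h1 := (h A hA).resolve_right hA'
    have h2 := (h B hB).resolve_right hB'
    refine hA' (Set.eq_univ_of_forall fun y => ?_)
    have : y ∈ A ∪ B := hAB ▸ Set.mem_univ y
    rcases this with hy | hy
    · exact hy
    · exact h2 hy hxB ▸ hxA

end SimpleGraph

namespace SimpleGraph

variable {V : Type*} {G : SimpleGraph V}

/-! ### Parallel sections from squares in wheels or in `M₄` -/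

namespace LocalSystem

variable (X : LocalSystem G)

theorem tr_square {a b c d : V} (hsq : G.IsSquare a b c d) (h : G.IsGoodSquare a b c d)
    (s : X.fiber a) :
    X.tr hsq.bc (X.tr hsq.ab s) = X.tr hsq.cd.symm (X.tr hsq.da.symm s) := by
  rcases h with ⟨k, ha, hb, hc, hd⟩ | ⟨p, q, r, s', hp, hq, hr, hs, h1, h2, h3, h4, h5, h6⟩
  · rw [← X.tr_tr ha.symm hb hsq.ab, X.tr_tr hb hsq.bc hc, ← X.tr_tr ha.symm hd hsq.da.symm,
      X.tr_tr hd hsq.cd.symm hc]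
  · rw [← X.tr_tr hp.1.symm hp.2.1 hsq.ab, ← X.tr_tr hq.2.1.symm hq.2.2.1 hsq.bc,
      X.tr_tr hp.2.1 hq.2.1.symm h1, ← X.tr_tr hs.1.symm hs.2.2.2 hsq.da.symm,
      ← X.tr_tr hr.2.2.2.symm hr.2.2.1 hsq.cd.symm, X.tr_tr hs.2.2.2 hr.2.2.2.symm h3.symm,
      ← X.tr_tr hp.1.symm h4.symm hs.1.symm, X.tr_tr h4.symm h3.symm h5, ← X.tr_tr h1 h2 h5,
      X.tr_tr h2 hr.2.2.1 hq.2.2.1]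

/-- The values obtained by transport from `v₀` along geodesics. -/
inductive Reach {v₀ : V} (s₀ : X.fiber v₀) : ∀ v, X.fiber v → Prop
  | base : Reach s₀ v₀ s₀
  | step {u v : V} (h : G.Adj u v) (hd : G.dist v₀ u + 1 = G.dist v₀ v) {s : X.fiber u} :
      Reach s₀ u s → Reach s₀ v (X.tr h s)

variable {X} {v₀ : V} {s₀ : X.fiber v₀}

theorem exists_reach (hG : G.Connected) (s₀ : X.fiber v₀) : ∀ v, ∃ s, X.Reach s₀ v s := by
  have key : ∀ n v, G.dist v₀ v = n → ∃ s, X.Reach s₀ v s := by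
    intro n
    induction n with
    | zero =>
      intro v hv
      obtain rfl := hG.dist_eq_zero_iff.1 hv
      exact ⟨s₀, .base⟩
    | succ n ih =>
      intro v hv
      obtain ⟨u, hu, hd⟩ := hG.exists_adj_dist_add_one (u := v₀) (v := v)
        (by rintro rfl; simp at hv)
      obtain ⟨s, hs⟩ := ih u (by omega)
      exact ⟨_, hs.step hu hd⟩
  exact fun v => key _ v rfl

theorem Reach.eq_base {s : X.fiber v₀} (h : X.Reach s₀ v₀ s) : s = s₀ := by
  cases h with
  | base => rfl
  | step h hd _ => simp at hd

/-- Two last steps into `v` come from `u` and `w` with a common neighbour `e` one level lower. By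
induction both values come from `e`, and the triangles or the good square make them agree. -/
theorem Reach.unique (hG : G.Connected) (hW : G.IsWeaklyModular)
    (hgood : ∀ a b c d, G.IsSquare a b c d → G.IsGoodSquare a b c d) :
    ∀ n v s s', G.dist v₀ v = n → X.Reach s₀ v s → X.Reach s₀ v s' → s = s' := by
  intro n
  induction n with
  | zero =>
    intro v s s' hv hs hs'
    obtain rfl := hG.dist_eq_zero_iff.1 hv
    rw [hs.eq_base, hs'.eq_base]
  | succ n ih =>
    intro v s s' hv hs hs'
    cases hs with
    | base => simp at hv
    | @step u _ hu hud t ht =>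
      cases hs' with
      | base => simp at hv
      | @step w _ hw hwd t' ht' =>
        by_cases hne : u = w
        · subst hne
          rw [ih u t t' (by omega) ht ht']
        by_cases hadj : G.Adj u w
        · obtain ⟨e, he1, he2, he3⟩ := hW.triangle hG (u := v₀) hadj (by omega)
          obtain ⟨r, hr⟩ := exists_reach hG s₀ e
          rw [ih u t _ (by omega) ht (hr.step he1 he3),
            ih w t' _ (by omega) ht' (hr.step he2 (by omega)), ← X.tr_tr he1 hadj he2,
            X.tr_tr hadj hw hu]
        · obtain ⟨e, he1, he2, he3⟩ := hW.quadrangle hG hu hw hne hadj hud hwd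
          obtain ⟨r, hr⟩ := exists_reach hG s₀ e
          rw [ih u t _ (by omega) ht (hr.step he1 he3),
            ih w t' _ (by omega) ht' (hr.step he2 (by omega))]
          have hnot : ¬ G.Adj e v := fun h => by
            have := h.symm.dist_le_dist_add_one hG v₀
            omega
          have hsq : G.IsSquare e u v w := ⟨he1, hu, hw.symm, he2.symm, by rintro rfl; omega,
            hne, hnot, hadj⟩
          exact X.tr_square hsq (hgood _ _ _ _ hsq) r

end LocalSystem

theorem hasParallelSections_of_isGoodSquare.{w} (hG : G.Connected) (hW : G.IsWeaklyModular)
    (hgood : ∀ a b c d, G.IsSquare a b c d → G.IsGoodSquare a b c d) :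
    HasParallelSections.{_, w} G := by
  intro X v₀ s₀
  choose f hf using LocalSystem.exists_reach (X := X) hG s₀
  have huniq := LocalSystem.Reach.unique (X := X) (s₀ := s₀) hG hW hgood
  refine ⟨f, (hf v₀).eq_base, fun u v h => ?_⟩
  have h1 := h.dist_le_dist_add_one hG v₀
  have h2 := h.symm.dist_le_dist_add_one hG v₀
  rcases lt_trichotomy (G.dist v₀ u) (G.dist v₀ v) with h3 | h3 | h3
  · exact huniq _ v _ _ rfl (hf v) ((hf u).step h (by omega))
  · obtain ⟨e, he1, he2, he3⟩ := hW.triangle hG h h3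
    rw [huniq _ u _ _ rfl (hf u) ((hf e).step he1 he3),
      huniq _ v _ _ rfl (hf v) ((hf e).step he2 (by omega)), X.tr_tr]
  · rw [huniq _ u _ _ rfl (hf u) ((hf v).step h.symm (by omega))]
    exact (X.tr_symm h.symm _).symm

/-! ### The equivalence -/

theorem exists_mem_triangleComplex_of_adj {u v : V} (h : G.Adj u v) :
    ∃ s ∈ G.triangleComplex, u ∈ s ∧ v ∈ s := by
  classical
  refine ⟨{u, v}, ⟨⟨u, by simp⟩, ?_, ?_⟩, by simp, by simp⟩
  · simpa [isClique_insert] using fun _ => h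
  · exact (Finset.card_le_two).trans (by omega)

theorem exists_mem_triangleComplex_of_triangle {u v w : V} (huv : G.Adj u v) (hvw : G.Adj v w)
    (huw : G.Adj u w ∨ u = w) : ∃ s ∈ G.triangleComplex, u ∈ s ∧ v ∈ s ∧ w ∈ s := by
  rcases huw with huw | rfl
  · classical
    refine ⟨{u, v, w}, ⟨⟨u, by simp⟩, ?_, Finset.card_le_three⟩, by simp, by simp, by simp⟩
    simp [isClique_insert, huv, hvw, huw]
  · obtain ⟨s, hs, h1, h2⟩ := exists_mem_triangleComplex_of_adj huv
    exact ⟨s, hs, h1, h2, h1⟩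

theorem triangleComplex_le_cliqueComplex : ∀ s ∈ G.triangleComplex, s ∈ G.cliqueComplex :=
  fun _ hs => ⟨hs.1, hs.2.1⟩

end SimpleGraph

theorem mainTheorem4 {V : Type*} (G : SimpleGraph V) (hG : G.Connected) :
    List.TFAE
      [ G.IsPrime ∧ G.IsPreMedian,
        G.IsTwoConnected ∧ G.IsPreMedian ∧ G.SquaresInWheelFourOrMFour,
        G.IsTwoConnected ∧ G.IsPreMedian ∧ SimplyConnectedSpace G.triangleComplex.Realization,
        G.IsTwoConnected ∧ G.IsPreMedian ∧ SimplyConnectedSpace G.cliqueComplex.Realization,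
        G.IsTwoConnected ∧ G.IsLocallyWeaklyModular ∧
          ¬ completeBipartiteGraph (Fin 2) (Fin 3) ⊴ G ∧ ¬ SimpleGraph.almostWheelFour ⊴ G ∧
          SimplyConnectedSpace G.triangleComplex.Realization ] := by
  have hprime : G.IsTwoConnected → G.IsPreMedian → SimpleGraph.HasParallelSections.{_, 0} G → G.IsPrime :=
    fun h2 hP hsec => (hsec.hasTrivialGatedSets hG hP h2).isPrime hG h2.1
  tfae_have 1 → 2 := fun ⟨h, hP⟩ => ⟨h.isTwoConnected hG, hP,
    SimpleGraph.squaresInWheelFourOrMFour_iff.2 fun _ _ _ _ hsq => h.isGoodSquare hG hP hsq⟩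
  tfae_have 2 → 3 := fun ⟨h2, hP, hsq⟩ => ⟨h2, hP,
    SimpleGraph.simplyConnectedSpace_of_hasParallelSections hG _ (fun _ hs => hs.2.1)
      (fun _ _ _ => SimpleGraph.exists_mem_triangleComplex_of_triangle)
      (SimpleGraph.hasParallelSections_of_isGoodSquare hG hP.1 (SimpleGraph.squaresInWheelFourOrMFour_iff.1 hsq))⟩
  tfae_have 2 → 4 := fun ⟨h2, hP, hsq⟩ => ⟨h2, hP,
    SimpleGraph.simplyConnectedSpace_of_hasParallelSections hG _ (fun _ hs => hs.2)
      (fun _ _ _ h h' h'' => by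
        obtain ⟨s, hs, hmem⟩ := SimpleGraph.exists_mem_triangleComplex_of_triangle h h' h''
        exact ⟨s, SimpleGraph.triangleComplex_le_cliqueComplex s hs, hmem⟩)
      (SimpleGraph.hasParallelSections_of_isGoodSquare hG hP.1 (SimpleGraph.squaresInWheelFourOrMFour_iff.1 hsq))⟩
  tfae_have 3 → 1 := fun ⟨h2, hP, _⟩ => ⟨hprime h2 hP
    (SimpleGraph.hasParallelSections_of_simplyConnectedSpace hG G.triangleComplex (fun _ hs => hs.2.1)
      fun _ _ => SimpleGraph.exists_mem_triangleComplex_of_adj), hP⟩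
  tfae_have 4 → 1 := fun ⟨h2, hP, _⟩ => ⟨hprime h2 hP
    (SimpleGraph.hasParallelSections_of_simplyConnectedSpace hG G.cliqueComplex (fun _ hs => hs.2)
      fun _ _ h => by
        obtain ⟨s, hs, hmem⟩ := SimpleGraph.exists_mem_triangleComplex_of_adj h
        exact ⟨s, SimpleGraph.triangleComplex_le_cliqueComplex s hs, hmem⟩), hP⟩
  tfae_have 3 → 5 := fun ⟨h2, hP, hsc⟩ => ⟨h2, hP.1.isLocallyWeaklyModular, hP.2.1, hP.2.2, hsc⟩
  tfae_have 5 → 3 := fun ⟨h2, hLW, hK, hWh, hsc⟩ => ⟨h2, ⟨hLW.isWeaklyModular hG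
    (SimpleGraph.hasParallelSections_of_simplyConnectedSpace hG G.triangleComplex (fun _ hs => hs.2.1)
      fun _ _ => SimpleGraph.exists_mem_triangleComplex_of_adj), hK, hWh⟩, hsc⟩
  tfae_finish
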